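/- Let $(S,\mathcal F,\delta_0)$ and $(A,\mathcal A,\varrho)$ be complete separable metric spaces with their Borel $\sigma$-algebras and $\sigma$-finite measures $\lambda$ on $S$ and $\tau$ on $A$. Let $\mathcal H=\{(S,\mathcal F,\delta_0),(p,\lambda),(A,\mathcal A,\varrho),(m,\tau)\}$ be a hidden Markov model (HMM) with densities. That is, $m:S\times S\times A\to[0,\infty)$ is measurable with $\int_S\int_A m(s,t,a)\,\tau(da)\,\lambda(dt)=1$ for all $s\in S$, and $p:S\times S\to[0,\infty)$ is $p(s,t)=\int_A m(s,t,a)\,\tau(da)$. Let $P(s,F)=\int_F p(s,t)\,\lambda(dt)$ be its Markov kernel. **Definitions.** For finite measures put $\|\mu-\nu\|=\sup_F(\mu(F)-\nu(F))+\sup_F(\nu(F)-\mu(F))$, the suprema being over all measurable sets. Let $\mathcal Q_\lambda$ (resp. $K$) be the set of finite nonnegative measures (resp. probability measures) on $S$ that have a density with respect to $\lambda$, with the metric $\|\cdot-\cdot\|$ and its Borel $\sigma$-algebra. For $x\in\mathcal Q_\lambda$ and $a\in A$ let $xM_a(F)=\int_S\int_F m(s,t,a)\,\lambda(dt)\,x(ds)$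 and $\|xM_a\|=xM_a(S)$. $\mathcal H$ is *regular* if $(x,a)\mapsto xM_a$ is a well-defined continuous map $\mathcal Q_\lambda\times A\to\mathcal Q_\lambda$. In that case its *filter kernel* is the transition probability function on $K$ $$\mathbf P(x,E)=\int_{\{a:\,\|xM_a\|>0\}} 1_E\!\left(\frac{xM_a}{\|xM_a\|}\right)\|xM_a\|\,\tau(da).$$ $\mathcal H$ is *strongly ergodic* with limit (stationary) measure $\pi$, a probability measure on $S$, if $\|P^n(s,\cdot)-\pi\|\to0$ for every $s\in S$. It is *uniformly ergodic* if moreover $\sup_{s\in S}\|P^n(s,\cdot)-\pi\|\to0$. A transition probability function $Q$ on a metric space $X$ is *weakly contracting* if for all $x,y\in X$ $$\lim_{n\to\infty}\ \sup_u\Big(\int u\,dQ^n(x,\cdot)-\int u\,dQ^n(y,\cdot)\Big)=0,$$ the supremum being over all bounded continuous $u:X\to\mathbb R$ with Lipschitz constant at most $1$. It is *weakly ergodic* if it is weakly contracting and there is a probability measure $\nu$ on $X$ such that $\int u\,dQ^n(x,\cdot)\to\int u\,d\nu$ for every bounded continuous $u:X\to\mathbb R$ and every $x\in X$. **Theorem.**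 Suppose $m(s,t,a)=p(s,t)q(t,a)$ for all $s,t,a$, where $q:S\times A\to[0,\infty)$ is measurable with $\int_A q(t,a)\,\tau(da)=1$ for all $t\in S$, and $\sup_{s,t}p(s,t)<\infty$ and $\sup_{t,a}q(t,a)<\infty$. Put $S_+(a)=\{t\in S:q(t,a)>0\}$. Suppose that $\lambda(S_+(a))>0$ for all $a\in A$, and that for every $\epsilon>0$ there is $\eta>0$ such that for all $a,b\in A$ with $\varrho(a,b)<\eta$ we have $\lambda(S_+(a)\,\triangle\,S_+(b))<\epsilon$ and $|q(t,a)-q(t,b)|<\epsilon$ for all $t\in S_+(a)\cap S_+(b)$. Suppose further that $\mathcal H$ is strongly ergodic with limit measure $\pi$, and that there are sets $F_0\in\mathcal F$ and $B_0\in\mathcal A$ and constants $\beta_0,c_0,c_1>0$ such that 1. $\pi(F_0)>0$; 2. $\tau(B_0)>0$; 3. $S_+(a)\subset F_0$ for all $a\in B_0$; 4. $\lambda(S_+(a))\ge\beta_0$ for all $a\in B_0$; 5. $\{t:0<q(t,a)<c_0\}=\emptyset$ for all $a\in B_0$; 6. $p(s,t)\ge c_1$ for all $(s,t)\in F_0\times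 F_0$. Then $\mathcal H$ is regular and its filter kernel $\mathbf P$ is weakly contracting. If furthermore $\mathcal H$ is uniformly ergodic, then $\mathbf P$ is weakly ergodic. -/

import Mathlib

open MeasureTheory ProbabilityTheory Filter Topology
open scoped ENNReal NNReal BoundedContinuousFunction

namespace HiddenMarkov

noncomputable section

section TotalVariation

variable {X : Type*} [MeasurableSpace X]

/-- The total variation distance of two finite measures,
`sup {μ F - ν F} + sup {ν F - μ F}`, both suprema over all measurable sets `F`
(the suprema are finite when `μ` and `ν` are finite). -/
def tvDist (μ ν : Measure X) : ℝ :=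
  (⨆ F : {F : Set X // MeasurableSet F}, (μ.real F.1 - ν.real F.1)) +
    ⨆ F : {F : Set X // MeasurableSet F}, (ν.real F.1 - μ.real F.1)

theorem bddAbove_sub (μ ν : Measure X) [IsFiniteMeasure μ] :
    BddAbove (Set.range fun F : {F : Set X // MeasurableSet F} => μ.real F.1 - ν.real F.1) := by
  refine ⟨μ.real Set.univ, ?_⟩
  rintro _ ⟨F, rfl⟩
  have h1 : μ.real F.1 ≤ μ.real Set.univ := measureReal_mono (Set.subset_univ _)
  have h2 : 0 ≤ ν.real F.1 := measureReal_nonneg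
  simp only
  linarith

instance : Nonempty {F : Set X // MeasurableSet F} := ⟨⟨∅, MeasurableSet.empty⟩⟩

theorem sub_le_iSup (μ ν : Measure X) [IsFiniteMeasure μ] {F : Set X} (hF : MeasurableSet F) :
    μ.real F - ν.real F ≤
      ⨆ F : {F : Set X // MeasurableSet F}, (μ.real F.1 - ν.real F.1) :=
  le_ciSup (f := fun F : {F : Set X // MeasurableSet F} => μ.real F.1 - ν.real F.1)
    (bddAbove_sub μ ν) ⟨F, hF⟩

theorem iSup_sub_nonneg (μ ν : Measure X) [IsFiniteMeasure μ] :
    0 ≤ ⨆ F : {F : Set X // MeasurableSet F}, (μ.real F.1 - ν.real F.1) := by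
  have h := sub_le_iSup μ ν (MeasurableSet.empty)
  simpa using h

theorem sub_le_tvDist (μ ν : Measure X) [IsFiniteMeasure μ] [IsFiniteMeasure ν] {F : Set X}
    (hF : MeasurableSet F) : μ.real F - ν.real F ≤ tvDist μ ν := by
  have h1 := sub_le_iSup μ ν hF
  have h2 := iSup_sub_nonneg ν μ
  unfold tvDist
  linarith

theorem tvDist_comm (μ ν : Measure X) : tvDist μ ν = tvDist ν μ := by
  unfold tvDist
  rw [add_comm]

theorem abs_sub_le_tvDist (μ ν : Measure X) [IsFiniteMeasure μ] [IsFiniteMeasure ν] {F : Set X}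
    (hF : MeasurableSet F) : |μ.real F - ν.real F| ≤ tvDist μ ν := by
  rw [abs_le]
  have h1 := sub_le_tvDist μ ν hF
  have h2 := sub_le_tvDist ν μ hF
  rw [tvDist_comm] at h2
  constructor <;> linarith

theorem tvDist_le (μ ν : Measure X) {c : ℝ}
    (h : ∀ F, MeasurableSet F → |μ.real F - ν.real F| ≤ c) : tvDist μ ν ≤ c + c := by
  unfold tvDist
  refine add_le_add (ciSup_le fun F => ?_) (ciSup_le fun F => ?_)
  · exact (le_abs_self _).trans (h F.1 F.2)
  · have := h F.1 F.2
    rw [abs_sub_comm] at this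
    exact (le_abs_self _).trans this

theorem tvDist_self (μ : Measure X) : tvDist μ μ = 0 := by
  simp [tvDist]

theorem tvDist_triangle (μ ν ρ : Measure X) [IsFiniteMeasure μ] [IsFiniteMeasure ν]
    [IsFiniteMeasure ρ] : tvDist μ ρ ≤ tvDist μ ν + tvDist ν ρ := by
  have key : ∀ (a b c : Measure X) [IsFiniteMeasure a] [IsFiniteMeasure b] [IsFiniteMeasure c],
      (⨆ F : {F : Set X // MeasurableSet F}, (a.real F.1 - c.real F.1)) ≤
        (⨆ F : {F : Set X // MeasurableSet F}, (a.real F.1 - b.real F.1)) +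
        ⨆ F : {F : Set X // MeasurableSet F}, (b.real F.1 - c.real F.1) := by
    intro a b c _ _ _
    refine ciSup_le fun F => ?_
    have h1 := sub_le_iSup a b F.2
    have h2 := sub_le_iSup b c F.2
    linarith
  have h1 := key μ ν ρ
  have h2 := key ρ ν μ
  unfold tvDist
  linarith

end TotalVariation

section Ergodicity

variable {X : Type*} [MeasurableSpace X]

/-- A transition kernel `Q` is strongly ergodic with limit measure `π`: `π` is a probability
measure and `Q ^ n x` converges to `π` in total variation for every starting point `x`. -/
def StronglyErgodicWith (Q : Kernel X X) (π : Measure X) : Prop :=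
  IsProbabilityMeasure π ∧ ∀ x : X, Tendsto (fun n : ℕ => tvDist ((Q ^ n) x) π) atTop (𝓝 0)

/-- A transition kernel is uniformly ergodic if it is strongly ergodic and the convergence in
total variation to the limit measure is uniform in the starting point. -/
def UniformlyErgodic (Q : Kernel X X) : Prop :=
  ∃ π : Measure X, StronglyErgodicWith Q π ∧
    Tendsto (fun n : ℕ => ⨆ x : X, ENNReal.ofReal (tvDist ((Q ^ n) x) π)) atTop (𝓝 0)

variable [MetricSpace X]

/-- A transition kernel on a metric space is weakly contracting if for all `x`, `y`
`sup {∫ u d(Q ^ n x) - ∫ u d(Q ^ n y)}` tends to zero, the supremum being taken over all bounded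
continuous `u` with Lipschitz constant at most one. (As `u` may be replaced by `-u`, taking
positive parts does not change the supremum.) -/
def WeaklyContracting (Q : Kernel X X) : Prop :=
  ∀ x y : X, Tendsto
    (fun n : ℕ => ⨆ u : {u : X →ᵇ ℝ // LipschitzWith 1 u},
      ENNReal.ofReal (∫ z, u.1 z ∂((Q ^ n) x) - ∫ z, u.1 z ∂((Q ^ n) y)))
    atTop (𝓝 0)

/-- A transition kernel on a metric space is weakly ergodic if it is weakly contracting and there
is a probability measure `π` to which `Q ^ n x` converges weakly for every `x`. -/
def WeaklyErgodic (Q : Kernel X X) : Prop :=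
  WeaklyContracting Q ∧ ∃ π : Measure X, IsProbabilityMeasure π ∧
    ∀ (u : X →ᵇ ℝ) (x : X),
      Tendsto (fun n : ℕ => ∫ z, u z ∂((Q ^ n) x)) atTop (𝓝 (∫ z, u z ∂π))

end Ergodicity

/-- The finite nonnegative measures on `S` that have a density with respect to `lam`. -/
@[ext]
structure FiniteDensityMeasure {S : Type*} [MeasurableSpace S] (lam : Measure S) where
  toMeasure : Measure S
  isFiniteMeasure : IsFiniteMeasure toMeasure
  exists_density : ∃ f : S → ℝ≥0, Measurable f ∧
    ∀ F : Set S, MeasurableSet F → toMeasure F = ∫⁻ t in F, (f t : ℝ≥0∞) ∂lam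

namespace FiniteDensityMeasure

variable {S : Type*} [MeasurableSpace S] {lam : Measure S}

instance (x : FiniteDensityMeasure lam) : IsFiniteMeasure x.toMeasure := x.isFiniteMeasure

/-- The set of finite measures with a density carries the total variation metric. -/
instance : MetricSpace (FiniteDensityMeasure lam) where
  dist x y := tvDist x.toMeasure y.toMeasure
  dist_self x := tvDist_self _
  dist_comm x y := tvDist_comm _ _
  dist_triangle x y z := tvDist_triangle _ _ _
  eq_of_dist_eq_zero := by
    intro x y h
    change tvDist x.toMeasure y.toMeasure = 0 at h
    ext F hF
    have h1 := abs_sub_le_tvDist x.toMeasure y.toMeasure hF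
    rw [h] at h1
    have h2 : x.toMeasure.real F = y.toMeasure.real F :=
      sub_eq_zero.1 (abs_eq_zero.1 (le_antisymm h1 (abs_nonneg _)))
    exact (measureReal_eq_measureReal_iff).1 h2

theorem dist_def (x y : FiniteDensityMeasure lam) :
    dist x y = tvDist x.toMeasure y.toMeasure := rfl

/-- The Borel σ-algebra of the total variation metric. -/
instance : MeasurableSpace (FiniteDensityMeasure lam) := borel _

instance : BorelSpace (FiniteDensityMeasure lam) := ⟨rfl⟩

end FiniteDensityMeasure

/-- The set `K` of probability measures on `S` that have a density with respect to `lam`, with the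
total variation metric and its Borel σ-algebra. -/
abbrev DensityProbability {S : Type*} [MeasurableSpace S] (lam : Measure S) : Type _ :=
  {x : FiniteDensityMeasure lam // x.toMeasure Set.univ = 1}

/-- A hidden Markov model with densities: σ-finite base measures `lam` on the state space `S` and
`tau` on the observation space `A`, a measurable probability density kernel
`m : S × S × A → [0, ∞)` with respect to `lam ⊗ tau`, and the density
`p s t = ∫ m s t a tau(da)` of the transition kernel of the hidden Markov chain. -/
structure DensityHMM (S A : Type*) [MeasurableSpace S] [MeasurableSpace A] where
  lam : Measure S
  tau : Measure A
  p : S → S → ℝ≥0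
  m : S → S → A → ℝ≥0
  sigmaFinite_lam : SigmaFinite lam
  sigmaFinite_tau : SigmaFinite tau
  measurable_m : Measurable fun z : S × S × A => m z.1 z.2.1 z.2.2
  lintegral_m : ∀ s, ∫⁻ t, ∫⁻ a, (m s t a : ℝ≥0∞) ∂tau ∂lam = 1
  p_eq : ∀ s t, (p s t : ℝ≥0∞) = ∫⁻ a, (m s t a : ℝ≥0∞) ∂tau

namespace DensityHMM

variable {S A : Type*} [MeasurableSpace S] [MeasurableSpace A] (H : DensityHMM S A)

instance : SigmaFinite H.lam := H.sigmaFinite_lam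

instance : SigmaFinite H.tau := H.sigmaFinite_tau

theorem measurable_m_coe :
    Measurable fun z : S × S × A => (H.m z.1 z.2.1 z.2.2 : ℝ≥0∞) :=
  H.measurable_m.coe_nnreal_ennreal

/-- The HMM-kernel `M(s, ·)`, with density `m s` with respect to `lam ⊗ tau`. -/
def hmmKernel : Kernel S (S × A) :=
  Kernel.withDensity (Kernel.const S (H.lam.prod H.tau))
    fun s z => (H.m s z.1 z.2 : ℝ≥0∞)

/-- The Markov kernel `P(s, F) = M(s, F × A)` of the hidden Markov chain. -/
def markovKernel : Kernel S S := H.hmmKernel.fst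

theorem hmmKernel_apply_prod (s : S) (F : Set S) (B : Set A) :
    H.hmmKernel s (F ×ˢ B) = ∫⁻ t in F, ∫⁻ a in B, (H.m s t a : ℝ≥0∞) ∂H.tau ∂H.lam := by
  have hm : Measurable fun z : S × A => (H.m s z.1 z.2 : ℝ≥0∞) :=
    H.measurable_m_coe.comp measurable_prodMk_left
  rw [hmmKernel, Kernel.withDensity_apply' _ (by exact H.measurable_m_coe), Kernel.const_apply,
    ← Measure.prod_restrict, lintegral_prod _ hm.aemeasurable]

theorem markovKernel_apply (s : S) {F : Set S} (hF : MeasurableSet F) :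
    H.markovKernel s F = ∫⁻ t in F, (H.p s t : ℝ≥0∞) ∂H.lam := by
  rw [markovKernel, Kernel.fst_apply' _ _ hF]
  have h : {z : S × A | z.1 ∈ F} = F ×ˢ Set.univ := by ext; simp
  rw [h, hmmKernel_apply_prod]
  simp [H.p_eq]

/-- The measure `x M_a`, that is `F ↦ ∫ ∫_F m s t a lam(dt) x(ds)`, given here through its density
`t ↦ ∫ m s t a x(ds)` with respect to `lam`. -/
def stepMeasure (x : FiniteDensityMeasure H.lam) (a : A) : Measure S :=
  H.lam.withDensity fun t => ∫⁻ s, (H.m s t a : ℝ≥0∞) ∂x.toMeasure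

theorem measurable_stepDensity (x : FiniteDensityMeasure H.lam) :
    Measurable fun z : A × S => ∫⁻ s, (H.m s z.2 z.1 : ℝ≥0∞) ∂x.toMeasure := by
  refine Measurable.lintegral_prod_right' (f := fun w : (A × S) × S =>
    (H.m w.2 w.1.2 w.1.1 : ℝ≥0∞)) ?_
  exact H.measurable_m_coe.comp
    (measurable_snd.prodMk ((measurable_snd.comp measurable_fst).prodMk
      (measurable_fst.comp measurable_fst)))

theorem stepMeasure_apply (x : FiniteDensityMeasure H.lam) (a : A) {F : Set S}
    (hF : MeasurableSet F) :
    H.stepMeasure x a F = ∫⁻ s, ∫⁻ t in F, (H.m s t a : ℝ≥0∞) ∂H.lam ∂x.toMeasure := by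
  rw [stepMeasure, withDensity_apply _ hF]
  refine lintegral_lintegral_swap ?_
  refine Measurable.aemeasurable ?_
  exact H.measurable_m_coe.comp (measurable_snd.prodMk (measurable_fst.prodMk measurable_const))

/-- A hidden Markov model with densities is regular if `(x, a) ↦ x M_a` is a well defined (in
particular, every `x M_a` is a finite measure) and continuous map from `Q × A` to `Q`, where `Q`
is the set of finite measures with a density, with the total variation metric. -/
def IsRegular [TopologicalSpace A] : Prop :=
  ∃ Mbar : FiniteDensityMeasure H.lam × A → FiniteDensityMeasure H.lam, Continuous Mbar ∧
    ∀ x a, (Mbar (x, a)).toMeasure = H.stepMeasure x a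

/-- The function `g (x, a) = ‖x M_a‖`. -/
def obsDensity (x : DensityProbability H.lam) (a : A) : ℝ≥0∞ := H.stepMeasure x.1 a Set.univ

theorem normalized_exists_density (x : FiniteDensityMeasure H.lam) (a : A)
    (h0 : H.stepMeasure x a Set.univ ≠ 0) (h : H.stepMeasure x a Set.univ ≠ ∞) :
    ∃ f : S → ℝ≥0, Measurable f ∧ ∀ F : Set S, MeasurableSet F →
      ((H.stepMeasure x a Set.univ)⁻¹ • H.stepMeasure x a) F =
        ∫⁻ t in F, (f t : ℝ≥0∞) ∂H.lam := by
  have hd : Measurable fun t => ∫⁻ s, (H.m s t a : ℝ≥0∞) ∂x.toMeasure :=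
    (H.measurable_stepDensity x).comp measurable_prodMk_left
  have hfin : ∀ᵐ t ∂H.lam, (∫⁻ s, (H.m s t a : ℝ≥0∞) ∂x.toMeasure) < ∞ := by
    refine ae_lt_top hd ?_
    rwa [stepMeasure, withDensity_apply _ MeasurableSet.univ, Measure.restrict_univ] at h
  refine ⟨fun t => ((H.stepMeasure x a Set.univ)⁻¹ *
    ∫⁻ s, (H.m s t a : ℝ≥0∞) ∂x.toMeasure).toNNReal, (hd.const_mul _).ennreal_toNNReal, ?_⟩
  intro F hF
  have hF' : H.stepMeasure x a F = ∫⁻ t in F, ∫⁻ s, (H.m s t a : ℝ≥0∞) ∂x.toMeasure ∂H.lam := by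
    rw [stepMeasure, withDensity_apply _ hF]
  rw [Measure.smul_apply, smul_eq_mul, hF', ← lintegral_const_mul _ hd]
  refine lintegral_congr_ae (ae_restrict_of_ae ?_)
  filter_upwards [hfin] with t ht
  rw [ENNReal.coe_toNNReal]
  exact ENNReal.mul_ne_top (ENNReal.inv_ne_top.2 h0) ht.ne

open Classical in
/-- The filter update `h (x, a) = x M_a / ‖x M_a‖` if `‖x M_a‖ > 0`, and `h (x, a) = x`
otherwise. -/
def filterUpdate (x : DensityProbability H.lam) (a : A) : DensityProbability H.lam :=
  if h : H.obsDensity x a ≠ 0 ∧ H.obsDensity x a ≠ ∞ then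
    ⟨⟨(H.obsDensity x a)⁻¹ • H.stepMeasure x.1 a,
      ⟨by
        rw [Measure.smul_apply, smul_eq_mul]
        exact (ENNReal.inv_mul_cancel h.1 h.2).trans_lt ENNReal.one_lt_top⟩,
      H.normalized_exists_density x.1 a h.1 h.2⟩,
      by
        rw [Measure.smul_apply, smul_eq_mul]
        exact ENNReal.inv_mul_cancel h.1 h.2⟩
  else x

theorem filterUpdate_toMeasure (x : DensityProbability H.lam) (a : A)
    (h0 : H.obsDensity x a ≠ 0) (h : H.obsDensity x a ≠ ∞) :
    (H.filterUpdate x a).1.toMeasure = (H.obsDensity x a)⁻¹ • H.stepMeasure x.1 a := by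
  rw [filterUpdate, dif_pos ⟨h0, h⟩]

variable {H}

theorem IsRegular.obsDensity_ne_top [TopologicalSpace A] (hH : H.IsRegular)
    (x : DensityProbability H.lam) (a : A) : H.obsDensity x a ≠ ∞ := by
  obtain ⟨Mbar, -, hM⟩ := hH
  rw [obsDensity, ← hM]
  exact measure_ne_top _ _

theorem IsRegular.continuous_mass [TopologicalSpace A] (hH : H.IsRegular) :
    Continuous fun z : DensityProbability H.lam × A => (H.obsDensity z.1 z.2).toReal := by
  obtain ⟨Mbar, hc, hM⟩ := hH
  have h1 : Continuous fun y : FiniteDensityMeasure H.lam => y.toMeasure.real Set.univ := by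
    refine LipschitzWith.continuous (K := 1) (LipschitzWith.of_dist_le_mul fun y z => ?_)
    rw [Real.dist_eq, NNReal.coe_one, one_mul, FiniteDensityMeasure.dist_def]
    exact abs_sub_le_tvDist _ _ MeasurableSet.univ
  have h2 : (fun z : DensityProbability H.lam × A => (H.obsDensity z.1 z.2).toReal) =
      fun z => (Mbar (z.1.1, z.2)).toMeasure.real Set.univ := by
    funext z
    rw [hM, obsDensity, measureReal_def]
  rw [h2]
  exact h1.comp (hc.comp ((continuous_subtype_val.comp continuous_fst).prodMk continuous_snd))

theorem IsRegular.continuousOn_filterUpdate [TopologicalSpace A] (hH : H.IsRegular) :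
    ContinuousOn (fun z : DensityProbability H.lam × A => H.filterUpdate z.1 z.2)
      {z | 0 < (H.obsDensity z.1 z.2).toReal} := by
  have hmass := hH.continuous_mass
  have htop := hH.obsDensity_ne_top
  obtain ⟨Mbar, hc, hM⟩ := hH
  intro z0 hz0
  have hc' : Continuous fun z : DensityProbability H.lam × A => Mbar (z.1.1, z.2) :=
    hc.comp ((continuous_subtype_val.comp continuous_fst).prodMk continuous_snd)
  have hb : Tendsto (fun z : DensityProbability H.lam × A =>
      ((H.obsDensity z.1 z.2).toReal⁻¹ * dist (Mbar (z.1.1, z.2)) (Mbar (z0.1.1, z0.2)) +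
        |(H.obsDensity z.1 z.2).toReal⁻¹ - (H.obsDensity z0.1 z0.2).toReal⁻¹| *
          (H.obsDensity z0.1 z0.2).toReal)) (𝓝 z0) (𝓝 0) := by
    have e1 := (hmass.tendsto z0).inv₀ (ne_of_gt hz0)
    have e2 := (tendsto_iff_dist_tendsto_zero.1 (hc'.tendsto z0))
    have e3 := ((e1.sub_const (H.obsDensity z0.1 z0.2).toReal⁻¹).abs).mul_const
      (H.obsDensity z0.1 z0.2).toReal
    simpa using (e1.mul e2).add e3
  have hb2 := (hb.add hb).mono_left (nhdsWithin_le_nhds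
    (s := {z : DensityProbability H.lam × A | 0 < (H.obsDensity z.1 z.2).toReal}))
  rw [add_zero] at hb2
  refine tendsto_iff_dist_tendsto_zero.2 (squeeze_zero' (Eventually.of_forall fun z => dist_nonneg)
    ?_ hb2)
  filter_upwards [self_mem_nhdsWithin] with z hz
  have hne : ∀ w : DensityProbability H.lam × A, 0 < (H.obsDensity w.1 w.2).toReal →
      H.obsDensity w.1 w.2 ≠ 0 := fun w hw h => by simp [h] at hw
  rw [Subtype.dist_eq, FiniteDensityMeasure.dist_def]
  refine tvDist_le _ _ fun F hF => ?_
  rw [filterUpdate_toMeasure H _ _ (hne z hz) (htop _ _),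
    filterUpdate_toMeasure H _ _ (hne z0 hz0) (htop _ _), measureReal_ennreal_smul_apply,
    measureReal_ennreal_smul_apply, ENNReal.toReal_inv, ENNReal.toReal_inv, ← hM, ← hM]
  have h1 := abs_sub_le_tvDist (Mbar (z.1.1, z.2)).toMeasure (Mbar (z0.1.1, z0.2)).toMeasure hF
  rw [← FiniteDensityMeasure.dist_def] at h1
  have h2 : (Mbar (z0.1.1, z0.2)).toMeasure.real F ≤ (H.obsDensity z0.1 z0.2).toReal := by
    rw [obsDensity, ← hM]
    exact measureReal_mono (Set.subset_univ _)
  have h3 : 0 ≤ (Mbar (z0.1.1, z0.2)).toMeasure.real F := measureReal_nonneg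
  have hz' : 0 ≤ (H.obsDensity z.1 z.2).toReal⁻¹ := inv_nonneg.2 (le_of_lt hz)
  generalize (H.obsDensity z.1 z.2).toReal⁻¹ = α at *
  generalize hβ : (H.obsDensity z0.1 z0.2).toReal⁻¹ = β at *
  have e : α * (Mbar (z.1.1, z.2)).toMeasure.real F - β * (Mbar (z0.1.1, z0.2)).toMeasure.real F =
      α * ((Mbar (z.1.1, z.2)).toMeasure.real F - (Mbar (z0.1.1, z0.2)).toMeasure.real F) +
        (α - β) * (Mbar (z0.1.1, z0.2)).toMeasure.real F := by ring
  rw [e]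
  refine (abs_add_le _ _).trans (add_le_add ?_ ?_)
  · rw [abs_mul, abs_of_nonneg hz']
    exact mul_le_mul_of_nonneg_left h1 hz'
  · rw [abs_mul, abs_of_nonneg h3]
    exact mul_le_mul_of_nonneg_left h2 (abs_nonneg _)

section Measurability

variable [MetricSpace A] [SecondCountableTopology A] [BorelSpace A]

theorem IsRegular.measurable_obsDensity (hH : H.IsRegular) :
    Measurable fun z : DensityProbability H.lam × A => H.obsDensity z.1 z.2 := by
  have h : (fun z : DensityProbability H.lam × A => H.obsDensity z.1 z.2) =
      fun z => ENNReal.ofReal (H.obsDensity z.1 z.2).toReal := by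
    funext z
    rw [ENNReal.ofReal_toReal (hH.obsDensity_ne_top _ _)]
  rw [h]
  exact hH.continuous_mass.measurable.ennreal_ofReal

open Classical in
theorem IsRegular.measurable_filterUpdate (hH : H.IsRegular) :
    Measurable fun z : DensityProbability H.lam × A => H.filterUpdate z.1 z.2 := by
  obtain ⟨U, hU⟩ : ∃ U : Set (DensityProbability H.lam × A),
      U = {z | 0 < (H.obsDensity z.1 z.2).toReal} := ⟨_, rfl⟩
  have hc := hH.continuousOn_filterUpdate
  rw [← hU] at hc
  have ho : IsOpen U := hU ▸ isOpen_lt continuous_const hH.continuous_mass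
  have h := ContinuousOn.measurable_piecewise hc
    (g := Prod.fst) continuous_fst.continuousOn ho.measurableSet
  convert h using 1
  funext z
  by_cases hz : z ∈ U
  · rw [Set.piecewise_eq_of_mem _ _ _ hz]
  · rw [Set.piecewise_eq_of_notMem _ _ _ hz, filterUpdate, dif_neg]
    rintro ⟨h1, h2⟩
    exact hz (hU ▸ ENNReal.toReal_pos h1 h2)

theorem map_withDensity_apply (hH : H.IsRegular) (x : DensityProbability H.lam)
    {E : Set (DensityProbability H.lam)} (hE : MeasurableSet E) :
    ((H.tau.withDensity (H.obsDensity x)).map (H.filterUpdate x)) E =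
      ∫⁻ a, E.indicator 1 (H.filterUpdate x a) * H.obsDensity x a ∂H.tau := by
  have hu : Measurable (H.filterUpdate x) :=
    hH.measurable_filterUpdate.comp (g := fun z : DensityProbability H.lam × A =>
      H.filterUpdate z.1 z.2) (f := fun a => (x, a)) measurable_prodMk_left
  rw [Measure.map_apply hu hE, withDensity_apply _ (hu hE), ← lintegral_indicator (hu hE)]
  refine lintegral_congr fun a => ?_
  by_cases ha : H.filterUpdate x a ∈ E
  · simp [Set.indicator, ha]
  · simp [Set.indicator, ha]

variable (H) in
/-- The filter kernel of a regular hidden Markov model: `P(x, ·)` is the image under `h (x, ·)`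
of the probability measure with density `g (x, ·)` with respect to `tau`. -/
def filterKernel (hH : H.IsRegular) :
    Kernel (DensityProbability H.lam) (DensityProbability H.lam) where
  toFun x := (H.tau.withDensity (H.obsDensity x)).map (H.filterUpdate x)
  measurable' := by
    refine Measure.measurable_of_measurable_coe _ fun E hE => ?_
    simp_rw [map_withDensity_apply hH _ hE]
    refine Measurable.lintegral_prod_right' (f := fun z : DensityProbability H.lam × A =>
      E.indicator 1 (H.filterUpdate z.1 z.2) * H.obsDensity z.1 z.2) ?_
    exact ((measurable_one.indicator hE).comp hH.measurable_filterUpdate).mul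
      hH.measurable_obsDensity

/-- The defining formula of the filter kernel:
`P(x, E) = ∫_{a : ‖x M_a‖ > 0} 1_E (x M_a / ‖x M_a‖) ‖x M_a‖ tau(da)`. -/
theorem filterKernel_apply (hH : H.IsRegular) (x : DensityProbability H.lam)
    {E : Set (DensityProbability H.lam)} (hE : MeasurableSet E) :
    H.filterKernel hH x E = ∫⁻ a in {a | 0 < H.obsDensity x a},
      E.indicator 1 (H.filterUpdate x a) * H.obsDensity x a ∂H.tau := by
  have hg : Measurable (H.obsDensity x) :=
    hH.measurable_obsDensity.comp (g := fun z : DensityProbability H.lam × A =>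
      H.obsDensity z.1 z.2) (f := fun a => (x, a)) measurable_prodMk_left
  have hs : MeasurableSet {a | 0 < H.obsDensity x a} := measurableSet_lt measurable_const hg
  change ((H.tau.withDensity (H.obsDensity x)).map (H.filterUpdate x)) E = _
  rw [map_withDensity_apply hH x hE, ← lintegral_indicator hs]
  refine lintegral_congr fun a => ?_
  by_cases ha : 0 < H.obsDensity x a
  · simp [Set.indicator, ha]
  · simp [Set.indicator, nonpos_iff_eq_zero.1 (not_lt.1 ha)]

end Measurability

end DensityHMM

end

end HiddenMarkov

/-!
The filter is stable because variance cannot be lost forever. Fix a law `μ` of the hidden state and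
a function `r` of it, which encodes some additional information, for instance the likelihood of an
earlier observation. When the chain moves, `r` is replaced by its conditional expectation given the
new state and the observation, and `μ` by `μ M_a`; integrating a functional of `(r, μ)` over the
observation `a` gives the transfer operator `DensityHMM.transfer`. The variance of `r` under the
filter decreases by an explicit amount in each step (`DensityHMM.variance_eq`). The losses are
therefore summable and tend to zero (`DensityHMM.vanishes_varianceLoss`).

The hypotheses on `F₀` and `B₀` say that an observation in `B₀` puts the chain into `F₀`, from where
a second observation in `B₀` comes with a joint density bounded from below on the set of possible
new states (`DensityHMM.IsMinorizedOn`). Such a step forgets the state with a fixed probability, so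
the variance that is present on `F₀` is at most a multiple of the losses in two steps, and it
vanishes asymptotically. So does the variance with the weight `P^N(s, F₀)` in place of the indicator
of `F₀`, and by strong ergodicity this weight is close to the constant `π F₀ > 0` if `N` is large.
Hence the whole variance vanishes (`DensityHMM.IsMinorizedOn.vanishes_variance`).

The filter that uses the information `r` and the filter that ignores it are at a mean distance equal
to the mean deviation of `r` (`DensityHMM.edist_normalized_mul`). With `r = q(·, a)` this shows that
the filter forgets its first observation: at time `n + 1`, started at `x`, it is close in law to the
filter at time `n`, started at the prediction `xP` (`DensityHMM.lintegral_pow_succ_le`, and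
`DensityHMM.exists_forget` for `k` observations). The predictions `xP^k` and `yP^k` merge by strong
ergodicity, and the iterates of the filter kernel preserve Lipschitz functions up to a constant
(`DensityHMM.lintegral_pow_le_add_edist`); weak contraction follows
(`DensityHMM.tendsto_testGap`).

The map `(x, a) ↦ x M_a = q(·, a) · xP` is a composition of continuous maps
(`DensityHMM.IsEmission.isRegular`). It also shows that the laws of the filter are tight: the
observations are mostly in a compact set, and the transition densities can be approximated, on most
of the state space, by finitely many of them, because `L¹` is separable
(`DensityHMM.isTightMeasureSet_range_filterKernel_pow`). Hence the laws have a limit point by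
Prokhorov's theorem; by contraction the limit point is invariant and attracts the filter from every
initial value (`DensityHMM.weaklyErgodic_filterKernel`).
-/

namespace HiddenMarkov

noncomputable section

/-! ### Total variation, `L¹` and the space `K` -/

section TotalVariationIntegrals

variable {X : Type*} [MeasurableSpace X]

theorem tvDist_nonneg (μ ν : Measure X) [IsFiniteMeasure μ] [IsFiniteMeasure ν] :
    0 ≤ tvDist μ ν :=
  add_nonneg (iSup_sub_nonneg μ ν) (iSup_sub_nonneg ν μ)

theorem measure_le_add_tvDist (μ ν : Measure X) [IsFiniteMeasure μ] [IsFiniteMeasure ν]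
    {F : Set X} (hF : MeasurableSet F) : μ F ≤ ν F + ENNReal.ofReal (tvDist μ ν) := by
  have h := sub_le_tvDist μ ν hF
  rw [← ofReal_measureReal (μ := μ), ← ofReal_measureReal (μ := ν),
    ← ENNReal.ofReal_add measureReal_nonneg (tvDist_nonneg μ ν)]
  exact ENNReal.ofReal_le_ofReal (by linarith)

/-- Integrals of a function with values in `[0, c]` differ by at most `c` times the total variation
distance. -/
theorem lintegral_le_add_tvDist (μ ν : Measure X) [IsFiniteMeasure μ] [IsFiniteMeasure ν]
    {φ : X → ℝ≥0∞} (hφ : Measurable φ) {c : ℝ≥0} (hc : ∀ x, φ x ≤ c) :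
    ∫⁻ x, φ x ∂μ ≤ ∫⁻ x, φ x ∂ν + c * ENNReal.ofReal (tvDist μ ν) := by
  obtain ⟨s, hs, h1, h2⟩ := hahn_decomposition μ ν
  have hsub : Measurable fun x => (c : ℝ≥0∞) - φ x := measurable_const.sub hφ
  have e1 : ∀ ρ : Measure X, ∫⁻ x in s, φ x ∂ρ + ∫⁻ x in s, (c - φ x) ∂ρ = c * ρ s := by
    intro ρ
    rw [← lintegral_add_left hφ]
    simp_rw [add_tsub_cancel_of_le (hc _)]
    simp
  have r1 : ν.restrict s ≤ μ.restrict s := by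
    refine Measure.le_iff.2 fun t ht => ?_
    rw [Measure.restrict_apply ht, Measure.restrict_apply ht]
    exact h1 _ (ht.inter hs) Set.inter_subset_right
  have r2 : μ.restrict sᶜ ≤ ν.restrict sᶜ := by
    refine Measure.le_iff.2 fun t ht => ?_
    rw [Measure.restrict_apply ht, Measure.restrict_apply ht]
    exact h2 _ (ht.inter hs.compl) Set.inter_subset_right
  have key : ∫⁻ x in s, φ x ∂μ ≤ ∫⁻ x in s, φ x ∂ν + c * ENNReal.ofReal (tvDist μ ν) := by
    have hfin : ∫⁻ x in s, (c - φ x) ∂ν ≠ ∞ := by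
      refine ne_top_of_le_ne_top ?_ (le_add_self.trans (e1 ν).le)
      exact ENNReal.mul_ne_top ENNReal.coe_ne_top (measure_ne_top _ _)
    refine (ENNReal.add_le_add_iff_right hfin).1 ?_
    calc ∫⁻ x in s, φ x ∂μ + ∫⁻ x in s, (c - φ x) ∂ν
        ≤ ∫⁻ x in s, φ x ∂μ + ∫⁻ x in s, (c - φ x) ∂μ := by gcongr
      _ = c * μ s := e1 μ
      _ ≤ c * (ν s + ENNReal.ofReal (tvDist μ ν)) := by gcongr; exact measure_le_add_tvDist μ ν hs
      _ = _ := by rw [mul_add, ← e1 ν]; ring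
  calc ∫⁻ x, φ x ∂μ = ∫⁻ x in s, φ x ∂μ + ∫⁻ x in sᶜ, φ x ∂μ := (lintegral_add_compl _ hs).symm
    _ ≤ (∫⁻ x in s, φ x ∂ν + c * ENNReal.ofReal (tvDist μ ν)) + ∫⁻ x in sᶜ, φ x ∂ν := by
        gcongr
    _ = _ := by rw [← lintegral_add_compl φ hs (μ := ν)]; ring

/-- The `L¹` distance of two `[0, ∞]`-valued densities, in the form `∫ (f - g)⁺ + (g - f)⁺`. -/
def densDist (lam : Measure X) (f g : X → ℝ≥0∞) : ℝ≥0∞ :=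
  ∫⁻ t, ((f t - g t) + (g t - f t)) ∂lam

/-- The total variation distance of two measures with densities is the `L¹` distance of the
densities. -/
theorem ofReal_tvDist_withDensity (lam : Measure X) {f g : X → ℝ≥0∞} (hf : Measurable f)
    (hg : Measurable g) (hf' : ∫⁻ t, f t ∂lam ≠ ∞) (hg' : ∫⁻ t, g t ∂lam ≠ ∞) :
    ENNReal.ofReal (tvDist (lam.withDensity f) (lam.withDensity g)) = densDist lam f g := by
  have key : ∀ f g : X → ℝ≥0∞, Measurable f → Measurable g → ∫⁻ t, f t ∂lam ≠ ∞ →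
      ∫⁻ t, g t ∂lam ≠ ∞ →
      (⨆ F : {F : Set X // MeasurableSet F},
        ((lam.withDensity f).real F.1 - (lam.withDensity g).real F.1)) =
      (∫⁻ t, (f t - g t) ∂lam).toReal := by
    intro f g hf hg hf' hg'
    have : IsFiniteMeasure (lam.withDensity f) := isFiniteMeasure_withDensity hf'
    have : IsFiniteMeasure (lam.withDensity g) := isFiniteMeasure_withDensity hg'
    have hd : ∫⁻ t, (f t - g t) ∂lam ≠ ∞ :=
      ne_top_of_le_ne_top hf' (lintegral_mono fun t => tsub_le_self)
    apply le_antisymm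
    · refine ciSup_le fun F => ?_
      rw [sub_le_iff_le_add, measureReal_def, measureReal_def,
        ← ENNReal.toReal_add hd (measure_ne_top _ _)]
      refine ENNReal.toReal_mono (ENNReal.add_ne_top.2 ⟨hd, measure_ne_top _ _⟩) ?_
      rw [withDensity_apply _ F.2, withDensity_apply _ F.2]
      calc ∫⁻ t in F.1, f t ∂lam ≤ ∫⁻ t in F.1, ((f t - g t) + g t) ∂lam :=
            lintegral_mono fun t => le_tsub_add
        _ = ∫⁻ t in F.1, (f t - g t) ∂lam + ∫⁻ t in F.1, g t ∂lam := lintegral_add_right _ hg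
        _ ≤ _ := by gcongr; exact Measure.restrict_le_self
    · have hF : MeasurableSet {t | g t ≤ f t} := measurableSet_le hg hf
      refine le_trans ?_ (sub_le_iSup (lam.withDensity f) (lam.withDensity g) hF)
      rw [le_sub_iff_add_le, measureReal_def, measureReal_def,
        ← ENNReal.toReal_add hd (measure_ne_top _ _)]
      refine ENNReal.toReal_mono (measure_ne_top _ _) (le_of_eq ?_)
      rw [withDensity_apply _ hF, withDensity_apply _ hF]
      have e : ∫⁻ t, (f t - g t) ∂lam = ∫⁻ t in {t | g t ≤ f t}, (f t - g t) ∂lam := by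
        rw [← lintegral_indicator hF]
        refine lintegral_congr fun t => ?_
        by_cases ht : g t ≤ f t
        · simp [Set.indicator, ht]
        · simp [Set.indicator, ht, tsub_eq_zero_of_le (le_of_not_ge ht)]
      rw [e, ← lintegral_add_right _ hg]
      refine setLIntegral_congr_fun hF fun t ht => ?_
      exact tsub_add_cancel_of_le ht
  have hfg : ∫⁻ t, (f t - g t) ∂lam ≠ ∞ :=
    ne_top_of_le_ne_top hf' (lintegral_mono fun t => tsub_le_self)
  have hgf : ∫⁻ t, (g t - f t) ∂lam ≠ ∞ :=
    ne_top_of_le_ne_top hg' (lintegral_mono fun t => tsub_le_self)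
  unfold tvDist densDist
  rw [key f g hf hg hf' hg', key g f hg hf hg' hf', ← ENNReal.toReal_add hfg hgf,
    ENNReal.ofReal_toReal (ENNReal.add_ne_top.2 ⟨hfg, hgf⟩),
    lintegral_add_left (f := fun t => f t - g t) (hf.sub hg)]

end TotalVariationIntegrals

section DensityProbabilitySpace

variable {S : Type*} [MeasurableSpace S] {lam : Measure S}

namespace FiniteDensityMeasure

/-- A chosen density of a finite measure with a density. -/
def dens (x : FiniteDensityMeasure lam) : S → ℝ≥0 := x.exists_density.choose

theorem measurable_dens (x : FiniteDensityMeasure lam) : Measurable x.dens :=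
  x.exists_density.choose_spec.1

theorem toMeasure_eq (x : FiniteDensityMeasure lam) :
    x.toMeasure = lam.withDensity fun t => (x.dens t : ℝ≥0∞) := by
  ext F hF
  rw [withDensity_apply _ hF]
  exact x.exists_density.choose_spec.2 F hF

theorem lintegral_dens (x : FiniteDensityMeasure lam) :
    ∫⁻ t, (x.dens t : ℝ≥0∞) ∂lam = x.toMeasure Set.univ := by
  conv_rhs => rw [x.toMeasure_eq]
  simp

theorem lintegral_dens_ne_top (x : FiniteDensityMeasure lam) :
    ∫⁻ t, (x.dens t : ℝ≥0∞) ∂lam ≠ ∞ := by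
  rw [x.lintegral_dens]; exact measure_ne_top _ _

theorem edist_eq (x y : FiniteDensityMeasure lam) :
    edist x y = densDist lam (fun t => x.dens t) fun t => y.dens t := by
  rw [edist_dist, dist_def, x.toMeasure_eq, y.toMeasure_eq,
    ofReal_tvDist_withDensity _ x.measurable_dens.coe_nnreal_ennreal
      y.measurable_dens.coe_nnreal_ennreal x.lintegral_dens_ne_top y.lintegral_dens_ne_top]

/-- A measurable density with finite integral yields a finite measure with a density. -/
def ofDensity (lam : Measure S) (f : S → ℝ≥0∞) (hf : Measurable f) (hf' : ∫⁻ t, f t ∂lam ≠ ∞) :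
    FiniteDensityMeasure lam where
  toMeasure := lam.withDensity f
  isFiniteMeasure := isFiniteMeasure_withDensity hf'
  exists_density := by
    refine ⟨fun t => (f t).toNNReal, hf.ennreal_toNNReal, fun F hF => ?_⟩
    rw [withDensity_apply _ hF]
    refine lintegral_congr_ae (ae_restrict_of_ae ?_)
    filter_upwards [ae_lt_top hf hf'] with t ht
    rw [ENNReal.coe_toNNReal ht.ne]

theorem memLp_dens (x : FiniteDensityMeasure lam) : MemLp (fun t => (x.dens t : ℝ)) 1 lam := by
  refine ⟨x.measurable_dens.coe_nnreal_real.aestronglyMeasurable, ?_⟩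
  rw [eLpNorm_one_eq_lintegral_enorm]
  refine lt_of_le_of_lt (lintegral_mono fun t => ?_) x.lintegral_dens_ne_top.lt_top
  simp [← ofReal_norm]

/-- The map that sends a finite measure with a density to its density in `L¹`. -/
def toL1 (x : FiniteDensityMeasure lam) : Lp ℝ 1 lam := x.memLp_dens.toLp _

theorem enorm_coe_sub_coe (a b : ℝ≥0) : ‖(a : ℝ) - b‖ₑ = ((a : ℝ≥0∞) - b) + (b - a) := by
  rw [← ENNReal.coe_sub, ← ENNReal.coe_sub, ← ENNReal.coe_add, ← ofReal_norm,
    ← ENNReal.ofReal_coe_nnreal]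
  congr 1
  rcases le_total a b with h | h
  · rw [NNReal.coe_add, NNReal.coe_sub h, tsub_eq_zero_of_le h, Real.norm_eq_abs,
      abs_of_nonpos (sub_nonpos.2 (NNReal.coe_le_coe.2 h))]
    simp
  · rw [NNReal.coe_add, NNReal.coe_sub h, tsub_eq_zero_of_le h, Real.norm_eq_abs,
      abs_of_nonneg (sub_nonneg.2 (NNReal.coe_le_coe.2 h))]
    simp

theorem isometry_toL1 : Isometry (toL1 (lam := lam)) := by
  intro x y
  rw [toL1, toL1, Lp.edist_toLp_toLp, edist_eq, eLpNorm_one_eq_lintegral_enorm, densDist]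
  refine lintegral_congr fun t => ?_
  exact enorm_coe_sub_coe _ _

/-- The finite measures with a density are the nonnegative cone of `L¹`, which is closed; hence they
form a complete space. -/
theorem range_toL1 : Set.range (toL1 (lam := lam)) = {g | Lp.posPart g = g} := by
  ext g
  constructor
  · rintro ⟨x, rfl⟩
    refine Lp.ext ?_
    filter_upwards [Lp.coeFn_posPart x.toL1, x.memLp_dens.coeFn_toLp] with t h1 h2
    rw [h1]
    rw [toL1, h2]
    simp
  · intro hg
    have hm : Measurable fun t => ENNReal.ofReal (g t) :=
      (Lp.stronglyMeasurable g).measurable.ennreal_ofReal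
    have hfin : ∫⁻ t, ENNReal.ofReal (g t) ∂lam ≠ ∞ := by
      have h := (Lp.memLp g).2
      rw [eLpNorm_one_eq_lintegral_enorm] at h
      refine ne_top_of_le_ne_top h.ne (lintegral_mono fun t => ?_)
      rw [← ofReal_norm]
      exact ENNReal.ofReal_le_ofReal (le_abs_self _)
    let x := ofDensity lam _ hm hfin
    refine ⟨x, ?_⟩
    have hx : (fun t => (x.dens t : ℝ≥0∞)) =ᵐ[lam] fun t => ENNReal.ofReal (g t) := by
      have h := x.toMeasure_eq
      exact (withDensity_eq_iff x.measurable_dens.coe_nnreal_ennreal.aemeasurable hm.aemeasurable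
        x.lintegral_dens_ne_top).1 h.symm
    refine Lp.ext ?_
    have hpos := Lp.coeFn_posPart g
    rw [show Lp.posPart g = g from hg] at hpos
    filter_upwards [hx, x.memLp_dens.coeFn_toLp, hpos] with t h1 h2 h3
    rw [toL1, h2]
    have h4 : 0 ≤ g t := by rw [h3]; exact le_max_right _ _
    have := congrArg ENNReal.toReal h1
    rwa [ENNReal.coe_toReal, ENNReal.toReal_ofReal h4] at this

instance [MeasurableSpace.CountablyGenerated S] [SFinite lam] :
    SecondCountableTopology (FiniteDensityMeasure lam) := by
  have : Fact ((1 : ℝ≥0∞) ≠ ∞) := ⟨ENNReal.one_ne_top⟩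
  exact isometry_toL1.isEmbedding.secondCountableTopology

instance : CompleteSpace (FiniteDensityMeasure lam) := by
  have h : IsClosedEmbedding (toL1 (lam := lam)) := by
    refine ⟨isometry_toL1.isEmbedding, ?_⟩
    rw [range_toL1]
    exact isClosed_eq Lp.continuous_posPart continuous_id
  exact (completeSpace_iff_isComplete_range isometry_toL1.isUniformInducing).2
    h.isClosed_range.isComplete

theorem continuous_mass :
    Continuous fun y : FiniteDensityMeasure lam => y.toMeasure.real Set.univ := by
  refine LipschitzWith.continuous (K := 1) (LipschitzWith.of_dist_le_mul fun y z => ?_)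
  rw [Real.dist_eq, NNReal.coe_one, one_mul, dist_def]
  exact abs_sub_le_tvDist _ _ MeasurableSet.univ

end FiniteDensityMeasure

instance : CompleteSpace (DensityProbability lam) := by
  have h : IsClosed {x : FiniteDensityMeasure lam | x.toMeasure Set.univ = 1} := by
    have e : {x : FiniteDensityMeasure lam | x.toMeasure Set.univ = 1} =
        {x | x.toMeasure.real Set.univ = 1} := by
      ext x
      simp [measureReal_def, ENNReal.toReal_eq_one_iff]
    rw [e]
    exact isClosed_eq FiniteDensityMeasure.continuous_mass continuous_const
  exact h.completeSpace_coe

instance (x : DensityProbability lam) : IsProbabilityMeasure x.1.toMeasure := ⟨x.2⟩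

/-- A map into a separable metric space is measurable as soon as its distances to all points are,
since every open set is a countable union of balls. -/
theorem measurable_of_measurable_edist {Ω Y : Type*} [MeasurableSpace Ω] [MetricSpace Y]
    [SecondCountableTopology Y] [MeasurableSpace Y] [BorelSpace Y] {g : Ω → Y}
    (h : ∀ y, Measurable fun ω => edist (g ω) y) : Measurable g := by
  refine measurable_of_isOpen fun U hU => ?_
  choose! r hr hrU using fun y (hy : y ∈ U) => EMetric.isOpen_iff.1 hU y hy
  obtain ⟨T, hT, hTU⟩ := TopologicalSpace.isOpen_iUnion_countable
    (fun y : U => Metric.eball (y : Y) (r y)) fun y => Metric.isOpen_eball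
  have e : U = ⋃ y ∈ T, Metric.eball (y : Y) (r y) := by
    rw [hTU]
    refine Set.Subset.antisymm (fun y hy => ?_) (Set.iUnion_subset fun y => hrU y y.2)
    exact Set.mem_iUnion.2 ⟨⟨y, hy⟩, Metric.mem_eball_self (hr y hy)⟩
  rw [e, Set.preimage_iUnion₂]
  exact MeasurableSet.biUnion hT fun y _ => measurableSet_lt (h y) measurable_const

namespace DensityProbability

theorem ext_toMeasure {x y : DensityProbability lam} (h : x.1.toMeasure = y.1.toMeasure) :
    x = y :=
  Subtype.ext (FiniteDensityMeasure.ext h)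

open Classical in
/-- The value of `u` at the normalization of `ν`, if `ν` is a finite nonzero measure with a
density, and zero otherwise. -/
def evalNormalized (u : DensityProbability lam → ℝ≥0∞) (ν : Measure S) : ℝ≥0∞ :=
  if h : ∃ x : DensityProbability lam, x.1.toMeasure = (ν Set.univ)⁻¹ • ν then u h.choose else 0

theorem evalNormalized_eq (u : DensityProbability lam → ℝ≥0∞) {ν : Measure S}
    {x : DensityProbability lam} (hx : x.1.toMeasure = (ν Set.univ)⁻¹ • ν) :
    evalNormalized u ν = u x := by
  have h : ∃ x : DensityProbability lam, x.1.toMeasure = (ν Set.univ)⁻¹ • ν := ⟨x, hx⟩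
  rw [evalNormalized, dif_pos h]
  exact congrArg u (ext_toMeasure (h.choose_spec.trans hx.symm))

theorem evalNormalized_smul (u : DensityProbability lam → ℝ≥0∞) (x : DensityProbability lam)
    {c : ℝ≥0∞} (hc : c ≠ 0) (hc' : c ≠ ∞) : evalNormalized u (c • x.1.toMeasure) = u x := by
  refine evalNormalized_eq u ?_
  rw [Measure.smul_apply, x.2, smul_smul, smul_eq_mul, mul_one, ENNReal.inv_mul_cancel hc hc',
    one_smul]

theorem evalNormalized_of_mass_eq_zero (u : DensityProbability lam → ℝ≥0∞) {ν : Measure S}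
    (h : ν Set.univ = 0) : evalNormalized u ν = 0 := by
  rw [evalNormalized, dif_neg]
  rintro ⟨x, hx⟩
  have h1 := x.2
  rw [hx, Measure.measure_univ_eq_zero.1 h] at h1
  simp at h1

/-- A measurable density with integral one yields a probability measure with a density. -/
def ofDensity (f : S → ℝ≥0∞) (hf : Measurable f) (hf1 : ∫⁻ t, f t ∂lam = 1) :
    DensityProbability lam :=
  ⟨FiniteDensityMeasure.ofDensity lam f hf (by simp [hf1]), by
    simp [FiniteDensityMeasure.ofDensity, hf1]⟩

theorem lintegral_inv_mul_self {f : S → ℝ≥0∞} (hf : Measurable f) (h0 : ∫⁻ t, f t ∂lam ≠ 0)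
    (h1 : ∫⁻ t, f t ∂lam ≠ ∞) : ∫⁻ t, (∫⁻ s, f s ∂lam)⁻¹ * f t ∂lam = 1 := by
  rw [lintegral_const_mul _ hf, ENNReal.inv_mul_cancel h0 h1]

/-- The normalization of a density with finite nonzero integral. -/
def normalized (f : S → ℝ≥0∞) (hf : Measurable f) (h0 : ∫⁻ t, f t ∂lam ≠ 0)
    (h1 : ∫⁻ t, f t ∂lam ≠ ∞) : DensityProbability lam :=
  ofDensity (fun t => (∫⁻ s, f s ∂lam)⁻¹ * f t) (hf.const_mul _) (lintegral_inv_mul_self hf h0 h1)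

theorem normalized_toMeasure {f : S → ℝ≥0∞} (hf : Measurable f) (h0 : ∫⁻ t, f t ∂lam ≠ 0)
    (h1 : ∫⁻ t, f t ∂lam ≠ ∞) : (normalized f hf h0 h1).1.toMeasure =
      (lam.withDensity f Set.univ)⁻¹ • lam.withDensity f := by
  change lam.withDensity (fun t => (∫⁻ s, f s ∂lam)⁻¹ * f t) = _
  rw [withDensity_apply _ MeasurableSet.univ, Measure.restrict_univ, ← withDensity_smul _ hf]
  rfl

theorem evalNormalized_withDensity (u : DensityProbability lam → ℝ≥0∞) {f : S → ℝ≥0∞}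
    (hf : Measurable f) (h0 : ∫⁻ t, f t ∂lam ≠ 0) (h1 : ∫⁻ t, f t ∂lam ≠ ∞) :
    evalNormalized u (lam.withDensity f) = u (normalized f hf h0 h1) :=
  evalNormalized_eq u (normalized_toMeasure hf h0 h1)

theorem edist_ofDensity {f g : S → ℝ≥0∞} (hf : Measurable f) (hf1 : ∫⁻ t, f t ∂lam = 1)
    (hg : Measurable g) (hg1 : ∫⁻ t, g t ∂lam = 1) :
    edist (ofDensity f hf hf1) (ofDensity g hg hg1) = densDist lam f g := by
  rw [← ofReal_tvDist_withDensity lam hf hg (by simp [hf1]) (by simp [hg1]), edist_dist]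
  rfl

theorem ofDensity_dens (x : DensityProbability lam) :
    ofDensity (fun t => (x.1.dens t : ℝ≥0∞)) x.1.measurable_dens.coe_nnreal_ennreal
      (by rw [x.1.lintegral_dens, x.2]) = x :=
  ext_toMeasure x.1.toMeasure_eq.symm

theorem measurable_evalNormalized [MeasurableSpace.CountablyGenerated S] [SFinite lam]
    {u : DensityProbability lam → ℝ≥0∞} (hu : Measurable u) {Ω : Type*} [MeasurableSpace Ω]
    {f : Ω → S → ℝ≥0∞} (hf : Measurable (Function.uncurry f)) (hfin : ∀ ω, ∫⁻ t, f ω t ∂lam ≠ ∞) :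
    Measurable fun ω => evalNormalized u (lam.withDensity (f ω)) := by
  have hfω : ∀ ω, Measurable (f ω) := fun ω => hf.comp measurable_prodMk_left
  have hmass : Measurable fun ω => ∫⁻ t, f ω t ∂lam := hf.lintegral_prod_right'
  have hs : MeasurableSet {ω | ∫⁻ t, f ω t ∂lam ≠ 0} := hmass (measurableSet_singleton 0).compl
  refine measurable_of_restrict_of_restrict_compl hs ?_ ?_
  · have e : Set.domRestrict {ω | ∫⁻ t, f ω t ∂lam ≠ 0}
        (fun ω => evalNormalized u (lam.withDensity (f ω))) =
        fun ω => u (normalized (f ω.1) (hfω ω.1) ω.2 (hfin ω.1)) := by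
      funext ω
      exact evalNormalized_withDensity u (hfω ω.1) ω.2 (hfin ω.1)
    rw [e]
    refine hu.comp (measurable_of_measurable_edist fun x => ?_)
    have e2 : ∀ ω : {ω | ∫⁻ t, f ω t ∂lam ≠ 0},
        edist (normalized (f ω.1) (hfω ω.1) ω.2 (hfin ω.1)) x =
          densDist lam (fun t => (∫⁻ s, f ω.1 s ∂lam)⁻¹ * f ω.1 t) fun t => x.1.dens t := by
      intro ω
      conv_lhs => rw [← ofDensity_dens x]
      exact edist_ofDensity _ _ _ _
    simp_rw [e2]
    unfold densDist
    have h1 : Measurable fun z : {ω | ∫⁻ t, f ω t ∂lam ≠ 0} × S =>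
        (∫⁻ s, f z.1.1 s ∂lam)⁻¹ * f z.1.1 z.2 := by
      refine Measurable.mul ?_ ?_
      · exact (hmass.comp (measurable_subtype_coe.comp measurable_fst)).inv
      · exact hf.comp ((measurable_subtype_coe.comp measurable_fst).prodMk measurable_snd)
    have h2 : Measurable fun z : {ω | ∫⁻ t, f ω t ∂lam ≠ 0} × S => (x.1.dens z.2 : ℝ≥0∞) :=
      x.1.measurable_dens.coe_nnreal_ennreal.comp measurable_snd
    exact ((h1.sub h2).add (h2.sub h1)).lintegral_prod_right'
  · have e : Set.domRestrict {ω | ∫⁻ t, f ω t ∂lam ≠ 0}ᶜ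
        (fun ω => evalNormalized u (lam.withDensity (f ω))) = fun _ => 0 := by
      funext ω
      refine evalNormalized_of_mass_eq_zero u ?_
      rw [withDensity_apply _ MeasurableSet.univ, Measure.restrict_univ]
      exact not_not.1 ω.2
    rw [e]
    exact measurable_const

end DensityProbability

end DensityProbabilitySpace

/-! ### Conditional expectations along observations and the transfer operator -/

section BiasVariance

variable {S : Type*} [MeasurableSpace S]

/-- The squared distance of two nonnegative reals, in `[0, ∞]`. -/
def sqDist (x y : ℝ≥0) : ℝ≥0∞ := ENNReal.ofReal (((x : ℝ) - y) ^ 2)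

theorem measurable_sqDist : Measurable fun z : ℝ≥0 × ℝ≥0 => sqDist z.1 z.2 := by
  unfold sqDist
  fun_prop

theorem _root_.Measurable.sqDist {Ω : Type*} [MeasurableSpace Ω] {f g : Ω → ℝ≥0}
    (hf : Measurable f) (hg : Measurable g) :
    Measurable fun ω => HiddenMarkov.sqDist (f ω) (g ω) :=
  measurable_sqDist.comp (hf.prodMk hg)

theorem sqDist_add (x y : ℝ≥0) : sqDist x y + 2 * x * y = (x : ℝ≥0∞) ^ 2 + (y : ℝ≥0∞) ^ 2 := by
  have h : ((2 : ℝ≥0∞) * x * y) = ENNReal.ofReal (2 * x * y) := by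
    rw [ENNReal.ofReal_mul (by positivity), ENNReal.ofReal_mul (by positivity)]
    simp
  have h2 : (x : ℝ≥0∞) ^ 2 + (y : ℝ≥0∞) ^ 2 = ENNReal.ofReal ((x : ℝ) ^ 2 + (y : ℝ) ^ 2) := by
    rw [ENNReal.ofReal_add (by positivity) (by positivity), ENNReal.ofReal_pow (by positivity),
      ENNReal.ofReal_pow (by positivity)]
    simp
  rw [h, h2, sqDist, ← ENNReal.ofReal_add (by positivity) (by positivity)]
  congr 1
  ring

theorem sqDist_le_three_mul (x y z w : ℝ≥0) :
    sqDist x w ≤ 3 * (sqDist x y + sqDist y z + sqDist z w) := by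
  have h3 : (3 : ℝ≥0∞) = ENNReal.ofReal 3 := by simp
  unfold sqDist
  rw [← ENNReal.ofReal_add (by positivity) (by positivity),
    ← ENNReal.ofReal_add (by positivity) (by positivity), h3, ← ENNReal.ofReal_mul (by norm_num)]
  refine ENNReal.ofReal_le_ofReal ?_
  nlinarith [sq_nonneg (((x : ℝ) - y) - (y - z)), sq_nonneg (((y : ℝ) - z) - (z - w)),
    sq_nonneg (((x : ℝ) - y) - (z - w))]

theorem sqDist_le {R x y : ℝ≥0} (hx : x ≤ R) (hy : y ≤ R) : sqDist x y ≤ (R : ℝ≥0∞) ^ 2 := by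
  have : (R : ℝ≥0∞) ^ 2 = ENNReal.ofReal ((R : ℝ) ^ 2) := by
    rw [ENNReal.ofReal_pow (by positivity)]; simp
  rw [this]
  refine ENNReal.ofReal_le_ofReal (sq_le_sq' ?_ ?_)
  · have := NNReal.coe_le_coe.2 hy
    have := x.coe_nonneg
    linarith
  · have := NNReal.coe_le_coe.2 hx
    have := y.coe_nonneg
    linarith

/-- The mean of `r` with respect to the normalization of the finite measure `μ`. -/
def mean (r : S → ℝ≥0) (μ : Measure S) : ℝ≥0 := ((∫⁻ s, r s ∂μ) / μ Set.univ).toNNReal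

theorem lintegral_le_mul_mass {r : S → ℝ≥0} {R : ℝ≥0} (hr : ∀ s, r s ≤ R) (μ : Measure S) :
    ∫⁻ s, r s ∂μ ≤ R * μ Set.univ := by
  calc ∫⁻ s, r s ∂μ ≤ ∫⁻ _, (R : ℝ≥0∞) ∂μ := lintegral_mono fun s => ENNReal.coe_le_coe.2 (hr s)
    _ = _ := by simp

theorem mean_le {r : S → ℝ≥0} {R : ℝ≥0} (hr : ∀ s, r s ≤ R) (μ : Measure S) : mean r μ ≤ R := by
  have h : (∫⁻ s, r s ∂μ) / μ Set.univ ≤ R :=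
    ENNReal.div_le_of_le_mul (lintegral_le_mul_mass hr μ)
  exact (ENNReal.toNNReal_mono ENNReal.coe_ne_top h).trans_eq (ENNReal.toNNReal_coe _)

theorem mean_mul_mass {r : S → ℝ≥0} {R : ℝ≥0} (hr : ∀ s, r s ≤ R) (μ : Measure S)
    [IsFiniteMeasure μ] : (mean r μ : ℝ≥0∞) * μ Set.univ = ∫⁻ s, r s ∂μ := by
  have hle := lintegral_le_mul_mass hr μ
  rw [mean, ENNReal.coe_toNNReal
    (ne_top_of_le_ne_top ENNReal.coe_ne_top (ENNReal.div_le_of_le_mul hle))]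
  refine ENNReal.div_mul_cancel' (fun h => ?_) fun h => absurd h (measure_ne_top _ _)
  rw [h, mul_zero] at hle
  exact nonpos_iff_eq_zero.1 hle

/-- The bias-variance decomposition of a mean square deviation. -/
theorem lintegral_sqDist_eq {r : S → ℝ≥0} (hrm : Measurable r) {R : ℝ≥0} (hr : ∀ s, r s ≤ R)
    (μ : Measure S) [IsFiniteMeasure μ] (c : ℝ≥0) :
    ∫⁻ s, sqDist (r s) c ∂μ =
      ∫⁻ s, sqDist (r s) (mean r μ) ∂μ + μ Set.univ * sqDist (mean r μ) c := by
  have key : ∀ c : ℝ≥0, ∫⁻ s, sqDist (r s) c ∂μ + 2 * c * (mean r μ * μ Set.univ) =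
      ∫⁻ s, (r s : ℝ≥0∞) ^ 2 ∂μ + (c : ℝ≥0∞) ^ 2 * μ Set.univ := by
    intro c
    have h1 : ∫⁻ s, (sqDist (r s) c + 2 * r s * c) ∂μ =
        ∫⁻ s, ((r s : ℝ≥0∞) ^ 2 + (c : ℝ≥0∞) ^ 2) ∂μ :=
      lintegral_congr fun s => sqDist_add _ _
    rw [lintegral_add_left (hrm.sqDist measurable_const), lintegral_add_right _ measurable_const,
      lintegral_const] at h1
    rw [← h1, mean_mul_mass hr μ, ← lintegral_const_mul _ hrm.coe_nnreal_ennreal]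
    congr 1
    refine lintegral_congr fun s => ?_
    ring
  have kc := key c
  have km := key (mean r μ)
  have kz := congrArg (fun z => z * μ Set.univ) (sqDist_add (mean r μ) c)
  generalize mean r μ = m at *
  have hM : μ Set.univ ≠ ∞ := measure_ne_top _ _
  generalize μ Set.univ = M at *
  have f1 : (m : ℝ≥0∞) ^ 2 * M ≠ ∞ := ENNReal.mul_ne_top (by simp) hM
  have f2 : 2 * (c : ℝ≥0∞) * (m * M) ≠ ∞ :=
    ENNReal.mul_ne_top (by finiteness) (ENNReal.mul_ne_top (by simp) hM)
  have km' : ∫⁻ s, sqDist (r s) m ∂μ + (m : ℝ≥0∞) ^ 2 * M = ∫⁻ s, (r s : ℝ≥0∞) ^ 2 ∂μ := by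
    refine (ENNReal.add_left_inj f1).1 ?_
    rw [← km]; ring
  refine (ENNReal.add_left_inj f2).1 ?_
  rw [kc, ← km']
  calc _ = ∫⁻ s, sqDist (r s) m ∂μ + ((m : ℝ≥0∞) ^ 2 + (c : ℝ≥0∞) ^ 2) * M := by ring
    _ = _ := by rw [← kz]; ring

end BiasVariance

namespace DensityHMM

universe v

variable {S : Type*} {A : Type v} [MeasurableSpace S] [MeasurableSpace A] (H : DensityHMM S A)

/-- The density `t ↦ ∫ m s t a μ(ds)` of `μ M_a`. -/
def stepDens (μ : Measure S) (a : A) (t : S) : ℝ≥0∞ := ∫⁻ s, (H.m s t a : ℝ≥0∞) ∂μ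

/-- The measure `μ M_a`, for an arbitrary measure `μ`. -/
def step (μ : Measure S) (a : A) : Measure S := H.lam.withDensity (H.stepDens μ a)

/-- The conditional expectation of `r` given the next state `t` and the next observation `a`, if
the present state has law `μ`. -/
def ratio (r : S → ℝ≥0) (μ : Measure S) (a : A) (t : S) : ℝ≥0 :=
  mean r (μ.withDensity fun s => (H.m s t a : ℝ≥0∞))

/-- Uniform bounds on the densities `m` and on the masses of the kernels `M_a`. -/
structure IsBoundedBy (C : ℝ≥0) : Prop where
  le : ∀ s t a, H.m s t a ≤ C
  lintegral_le : ∀ s a, ∫⁻ t, (H.m s t a : ℝ≥0∞) ∂H.lam ≤ C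

/-- The states to which the transfer operator is applied: a measurable function with values in
`[0, R]` and a finite measure with a density with respect to `lam`. -/
structure IsState (R : ℝ≥0) (r : S → ℝ≥0) (μ : Measure S) : Prop where
  measurable : Measurable r
  le : ∀ s, r s ≤ R
  exists_density : ∃ f : S → ℝ≥0∞, Measurable f ∧ ∫⁻ s, f s ∂H.lam ≠ ∞ ∧ μ = H.lam.withDensity f

variable {H}

theorem IsState.isFiniteMeasure {R : ℝ≥0} {r : S → ℝ≥0} {μ : Measure S} (h : H.IsState R r μ) :
    IsFiniteMeasure μ := by
  obtain ⟨f, -, hf, rfl⟩ := h.exists_density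
  exact isFiniteMeasure_withDensity hf

variable (H)

theorem measurable_m_fst (t : S) (a : A) : Measurable fun s => (H.m s t a : ℝ≥0∞) :=
  H.measurable_m_coe.comp (measurable_id.prodMk (measurable_const.prodMk measurable_const))

theorem measurable_stepDens (μ : Measure S) [SFinite μ] :
    Measurable fun z : A × S => H.stepDens μ z.1 z.2 := by
  refine Measurable.lintegral_prod_right' (f := fun w : (A × S) × S =>
    (H.m w.2 w.1.2 w.1.1 : ℝ≥0∞)) ?_
  exact H.measurable_m_coe.comp (f := fun w : (A × S) × S => (w.2, w.1.2, w.1.1)) (by fun_prop)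

theorem measurable_stepDens_right (μ : Measure S) [SFinite μ] (a : A) :
    Measurable (H.stepDens μ a) :=
  (H.measurable_stepDens μ).comp (f := fun t => (a, t)) (by fun_prop)

theorem stepDens_withDensity {f : S → ℝ≥0∞} (hf : Measurable f) (a : A) (t : S) :
    H.stepDens (H.lam.withDensity f) a t = ∫⁻ s, f s * H.m s t a ∂H.lam := by
  rw [stepDens, lintegral_withDensity_eq_lintegral_mul _ hf (H.measurable_m_fst t a)]
  rfl

theorem measurable_stepDens_uncurry {Ω : Type*} [MeasurableSpace Ω] {f : Ω → S → ℝ≥0∞}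
    (hf : Measurable (Function.uncurry f)) : Measurable fun z : (Ω × A) × S =>
      H.stepDens (H.lam.withDensity (f z.1.1)) z.1.2 z.2 := by
  simp_rw [fun z : (Ω × A) × S => H.stepDens_withDensity (f := f z.1.1)
    (hf.comp measurable_prodMk_left) z.1.2 z.2]
  refine Measurable.lintegral_prod_right' (f := fun w : ((Ω × A) × S) × S =>
    f w.1.1.1 w.2 * H.m w.2 w.1.2 w.1.1.2) ?_
  refine Measurable.mul ?_ ?_
  · exact hf.comp (f := fun w : ((Ω × A) × S) × S => (w.1.1.1, w.2)) (by fun_prop)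
  · exact H.measurable_m_coe.comp (f := fun w : ((Ω × A) × S) × S => (w.2, w.1.2, w.1.1.2))
      (by fun_prop)

theorem ratio_eq {r : S → ℝ≥0} (hr : Measurable r) (μ : Measure S) (a : A) (t : S) :
    H.ratio r μ a t = ((∫⁻ s, r s * H.m s t a ∂μ) / H.stepDens μ a t).toNNReal := by
  rw [ratio, mean, withDensity_apply _ MeasurableSet.univ, Measure.restrict_univ,
    lintegral_withDensity_eq_lintegral_mul _ (H.measurable_m_fst t a) hr.coe_nnreal_ennreal]
  simp_rw [Pi.mul_apply, mul_comm (H.m _ t a : ℝ≥0∞)]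
  rfl

theorem measurable_ratio {r : S → ℝ≥0} (hr : Measurable r) (μ : Measure S) [SFinite μ] :
    Measurable fun z : A × S => H.ratio r μ z.1 z.2 := by
  simp_rw [H.ratio_eq hr]
  refine Measurable.ennreal_toNNReal (Measurable.div ?_ (H.measurable_stepDens μ))
  refine Measurable.lintegral_prod_right' (f := fun w : (A × S) × S =>
    (r w.2 : ℝ≥0∞) * H.m w.2 w.1.2 w.1.1) ?_
  exact (hr.coe_nnreal_ennreal.comp measurable_snd).mul (H.measurable_m_coe.comp
    (f := fun w : (A × S) × S => (w.2, w.1.2, w.1.1)) (by fun_prop))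

theorem measurable_ratio_uncurry {Ω : Type*} [MeasurableSpace Ω] {r : Ω → S → ℝ≥0}
    (hr : Measurable (Function.uncurry r)) {f : Ω → S → ℝ≥0∞}
    (hf : Measurable (Function.uncurry f)) : Measurable fun z : (Ω × A) × S =>
      H.ratio (r z.1.1) (H.lam.withDensity (f z.1.1)) z.1.2 z.2 := by
  have hrω : ∀ ω, Measurable (r ω) := fun ω => hr.comp measurable_prodMk_left
  have hfω : ∀ ω, Measurable (f ω) := fun ω => hf.comp measurable_prodMk_left
  simp_rw [fun z : (Ω × A) × S => H.ratio_eq (hrω z.1.1) (H.lam.withDensity (f z.1.1)) z.1.2 z.2]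
  refine Measurable.ennreal_toNNReal (Measurable.div ?_ (H.measurable_stepDens_uncurry hf))
  have e : ∀ z : (Ω × A) × S, ∫⁻ s, (r z.1.1 s : ℝ≥0∞) * H.m s z.2 z.1.2
      ∂H.lam.withDensity (f z.1.1) =
      ∫⁻ s, f z.1.1 s * ((r z.1.1 s : ℝ≥0∞) * H.m s z.2 z.1.2) ∂H.lam := by
    intro z
    have hm : Measurable fun s => (r z.1.1 s : ℝ≥0∞) * H.m s z.2 z.1.2 :=
      (hrω _).coe_nnreal_ennreal.mul (H.measurable_m_fst _ _)
    rw [lintegral_withDensity_eq_lintegral_mul _ (hfω _) hm]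
    rfl
  simp_rw [e]
  refine Measurable.lintegral_prod_right' (f := fun w : ((Ω × A) × S) × S =>
    f w.1.1.1 w.2 * ((r w.1.1.1 w.2 : ℝ≥0∞) * H.m w.2 w.1.2 w.1.1.2)) ?_
  refine Measurable.mul ?_ (Measurable.fun_mul ?_ ?_)
  · exact hf.comp (f := fun w : ((Ω × A) × S) × S => (w.1.1.1, w.2)) (by fun_prop)
  · exact hr.coe_nnreal_ennreal.comp (f := fun w : ((Ω × A) × S) × S => (w.1.1.1, w.2))
      (by fun_prop)
  · exact H.measurable_m_coe.comp (f := fun w : ((Ω × A) × S) × S => (w.2, w.1.2, w.1.1.2))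
      (by fun_prop)

theorem lintegral_step (μ : Measure S) [SFinite μ] (a : A) {φ : S → ℝ≥0∞} (hφ : Measurable φ) :
    ∫⁻ t, φ t ∂H.step μ a = ∫⁻ t, H.stepDens μ a t * φ t ∂H.lam := by
  rw [step, lintegral_withDensity_eq_lintegral_mul _ (H.measurable_stepDens_right μ a) hφ]
  rfl

/-- Tonelli's theorem for the joint law of the present state, the next state and the next
observation. -/
theorem lintegral_triple_swap (μ : Measure S) [SFinite μ] {φ : S → S → A → ℝ≥0∞}
    (hφ : Measurable fun z : S × S × A => φ z.1 z.2.1 z.2.2) :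
    ∫⁻ a, ∫⁻ t, ∫⁻ s, H.m s t a * φ s t a ∂μ ∂H.lam ∂H.tau =
      ∫⁻ s, ∫⁻ t, ∫⁻ a, H.m s t a * φ s t a ∂H.tau ∂H.lam ∂μ := by
  have hm : Measurable fun z : S × S × A => H.m z.1 z.2.1 z.2.2 * φ z.1 z.2.1 z.2.2 :=
    H.measurable_m_coe.mul hφ
  have h1 : ∫⁻ a, ∫⁻ t, ∫⁻ s, H.m s t a * φ s t a ∂μ ∂H.lam ∂H.tau =
      ∫⁻ t, ∫⁻ a, ∫⁻ s, H.m s t a * φ s t a ∂μ ∂H.tau ∂H.lam := by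
    refine lintegral_lintegral_swap (Measurable.aemeasurable ?_)
    refine Measurable.lintegral_prod_right' (f := fun w : (A × S) × S =>
      H.m w.2 w.1.2 w.1.1 * φ w.2 w.1.2 w.1.1) ?_
    exact hm.comp (f := fun w : (A × S) × S => (w.2, w.1.2, w.1.1)) (by fun_prop)
  have h2 : ∀ t, ∫⁻ a, ∫⁻ s, H.m s t a * φ s t a ∂μ ∂H.tau =
      ∫⁻ s, ∫⁻ a, H.m s t a * φ s t a ∂H.tau ∂μ := by
    intro t
    refine lintegral_lintegral_swap (Measurable.aemeasurable ?_)
    exact hm.comp (f := fun w : A × S => (w.2, t, w.1)) (by fun_prop)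
  rw [h1]
  simp_rw [h2]
  refine lintegral_lintegral_swap (Measurable.aemeasurable ?_)
  refine Measurable.lintegral_prod_right' (f := fun w : (S × S) × A =>
      H.m w.1.2 w.1.1 w.2 * φ w.1.2 w.1.1 w.2) ?_
  exact hm.comp (f := fun w : (S × S) × A => (w.1.2, w.1.1, w.2)) (by fun_prop)

theorem lintegral_lintegral_step (μ : Measure S) [SFinite μ] {φ : S → A → ℝ≥0∞}
    (hφ : Measurable fun z : S × A => φ z.1 z.2) :
    ∫⁻ a, ∫⁻ t, φ t a ∂H.step μ a ∂H.tau =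
      ∫⁻ s, ∫⁻ t, ∫⁻ a, H.m s t a * φ t a ∂H.tau ∂H.lam ∂μ := by
  rw [← H.lintegral_triple_swap μ (φ := fun _ t a => φ t a) (hφ.comp (by fun_prop))]
  refine lintegral_congr fun a => ?_
  have hφa : Measurable fun t => φ t a := hφ.comp (f := fun t => (t, a)) (by fun_prop)
  rw [H.lintegral_step μ a hφa]
  refine lintegral_congr fun t => ?_
  rw [lintegral_mul_const _ (H.measurable_m_fst t a)]
  rfl

theorem lintegral_step_univ (μ : Measure S) [SFinite μ] :
    ∫⁻ a, H.step μ a Set.univ ∂H.tau = μ Set.univ := by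
  have h := H.lintegral_lintegral_step μ (φ := fun _ _ => 1) measurable_const
  simpa [H.lintegral_m] using h

/-- The defining property of the conditional expectation `ratio`. It holds also where the density
`stepDens` vanishes, as both sides are then zero. -/
theorem stepDens_mul_ratio {R C : ℝ≥0} (hH : H.IsBoundedBy C) {r : S → ℝ≥0}
    (hrm : Measurable r) (hr : ∀ s, r s ≤ R) (μ : Measure S) [IsFiniteMeasure μ] (a : A) (t : S) :
    H.stepDens μ a t * H.ratio r μ a t = ∫⁻ s, r s * H.m s t a ∂μ := by
  have hd : H.stepDens μ a t = μ.withDensity (fun s => (H.m s t a : ℝ≥0∞)) Set.univ := by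
    rw [withDensity_apply _ MeasurableSet.univ, Measure.restrict_univ]; rfl
  have : IsFiniteMeasure (μ.withDensity fun s => (H.m s t a : ℝ≥0∞)) := by
    refine isFiniteMeasure_withDensity (ne_top_of_le_ne_top ?_
      (lintegral_le_mul_mass (fun s => hH.le s t a) μ))
    finiteness
  rw [hd, mul_comm, ratio, mean_mul_mass hr,
    lintegral_withDensity_eq_lintegral_mul _ (H.measurable_m_fst t a) hrm.coe_nnreal_ennreal]
  simp_rw [Pi.mul_apply, mul_comm (H.m _ t a : ℝ≥0∞)]

variable {H}

theorem IsBoundedBy.stepDens_le {C : ℝ≥0} (hH : H.IsBoundedBy C) (μ : Measure S) (a : A) (t : S) :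
    H.stepDens μ a t ≤ C * μ Set.univ :=
  lintegral_le_mul_mass (fun s => hH.le s t a) μ

theorem IsBoundedBy.lintegral_stepDens_le {C : ℝ≥0} (hH : H.IsBoundedBy C) (μ : Measure S)
    [SFinite μ] (a : A) : ∫⁻ t, H.stepDens μ a t ∂H.lam ≤ C * μ Set.univ := by
  have hm : Measurable (Function.uncurry fun t s => (H.m s t a : ℝ≥0∞)) :=
    H.measurable_m_coe.comp (f := fun w : S × S => (w.2, w.1, a)) (by fun_prop)
  unfold stepDens
  rw [lintegral_lintegral_swap hm.aemeasurable]
  calc _ ≤ ∫⁻ _, (C : ℝ≥0∞) ∂μ := lintegral_mono fun s => hH.lintegral_le s a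
    _ = _ := by simp

theorem IsBoundedBy.lintegral_stepDens_ne_top {C : ℝ≥0} (hH : H.IsBoundedBy C) (μ : Measure S)
    [IsFiniteMeasure μ] (a : A) : ∫⁻ t, H.stepDens μ a t ∂H.lam ≠ ∞ :=
  ne_top_of_le_ne_top (by finiteness) (hH.lintegral_stepDens_le μ a)

theorem IsState.step {R C : ℝ≥0} {r : S → ℝ≥0} {μ : Measure S} (h : H.IsState R r μ)
    (hH : H.IsBoundedBy C) (a : A) : H.IsState R (H.ratio r μ a) (H.step μ a) := by
  have := h.isFiniteMeasure
  exact ⟨(H.measurable_ratio h.measurable μ).comp (f := fun t => (a, t)) (by fun_prop),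
    fun t => mean_le h.le _, H.stepDens μ a, H.measurable_stepDens_right μ a,
    hH.lintegral_stepDens_ne_top μ a, rfl⟩

variable (H)

/-- Functionals of a state `(r, μ)`. -/
abbrev Functional (S : Type*) [MeasurableSpace S] := (S → ℝ≥0) → Measure S → ℝ≥0∞

/-- The transfer operator: `(T Φ) (r, μ)` is the integral over the next observation `a` of `Φ` at
the updated state, whose function is the conditional expectation of `r`. -/
def transfer (Φ : Functional S) : Functional S :=
  fun r μ => ∫⁻ a, Φ (H.ratio r μ a) (H.step μ a) ∂H.tau

/-- A functional is measurable if it is measurable along every jointly measurable family of states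
with parameters in the universe of the observation space. -/
def IsMeasurableFunctional (Φ : Functional S) : Prop :=
  ∀ (Ω : Type v) [MeasurableSpace Ω] (r : Ω → S → ℝ≥0) (f : Ω → S → ℝ≥0∞),
    Measurable (Function.uncurry r) → Measurable (Function.uncurry f) →
    (∀ ω, ∫⁻ s, f ω s ∂H.lam ≠ ∞) → Measurable fun ω => Φ (r ω) (H.lam.withDensity (f ω))

variable {H} {R C : ℝ≥0} {Φ Ψ : Functional S}

theorem IsMeasurableFunctional.comp_step (hΦ : H.IsMeasurableFunctional Φ)
    (hH : H.IsBoundedBy C) {Ω : Type v} [MeasurableSpace Ω] {r : Ω → S → ℝ≥0} {f : Ω → S → ℝ≥0∞}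
    (hr : Measurable (Function.uncurry r)) (hf : Measurable (Function.uncurry f))
    (hfin : ∀ ω, ∫⁻ s, f ω s ∂H.lam ≠ ∞) :
    Measurable fun z : Ω × A => Φ (H.ratio (r z.1) (H.lam.withDensity (f z.1)) z.2)
      (H.step (H.lam.withDensity (f z.1)) z.2) := by
  refine hΦ (Ω × A) (fun z => H.ratio (r z.1) (H.lam.withDensity (f z.1)) z.2)
    (fun z => H.stepDens (H.lam.withDensity (f z.1)) z.2) (H.measurable_ratio_uncurry hr hf)
    (H.measurable_stepDens_uncurry hf) fun z => ?_
  have : IsFiniteMeasure (H.lam.withDensity (f z.1)) := isFiniteMeasure_withDensity (hfin z.1)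
  exact hH.lintegral_stepDens_ne_top _ _

theorem IsMeasurableFunctional.transfer (hΦ : H.IsMeasurableFunctional Φ)
    (hH : H.IsBoundedBy C) : H.IsMeasurableFunctional (H.transfer Φ) := by
  intro Ω _ r f hr hf hfin
  exact (hΦ.comp_step hH hr hf hfin).lintegral_prod_right'

theorem IsMeasurableFunctional.iterate (hΦ : H.IsMeasurableFunctional Φ)
    (hH : H.IsBoundedBy C) (n : ℕ) : H.IsMeasurableFunctional (H.transfer^[n] Φ) := by
  induction n generalizing Φ with
  | zero => exact hΦ
  | succ n ih =>
    rw [Function.iterate_succ_apply]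
    exact ih (hΦ.transfer hH)

theorem IsMeasurableFunctional.measurable_step (hΦ : H.IsMeasurableFunctional Φ)
    (hH : H.IsBoundedBy C) {r : S → ℝ≥0} {μ : Measure S} (h : H.IsState R r μ) :
    Measurable fun a => Φ (H.ratio r μ a) (H.step μ a) := by
  obtain ⟨f, hf, hfin, rfl⟩ := h.exists_density
  have := hΦ.comp_step hH (Ω := PUnit) (r := fun _ => r) (f := fun _ => f)
    (h.measurable.comp measurable_snd) (hf.comp measurable_snd) (fun _ => hfin)
  exact this.comp (f := fun a => (PUnit.unit, a)) (by fun_prop)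

theorem IsMeasurableFunctional.add (hΦ : H.IsMeasurableFunctional Φ)
    (hΨ : H.IsMeasurableFunctional Ψ) : H.IsMeasurableFunctional (Φ + Ψ) :=
  fun Ω _ r f hr hf hfin => (hΦ Ω r f hr hf hfin).add (hΨ Ω r f hr hf hfin)

theorem IsMeasurableFunctional.smul (hΦ : H.IsMeasurableFunctional Φ) (c : ℝ≥0∞) :
    H.IsMeasurableFunctional (c • Φ) :=
  fun Ω _ r f hr hf hfin => (hΦ Ω r f hr hf hfin).const_mul c

variable (H) in
/-- Pointwise inequality of functionals on the states with functions bounded by `R`. -/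
def LeOn (R : ℝ≥0) (Φ Ψ : Functional S) : Prop := ∀ r μ, H.IsState R r μ → Φ r μ ≤ Ψ r μ

/-- The transfer operator is monotone, since the states with functions bounded by `R` are stable
under updates. -/
theorem LeOn.transfer (h : H.LeOn R Φ Ψ) (hH : H.IsBoundedBy C) :
    H.LeOn R (H.transfer Φ) (H.transfer Ψ) :=
  fun _ _ hs => lintegral_mono fun a => h _ _ (hs.step hH a)

theorem LeOn.iterate (h : H.LeOn R Φ Ψ) (hH : H.IsBoundedBy C) (n : ℕ) :
    H.LeOn R (H.transfer^[n] Φ) (H.transfer^[n] Ψ) := by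
  induction n generalizing Φ Ψ with
  | zero => exact h
  | succ n ih =>
    rw [Function.iterate_succ_apply, Function.iterate_succ_apply]
    exact ih (h.transfer hH)

theorem transfer_add (hΦ : H.IsMeasurableFunctional Φ) (hH : H.IsBoundedBy C) {r : S → ℝ≥0}
    {μ : Measure S} (h : H.IsState R r μ) :
    H.transfer (Φ + Ψ) r μ = H.transfer Φ r μ + H.transfer Ψ r μ :=
  lintegral_add_left (hΦ.measurable_step hH h) _

theorem transfer_smul (hΦ : H.IsMeasurableFunctional Φ) (hH : H.IsBoundedBy C) (c : ℝ≥0∞)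
    {r : S → ℝ≥0} {μ : Measure S} (h : H.IsState R r μ) :
    H.transfer (c • Φ) r μ = c * H.transfer Φ r μ :=
  lintegral_const_mul c (hΦ.measurable_step hH h)

theorem LeOn.iterate_congr (h : ∀ r μ, H.IsState R r μ → Φ r μ = Ψ r μ) (hH : H.IsBoundedBy C)
    (n : ℕ) {r : S → ℝ≥0} {μ : Measure S} (hs : H.IsState R r μ) :
    H.transfer^[n] Φ r μ = H.transfer^[n] Ψ r μ :=
  le_antisymm (LeOn.iterate (fun r μ hs => (h r μ hs).le) hH n r μ hs)
    (LeOn.iterate (fun r μ hs => (h r μ hs).ge) hH n r μ hs)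

theorem iterate_add (hΦ : H.IsMeasurableFunctional Φ)
    (hH : H.IsBoundedBy C) (n : ℕ) {r : S → ℝ≥0} {μ : Measure S} (h : H.IsState R r μ) :
    H.transfer^[n] (Φ + Ψ) r μ = H.transfer^[n] Φ r μ + H.transfer^[n] Ψ r μ := by
  induction n generalizing r μ with
  | zero => rfl
  | succ n ih =>
    simp_rw [Function.iterate_succ_apply']
    rw [← transfer_add (hΦ.iterate hH n) hH h]
    exact lintegral_congr fun a => ih (h.step hH a)

theorem iterate_smul (hΦ : H.IsMeasurableFunctional Φ)
    (hH : H.IsBoundedBy C) (c : ℝ≥0∞) (n : ℕ) {r : S → ℝ≥0} {μ : Measure S}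
    (h : H.IsState R r μ) :
    H.transfer^[n] (c • Φ) r μ = c * H.transfer^[n] Φ r μ := by
  induction n generalizing r μ with
  | zero => rfl
  | succ n ih =>
    simp_rw [Function.iterate_succ_apply']
    rw [← transfer_smul (hΦ.iterate hH n) hH c h]
    exact lintegral_congr fun a => ih (h.step hH a)

variable (H) in
/-- A functional whose images under the iterated transfer operator tend to zero at every state. -/
structure Vanishes (R : ℝ≥0) (Φ : Functional S) : Prop where
  measurable : H.IsMeasurableFunctional Φ
  tendsto : ∀ r μ, H.IsState R r μ → Tendsto (fun n => H.transfer^[n] Φ r μ) atTop (𝓝 0)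

theorem Vanishes.mono (hΨ : H.Vanishes R Ψ) (hH : H.IsBoundedBy C)
    (hΦ : H.IsMeasurableFunctional Φ) (h : H.LeOn R Φ Ψ) : H.Vanishes R Φ :=
  ⟨hΦ, fun r μ hs => tendsto_of_tendsto_of_tendsto_of_le_of_le tendsto_const_nhds
    (hΨ.tendsto r μ hs) (fun _ => zero_le) fun n => h.iterate hH n r μ hs⟩

theorem Vanishes.add (hΦ : H.Vanishes R Φ) (hΨ : H.Vanishes R Ψ) (hH : H.IsBoundedBy C) :
    H.Vanishes R (Φ + Ψ) := by
  refine ⟨hΦ.measurable.add hΨ.measurable, fun r μ hs => ?_⟩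
  simp_rw [iterate_add hΦ.measurable hH _ hs]
  simpa using (hΦ.tendsto r μ hs).add (hΨ.tendsto r μ hs)

theorem Vanishes.smul (hΦ : H.Vanishes R Φ) (hH : H.IsBoundedBy C) {c : ℝ≥0∞} (hc : c ≠ ∞) :
    H.Vanishes R (c • Φ) := by
  refine ⟨hΦ.measurable.smul c, fun r μ hs => ?_⟩
  simp_rw [iterate_smul hΦ.measurable hH c _ hs]
  simpa using ENNReal.Tendsto.const_mul (hΦ.tendsto r μ hs) (Or.inr hc)

theorem Vanishes.transfer (hΦ : H.Vanishes R Φ) (hH : H.IsBoundedBy C) :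
    H.Vanishes R (H.transfer Φ) := by
  refine ⟨hΦ.measurable.transfer hH, fun r μ hs => ?_⟩
  simp_rw [← Function.iterate_succ_apply]
  exact (hΦ.tendsto r μ hs).comp (tendsto_add_atTop_nat 1)

end DensityHMM

/-! ### The loss of variance in one step -/

namespace DensityHMM

universe v

variable {S : Type*} {A : Type v} [MeasurableSpace S] [MeasurableSpace A] {H : DensityHMM S A}
  {R C : ℝ≥0}

/-- The integral of `g` with respect to the measure of a state. -/
def integralFunctional (g : S → ℝ≥0∞) : Functional S := fun _ μ => ∫⁻ s, g s ∂μ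

/-- The variance of `r` with respect to `μ`, with an additional weight `g`. -/
def weightedVariance (g : S → ℝ≥0∞) : Functional S :=
  fun r μ => ∫⁻ s, g s * sqDist (r s) (mean r μ) ∂μ

/-- The variance of `r` with respect to `μ`, not normalized by the mass of `μ`. -/
def variance : Functional S := fun r μ => ∫⁻ s, sqDist (r s) (mean r μ) ∂μ

/-- The mean absolute deviation of `r` from its mean with respect to `μ`. -/
def meanDeviation : Functional S :=
  fun r μ => ∫⁻ s, ENNReal.ofReal |(r s : ℝ) - mean r μ| ∂μ

/-- The integral of `r` with respect to `μ`. -/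
def firstMoment : Functional S := fun r μ => ∫⁻ s, r s ∂μ

variable (H) in
/-- The mean square change of the conditional expectation of `r` given the state of the chain when
time advances by one step. -/
def pointwiseLoss : Functional S := fun r μ =>
  ∫⁻ a, ∫⁻ t, ∫⁻ s, H.m s t a * sqDist (r s) (H.ratio r μ a t) ∂μ ∂H.lam ∂H.tau

variable (H) in
/-- The mean square change of the mean of `r` when the next observation is revealed. -/
def meanGain : Functional S := fun r μ =>
  ∫⁻ a, H.step μ a Set.univ * sqDist (mean (H.ratio r μ a) (H.step μ a)) (mean r μ) ∂H.tau

variable (H) in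
/-- The decrease of the variance in one step. -/
def varianceLoss : Functional S := H.pointwiseLoss + H.meanGain

theorem measurable_mean_uncurry {Ω : Type*} [MeasurableSpace Ω] {r : Ω → S → ℝ≥0}
    {f : Ω → S → ℝ≥0∞} (hr : Measurable (Function.uncurry r))
    (hf : Measurable (Function.uncurry f)) :
    Measurable fun ω => mean (r ω) (H.lam.withDensity (f ω)) := by
  have hrω : ∀ ω, Measurable (r ω) := fun ω => hr.comp measurable_prodMk_left
  have hfω : ∀ ω, Measurable (f ω) := fun ω => hf.comp measurable_prodMk_left
  unfold mean
  refine Measurable.ennreal_toNNReal (Measurable.div ?_ ?_)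
  · simp_rw [fun ω => lintegral_withDensity_eq_lintegral_mul H.lam (hfω ω)
      (hrω ω).coe_nnreal_ennreal]
    exact (hf.mul hr.coe_nnreal_ennreal).lintegral_prod_right'
  · simp_rw [withDensity_apply _ MeasurableSet.univ, Measure.restrict_univ]
    exact hf.lintegral_prod_right'

theorem measurable_lintegral_withDensity {Ω : Type*} [MeasurableSpace Ω] {φ f : Ω → S → ℝ≥0∞}
    (hφ : Measurable (Function.uncurry φ)) (hf : Measurable (Function.uncurry f)) :
    Measurable fun ω => ∫⁻ s, φ ω s ∂H.lam.withDensity (f ω) := by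
  have hφω : ∀ ω, Measurable (φ ω) := fun ω => hφ.comp measurable_prodMk_left
  have hfω : ∀ ω, Measurable (f ω) := fun ω => hf.comp measurable_prodMk_left
  simp_rw [fun ω => lintegral_withDensity_eq_lintegral_mul H.lam (hfω ω) (hφω ω)]
  exact (hf.mul hφ).lintegral_prod_right'

theorem isMeasurableFunctional_integral {g : S → ℝ≥0∞} (hg : Measurable g) :
    H.IsMeasurableFunctional (integralFunctional g) :=
  fun _ _ _ _ _ hf _ => measurable_lintegral_withDensity (φ := fun _ => g)
    (hg.comp measurable_snd) hf

theorem isMeasurableFunctional_firstMoment :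
    H.IsMeasurableFunctional (firstMoment (S := S)) :=
  fun _ _ r _ hr hf _ => measurable_lintegral_withDensity (φ := fun ω s => (r ω s : ℝ≥0∞))
    hr.coe_nnreal_ennreal hf

theorem isMeasurableFunctional_weightedVariance {g : S → ℝ≥0∞} (hg : Measurable g) :
    H.IsMeasurableFunctional (weightedVariance g) := by
  intro Ω _ r f hr hf _
  refine measurable_lintegral_withDensity (φ := fun ω s =>
    g s * sqDist (r ω s) (mean (r ω) (H.lam.withDensity (f ω)))) ?_ hf
  exact (hg.comp measurable_snd).mul
    (hr.sqDist ((measurable_mean_uncurry hr hf).comp measurable_fst))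

theorem weightedVariance_one : weightedVariance (fun _ : S => 1) = variance := by
  funext r μ
  simp [weightedVariance, variance]

theorem isMeasurableFunctional_variance : H.IsMeasurableFunctional (variance (S := S)) := by
  rw [← weightedVariance_one]
  exact isMeasurableFunctional_weightedVariance measurable_const

theorem isMeasurableFunctional_meanDeviation :
    H.IsMeasurableFunctional (meanDeviation (S := S)) := by
  intro Ω _ r f hr hf _
  refine measurable_lintegral_withDensity (φ := fun ω s =>
    ENNReal.ofReal |(r ω s : ℝ) - mean (r ω) (H.lam.withDensity (f ω))|) ?_ hf
  have h1 : Measurable fun z : Ω × S => (r z.1 z.2 : ℝ) := hr.coe_nnreal_real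
  have h2 : Measurable fun z : Ω × S => (mean (r z.1) (H.lam.withDensity (f z.1)) : ℝ) :=
    ((measurable_mean_uncurry hr hf).comp measurable_fst).coe_nnreal_real
  exact (h1.sub h2).abs.ennreal_ofReal

theorem isMeasurableFunctional_pointwiseLoss : H.IsMeasurableFunctional H.pointwiseLoss := by
  intro Ω _ r f hr hf _
  have hfω : ∀ ω, Measurable (f ω) := fun ω => hf.comp measurable_prodMk_left
  unfold pointwiseLoss
  refine Measurable.lintegral_prod_right' (f := fun z : Ω × A => ∫⁻ t, ∫⁻ s, H.m s t z.2 *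
    sqDist (r z.1 s) (H.ratio (r z.1) (H.lam.withDensity (f z.1)) z.2 t)
    ∂(H.lam.withDensity (f z.1)) ∂H.lam) ?_
  refine Measurable.lintegral_prod_right' (f := fun z : (Ω × A) × S => ∫⁻ s, H.m s z.2 z.1.2 *
    sqDist (r z.1.1 s) (H.ratio (r z.1.1) (H.lam.withDensity (f z.1.1)) z.1.2 z.2)
    ∂(H.lam.withDensity (f z.1.1))) ?_
  refine measurable_lintegral_withDensity (φ := fun (z : (Ω × A) × S) s => H.m s z.2 z.1.2 *
    sqDist (r z.1.1 s) (H.ratio (r z.1.1) (H.lam.withDensity (f z.1.1)) z.1.2 z.2))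
    (f := fun (z : (Ω × A) × S) s => f z.1.1 s) ?_ ?_
  · have h1 : Measurable fun w : ((Ω × A) × S) × S => (H.m w.2 w.1.2 w.1.1.2 : ℝ≥0∞) :=
      H.measurable_m_coe.comp (f := fun w : ((Ω × A) × S) × S => (w.2, w.1.2, w.1.1.2))
        (by fun_prop)
    have h2 : Measurable fun w : ((Ω × A) × S) × S => r w.1.1.1 w.2 :=
      hr.comp (f := fun w : ((Ω × A) × S) × S => (w.1.1.1, w.2)) (by fun_prop)
    have h3 : Measurable fun w : ((Ω × A) × S) × S =>
        H.ratio (r w.1.1.1) (H.lam.withDensity (f w.1.1.1)) w.1.1.2 w.1.2 :=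
      (H.measurable_ratio_uncurry hr hf).comp measurable_fst
    exact h1.mul (h2.sqDist h3)
  · exact hf.comp (f := fun w : ((Ω × A) × S) × S => (w.1.1.1, w.2)) (by fun_prop)

theorem isMeasurableFunctional_meanGain : H.IsMeasurableFunctional H.meanGain := by
  intro Ω _ r f hr hf _
  unfold meanGain
  refine Measurable.lintegral_prod_right' (f := fun z : Ω × A =>
    H.step (H.lam.withDensity (f z.1)) z.2 Set.univ *
      sqDist (mean (H.ratio (r z.1) (H.lam.withDensity (f z.1)) z.2)
        (H.step (H.lam.withDensity (f z.1)) z.2)) (mean (r z.1) (H.lam.withDensity (f z.1)))) ?_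
  refine Measurable.mul ?_ (Measurable.sqDist ?_ ?_)
  · unfold step
    simp_rw [withDensity_apply _ MeasurableSet.univ, Measure.restrict_univ]
    exact (H.measurable_stepDens_uncurry hf).lintegral_prod_right'
  · exact measurable_mean_uncurry (r := fun z : Ω × A =>
      H.ratio (r z.1) (H.lam.withDensity (f z.1)) z.2)
      (f := fun z : Ω × A => H.stepDens (H.lam.withDensity (f z.1)) z.2)
      (H.measurable_ratio_uncurry hr hf) (H.measurable_stepDens_uncurry hf)
  · exact (measurable_mean_uncurry hr hf).comp measurable_fst

theorem isMeasurableFunctional_varianceLoss : H.IsMeasurableFunctional H.varianceLoss :=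
  isMeasurableFunctional_pointwiseLoss.add isMeasurableFunctional_meanGain

/-- The bias-variance decomposition with respect to the law of the present state given the next
state `t` and the next observation `a`. -/
theorem lintegral_mul_sqDist_eq (hH : H.IsBoundedBy C) {r : S → ℝ≥0} {μ : Measure S}
    (h : H.IsState R r μ) (a : A) (t : S) (c : ℝ≥0) :
    ∫⁻ s, H.m s t a * sqDist (r s) c ∂μ =
      ∫⁻ s, H.m s t a * sqDist (r s) (H.ratio r μ a t) ∂μ +
        H.stepDens μ a t * sqDist (H.ratio r μ a t) c := by
  have := h.isFiniteMeasure
  have hfin : IsFiniteMeasure (μ.withDensity fun s => (H.m s t a : ℝ≥0∞)) := by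
    refine isFiniteMeasure_withDensity (ne_top_of_le_ne_top ?_ (hH.stepDens_le μ a t))
    finiteness
  have key := lintegral_sqDist_eq h.measurable h.le
    (μ.withDensity fun s => (H.m s t a : ℝ≥0∞)) c
  have e : ∀ d : ℝ≥0, ∫⁻ s, sqDist (r s) d ∂(μ.withDensity fun s => (H.m s t a : ℝ≥0∞)) =
      ∫⁻ s, H.m s t a * sqDist (r s) d ∂μ := by
    intro d
    rw [lintegral_withDensity_eq_lintegral_mul _ (H.measurable_m_fst t a)
      (h.measurable.sqDist measurable_const)]
    rfl
  rw [e, e, withDensity_apply _ MeasurableSet.univ, Measure.restrict_univ] at key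
  exact key

theorem lintegral_lintegral_mul_sqDist_eq (hH : H.IsBoundedBy C) {r : S → ℝ≥0} {μ : Measure S}
    (h : H.IsState R r μ) (a : A) (c : ℝ≥0) :
    ∫⁻ t, ∫⁻ s, H.m s t a * sqDist (r s) c ∂μ ∂H.lam =
      ∫⁻ t, ∫⁻ s, H.m s t a * sqDist (r s) (H.ratio r μ a t) ∂μ ∂H.lam +
        (variance (H.ratio r μ a) (H.step μ a) +
          H.step μ a Set.univ * sqDist (mean (H.ratio r μ a) (H.step μ a)) c) := by
  have := h.isFiniteMeasure
  have hs := h.step hH a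
  have := hs.isFiniteMeasure
  simp_rw [lintegral_mul_sqDist_eq hH h a _ c]
  have hm : Measurable fun t => H.stepDens μ a t * sqDist (H.ratio r μ a t) c :=
    (H.measurable_stepDens_right μ a).mul (hs.measurable.sqDist measurable_const)
  rw [lintegral_add_right _ hm, ← H.lintegral_step μ a (hs.measurable.sqDist measurable_const),
    lintegral_sqDist_eq hs.measurable hs.le (H.step μ a) c]
  rfl

theorem measurable_lintegral_lintegral_loss {r : S → ℝ≥0} {μ : Measure S} [SFinite μ]
    (hr : Measurable r) : Measurable fun a =>
      ∫⁻ t, ∫⁻ s, H.m s t a * sqDist (r s) (H.ratio r μ a t) ∂μ ∂H.lam := by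
  refine Measurable.lintegral_prod_right' (f := fun z : A × S =>
    ∫⁻ s, H.m s z.2 z.1 * sqDist (r s) (H.ratio r μ z.1 z.2) ∂μ) ?_
  refine Measurable.lintegral_prod_right' (f := fun z : (A × S) × S =>
    H.m z.2 z.1.2 z.1.1 * sqDist (r z.2) (H.ratio r μ z.1.1 z.1.2)) ?_
  refine Measurable.mul ?_ (Measurable.sqDist ?_ ?_)
  · exact H.measurable_m_coe.comp (f := fun w : (A × S) × S => (w.2, w.1.2, w.1.1))
        (by fun_prop)
  · exact hr.comp measurable_snd
  · exact (H.measurable_ratio hr μ).comp measurable_fst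

/-- The exact loss of variance in one step. -/
theorem variance_eq (hH : H.IsBoundedBy C) {r : S → ℝ≥0} {μ : Measure S}
    (h : H.IsState R r μ) :
    variance r μ = H.transfer variance r μ + H.varianceLoss r μ := by
  have := h.isFiniteMeasure
  have hsq : Measurable fun s => sqDist (r s) (mean r μ) := h.measurable.sqDist measurable_const
  have e : variance r μ =
      ∫⁻ a, ∫⁻ t, ∫⁻ s, H.m s t a * sqDist (r s) (mean r μ) ∂μ ∂H.lam ∂H.tau := by
    rw [H.lintegral_triple_swap μ (φ := fun s _ _ => sqDist (r s) (mean r μ))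
      (hsq.comp measurable_fst)]
    refine lintegral_congr fun s => ?_
    have e1 : ∀ t, ∫⁻ a, H.m s t a * sqDist (r s) (mean r μ) ∂H.tau =
        (∫⁻ a, H.m s t a ∂H.tau) * sqDist (r s) (mean r μ) := by
      intro t
      refine lintegral_mul_const _ ?_
      exact H.measurable_m_coe.comp (f := fun a => (s, t, a)) (by fun_prop)
    simp_rw [e1]
    rw [lintegral_mul_const, H.lintegral_m, one_mul]
    refine Measurable.lintegral_prod_right' (f := fun z : S × A => (H.m s z.1 z.2 : ℝ≥0∞)) ?_
    exact H.measurable_m_coe.comp (f := fun z : S × A => (s, z.1, z.2)) (by fun_prop)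
  rw [e]
  simp_rw [lintegral_lintegral_mul_sqDist_eq hH h]
  rw [lintegral_add_left (measurable_lintegral_lintegral_loss h.measurable),
    lintegral_add_left (isMeasurableFunctional_variance.measurable_step hH h)]
  simp only [varianceLoss, Pi.add_apply, pointwiseLoss, meanGain, transfer]
  ring

/-- The weighted variance at time zero, for a weight that is the conditional expectation of a
weight at time one, is controlled by the weighted variance at time one and the loss of variance. -/
theorem weightedVariance_le {r : S → ℝ≥0} {μ : Measure S}
    (h : H.IsState R r μ) {g : S → A → ℝ≥0∞} (hg : Measurable fun z : S × A => g z.1 z.2)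
    (hg1 : ∀ t a, g t a ≤ 1) :
    weightedVariance (fun s => ∫⁻ t, ∫⁻ a, H.m s t a * g t a ∂H.tau ∂H.lam) r μ ≤
      3 * H.varianceLoss r μ + 3 * ∫⁻ a, weightedVariance (fun t => g t a) (H.ratio r μ a)
        (H.step μ a) ∂H.tau := by
  have := h.isFiniteMeasure
  have hsq : Measurable fun s => sqDist (r s) (mean r μ) := h.measurable.sqDist measurable_const
  have hmg : ∀ s, Measurable fun z : S × A => (H.m s z.1 z.2 : ℝ≥0∞) * g z.1 z.2 := fun s =>
    (H.measurable_m_coe.comp (f := fun z : S × A => (s, z.1, z.2)) (by fun_prop)).mul hg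
  have e : weightedVariance (fun s => ∫⁻ t, ∫⁻ a, H.m s t a * g t a ∂H.tau ∂H.lam) r μ =
      ∫⁻ a, ∫⁻ t, ∫⁻ s, H.m s t a * (g t a * sqDist (r s) (mean r μ)) ∂μ ∂H.lam ∂H.tau := by
    rw [H.lintegral_triple_swap μ (φ := fun s t a => g t a * sqDist (r s) (mean r μ))
      ((hg.comp measurable_snd).mul (hsq.comp measurable_fst))]
    refine lintegral_congr fun s => ?_
    simp_rw [← mul_assoc]
    have e1 : ∀ t, ∫⁻ a, H.m s t a * g t a * sqDist (r s) (mean r μ) ∂H.tau =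
        (∫⁻ a, H.m s t a * g t a ∂H.tau) * sqDist (r s) (mean r μ) :=
      fun t => lintegral_mul_const _ ((hmg s).comp (f := fun a => (t, a)) (by fun_prop))
    simp_rw [e1]
    rw [lintegral_mul_const _ (hmg s).lintegral_prod_right']
  have hbound : ∀ a t, ∫⁻ s, H.m s t a * (g t a * sqDist (r s) (mean r μ)) ∂μ ≤
      3 * (∫⁻ s, H.m s t a * sqDist (r s) (H.ratio r μ a t) ∂μ +
        H.stepDens μ a t * (g t a * sqDist (H.ratio r μ a t)
          (mean (H.ratio r μ a) (H.step μ a))) +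
        H.stepDens μ a t * sqDist (mean (H.ratio r μ a) (H.step μ a)) (mean r μ)) := by
    intro a t
    have hm := H.measurable_m_fst t a
    generalize H.ratio r μ a t = ρ
    generalize mean (H.ratio r μ a) (H.step μ a) = c
    rw [stepDens, ← lintegral_mul_const _ hm, ← lintegral_mul_const _ hm,
      ← lintegral_add_right _ (hm.mul_const _), ← lintegral_add_right _ (hm.mul_const _),
      ← lintegral_const_mul' _ _ (by norm_num)]
    refine lintegral_mono fun s => ?_
    calc H.m s t a * (g t a * sqDist (r s) (mean r μ))
        ≤ H.m s t a * (g t a * (3 * (sqDist (r s) ρ + sqDist ρ c + sqDist c (mean r μ)))) := by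
          gcongr; exact sqDist_le_three_mul _ _ _ _
      _ = 3 * (H.m s t a * (g t a * sqDist (r s) ρ) + H.m s t a * (g t a * sqDist ρ c) +
          H.m s t a * (g t a * sqDist c (mean r μ))) := by ring
      _ ≤ 3 * (H.m s t a * (1 * sqDist (r s) ρ) + H.m s t a * (g t a * sqDist ρ c) +
          H.m s t a * (1 * sqDist c (mean r μ))) := by
          gcongr <;> exact hg1 t a
      _ = _ := by rw [one_mul, one_mul]
  have hga : ∀ a, Measurable fun t => g t a := fun a =>
    hg.comp (f := fun t => (t, a)) (by fun_prop)
  have hra : ∀ a, Measurable (H.ratio r μ a) := fun a =>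
    (H.measurable_ratio h.measurable μ).comp (f := fun t => (a, t)) (by fun_prop)
  have hbound2 : ∀ a, ∫⁻ t, ∫⁻ s, H.m s t a * (g t a * sqDist (r s) (mean r μ)) ∂μ ∂H.lam ≤
      3 * (∫⁻ t, ∫⁻ s, H.m s t a * sqDist (r s) (H.ratio r μ a t) ∂μ ∂H.lam +
        weightedVariance (fun t => g t a) (H.ratio r μ a) (H.step μ a) +
        H.step μ a Set.univ * sqDist (mean (H.ratio r μ a) (H.step μ a)) (mean r μ)) := by
    intro a
    have hd := H.measurable_stepDens_right μ a
    have hw : Measurable fun t => g t a * sqDist (H.ratio r μ a t)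
        (mean (H.ratio r μ a) (H.step μ a)) := (hga a).mul ((hra a).sqDist measurable_const)
    refine (lintegral_mono fun t => hbound a t).trans (le_of_eq ?_)
    rw [lintegral_const_mul' _ _ (by norm_num), lintegral_add_right _ (hd.mul_const _),
      lintegral_add_right _ (hd.fun_mul hw), lintegral_mul_const _ hd, weightedVariance,
      H.lintegral_step μ a hw]
    congr 3
    rw [step, withDensity_apply _ MeasurableSet.univ, Measure.restrict_univ]
  rw [e]
  refine (lintegral_mono hbound2).trans (le_of_eq ?_)
  have hloss : Measurable fun a =>
      ∫⁻ t, ∫⁻ s, H.m s t a * sqDist (r s) (H.ratio r μ a t) ∂μ ∂H.lam :=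
    measurable_lintegral_lintegral_loss h.measurable
  have hmass : Measurable fun a => H.step μ a Set.univ := by
    simp_rw [step, withDensity_apply _ MeasurableSet.univ, Measure.restrict_univ]
    exact (H.measurable_stepDens μ).lintegral_prod_right'
  have hmean : Measurable fun a => mean (H.ratio r μ a) (H.step μ a) :=
    measurable_mean_uncurry (r := fun a => H.ratio r μ a) (f := fun a => H.stepDens μ a)
      (H.measurable_ratio h.measurable μ) (H.measurable_stepDens μ)
  rw [lintegral_const_mul' _ _ (by norm_num),
    lintegral_add_right _ (hmass.fun_mul (hmean.sqDist measurable_const)), lintegral_add_left hloss]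
  simp only [varianceLoss, Pi.add_apply, pointwiseLoss, meanGain]
  ring

theorem variance_ne_top {r : S → ℝ≥0} {μ : Measure S} (h : H.IsState R r μ) :
    variance r μ ≠ ∞ := by
  have := h.isFiniteMeasure
  refine ne_top_of_le_ne_top ?_ (lintegral_mono fun s => sqDist_le (h.le s) (mean_le h.le μ))
  simp only [lintegral_const]
  finiteness

/-- The loss of variance is summable along the iterates of the transfer operator. -/
theorem vanishes_varianceLoss (hH : H.IsBoundedBy C) : H.Vanishes R H.varianceLoss := by
  refine ⟨isMeasurableFunctional_varianceLoss, fun r μ h => ?_⟩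
  have hstep : ∀ n, H.transfer^[n] variance r μ =
      H.transfer^[n + 1] variance r μ + H.transfer^[n] H.varianceLoss r μ := by
    intro n
    rw [Function.iterate_succ_apply,
      ← iterate_add (isMeasurableFunctional_variance.transfer hH) hH n h]
    exact LeOn.iterate_congr (fun r μ hs => variance_eq hH hs) hH n h
  have hsum : ∀ n, ∑ k ∈ Finset.range n, H.transfer^[k] H.varianceLoss r μ +
      H.transfer^[n] variance r μ = variance r μ := by
    intro n
    induction n with
    | zero => simp
    | succ n ih =>
      rw [Finset.sum_range_succ, ← ih, hstep n]
      ring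
  refine ENNReal.tendsto_atTop_zero_of_tsum_ne_top (ne_top_of_le_ne_top (variance_ne_top h) ?_)
  rw [ENNReal.tsum_eq_iSup_nat]
  exact iSup_le fun n => le_self_add.trans (hsum n).le

end DensityHMM

/-! ### Vanishing of the variance -/

section StrongErgodicity

variable {X : Type*} [MeasurableSpace X]

instance isMarkovKernel_pow (Q : Kernel X X) [IsMarkovKernel Q] (n : ℕ) :
    IsMarkovKernel (Q ^ n) := by
  induction n with
  | zero => exact inferInstanceAs (IsMarkovKernel Kernel.id)
  | succ n ih =>
    rw [pow_succ]
    exact inferInstanceAs (IsMarkovKernel ((Q ^ n) ∘ₖ Q))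

theorem tendsto_lintegral_of_tendsto_tvDist {μ : ℕ → Measure X} {π : Measure X}
    [∀ n, IsProbabilityMeasure (μ n)] [IsProbabilityMeasure π]
    (h : Tendsto (fun n => tvDist (μ n) π) atTop (𝓝 0)) {φ : X → ℝ≥0∞} (hφ : Measurable φ)
    (hφ1 : ∀ x, φ x ≤ 1) :
    Tendsto (fun n => ∫⁻ x, φ x ∂(μ n)) atTop (𝓝 (∫⁻ x, φ x ∂π)) := by
  have h0 : Tendsto (fun n => ENNReal.ofReal (tvDist (μ n) π)) atTop (𝓝 0) := by
    simpa using ENNReal.tendsto_ofReal h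
  have hπ : ∫⁻ x, φ x ∂π ≠ ∞ := by
    refine ne_top_of_le_ne_top ENNReal.one_ne_top ((lintegral_mono hφ1).trans ?_)
    simp
  refine tendsto_of_tendsto_of_tendsto_of_le_of_le
    (g := fun n => ∫⁻ x, φ x ∂π - ENNReal.ofReal (tvDist (μ n) π))
    (h := fun n => ∫⁻ x, φ x ∂π + ENNReal.ofReal (tvDist (μ n) π)) ?_ ?_ ?_ ?_
  · simpa using ENNReal.Tendsto.sub tendsto_const_nhds h0 (Or.inl hπ)
  · simpa using tendsto_const_nhds.add h0
  · intro n
    refine tsub_le_iff_right.2 ?_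
    have := lintegral_le_add_tvDist π (μ n) hφ (c := 1) (by simpa using hφ1)
    rwa [ENNReal.coe_one, one_mul, tvDist_comm] at this
  · intro n
    have := lintegral_le_add_tvDist (μ n) π hφ (c := 1) (by simpa using hφ1)
    rwa [ENNReal.coe_one, one_mul] at this

/-- Under strong ergodicity the laws of the chain converge setwise for every initial law. -/
theorem StronglyErgodicWith.tendsto_lintegral_lintegral {Q : Kernel X X} [IsMarkovKernel Q]
    {π : Measure X} (h : StronglyErgodicWith Q π) (μ : Measure X) [IsFiniteMeasure μ]
    {φ : X → ℝ≥0∞} (hφ : Measurable φ) (hφ1 : ∀ x, φ x ≤ 1) :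
    Tendsto (fun n => ∫⁻ x, ∫⁻ y, φ y ∂((Q ^ n) x) ∂μ) atTop
      (𝓝 (μ Set.univ * ∫⁻ y, φ y ∂π)) := by
  have := h.1
  rw [mul_comm, ← lintegral_const]
  refine tendsto_lintegral_of_dominated_convergence (fun _ => 1)
    (fun n => hφ.lintegral_kernel) ?_ (by simp) ?_
  · refine fun n => Eventually.of_forall fun x => (lintegral_mono hφ1).trans ?_
    simp
  · exact Eventually.of_forall fun x => tendsto_lintegral_of_tendsto_tvDist (h.2 x) hφ hφ1

end StrongErgodicity

namespace DensityHMM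

universe v

variable {S : Type*} {A : Type v} [MeasurableSpace S] [MeasurableSpace A] {H : DensityHMM S A}
  {R C : ℝ≥0}

variable (H) in
theorem measurable_p : Measurable fun z : S × S => (H.p z.1 z.2 : ℝ≥0∞) := by
  simp_rw [H.p_eq]
  refine Measurable.lintegral_prod_right' (f := fun w : (S × S) × A =>
    (H.m w.1.1 w.1.2 w.2 : ℝ≥0∞)) ?_
  exact H.measurable_m_coe.comp (f := fun w : (S × S) × A => (w.1.1, w.1.2, w.2)) (by fun_prop)

variable (H) in
theorem measurable_p_right (s : S) : Measurable fun t => (H.p s t : ℝ≥0∞) :=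
  H.measurable_p.comp (f := fun t => (s, t)) (by fun_prop)

variable (H) in
theorem markovKernel_eq (s : S) :
    H.markovKernel s = H.lam.withDensity fun t => (H.p s t : ℝ≥0∞) := by
  ext F hF
  rw [H.markovKernel_apply s hF, withDensity_apply _ hF]

variable (H) in
theorem lintegral_markovKernel (s : S) {φ : S → ℝ≥0∞} (hφ : Measurable φ) :
    ∫⁻ t, φ t ∂H.markovKernel s = ∫⁻ t, H.p s t * φ t ∂H.lam := by
  rw [H.markovKernel_eq, lintegral_withDensity_eq_lintegral_mul _ (H.measurable_p_right s) hφ]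
  rfl

variable (H) in
theorem lintegral_p (s : S) : ∫⁻ t, H.p s t ∂H.lam = 1 := by
  simp_rw [H.p_eq]
  exact H.lintegral_m s

instance : IsMarkovKernel H.markovKernel := by
  refine ⟨fun s => ⟨?_⟩⟩
  rw [H.markovKernel_apply s MeasurableSet.univ, Measure.restrict_univ, H.lintegral_p]

theorem lintegral_lintegral_m_mul (s : S) (φ : S → ℝ≥0∞) (hφ : Measurable φ) :
    ∫⁻ t, ∫⁻ a, H.m s t a * φ t ∂H.tau ∂H.lam = ∫⁻ t, φ t ∂H.markovKernel s := by
  rw [H.lintegral_markovKernel s hφ]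
  refine lintegral_congr fun t => ?_
  have hm : Measurable fun a => (H.m s t a : ℝ≥0∞) :=
    H.measurable_m_coe.comp (f := fun a => (s, t, a)) (by fun_prop)
  rw [lintegral_mul_const _ hm, ← H.p_eq]

theorem transfer_integralFunctional {g : S → ℝ≥0∞} (hg : Measurable g) {r : S → ℝ≥0}
    {μ : Measure S} (h : H.IsState R r μ) : H.transfer (integralFunctional g) r μ =
      integralFunctional (fun s => ∫⁻ t, g t ∂H.markovKernel s) r μ := by
  have := h.isFiniteMeasure
  have e := H.lintegral_lintegral_step μ (φ := fun t _ => g t) (hg.comp measurable_fst)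
  simp_rw [lintegral_lintegral_m_mul _ g hg] at e
  exact e

/-- For functionals of the measure alone, the transfer operator is the Markov kernel of the hidden
chain. -/
theorem iterate_integralFunctional (hH : H.IsBoundedBy C) {g : S → ℝ≥0∞} (hg : Measurable g)
    (n : ℕ) {r : S → ℝ≥0} {μ : Measure S} (h : H.IsState R r μ) :
    H.transfer^[n] (integralFunctional g) r μ =
      ∫⁻ s, ∫⁻ t, g t ∂((H.markovKernel ^ n) s) ∂μ := by
  induction n generalizing g with
  | zero =>
    simp only [Function.iterate_zero, id_eq, pow_zero, integralFunctional]
    refine lintegral_congr fun s => ?_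
    change _ = ∫⁻ t, g t ∂(Kernel.id s)
    rw [Kernel.id_apply, lintegral_dirac' _ hg]
  | succ n ih =>
    rw [Function.iterate_succ_apply, LeOn.iterate_congr
      (fun r μ hs => transfer_integralFunctional hg hs) hH n h, ih hg.lintegral_kernel]
    refine lintegral_congr fun s => ?_
    rw [add_comm n 1, Kernel.pow_add, Kernel.lintegral_comp _ _ _ hg, pow_one]

variable (H) in
/-- A minorization condition: for observations in `B₀` the next state lies in a set `W a ⊆ F₀` of
mass at least `β`, and from `F₀` every point of `W a` is reached with density at least `c`. -/
structure IsMinorizedOn (F₀ : Set S) (B₀ : Set A) (W : A → Set S) (c β : ℝ≥0∞) : Prop where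
  measurableSet_left : MeasurableSet F₀
  measurableSet_right : MeasurableSet B₀
  measurableSet_support : ∀ a, MeasurableSet (W a)
  eq_zero : ∀ a ∈ B₀, ∀ t ∉ W a, ∀ s, H.m s t a = 0
  subset : ∀ a ∈ B₀, W a ⊆ F₀
  le : ∀ a ∈ B₀, ∀ t ∈ W a, ∀ s ∈ F₀, c ≤ H.m s t a
  mass_le : ∀ a ∈ B₀, β ≤ H.lam (W a)

variable {F₀ : Set S} {B₀ : Set A} {W : A → Set S} {c β : ℝ≥0∞}

/-- After an observation in `B₀` the chain is in `F₀`. -/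
theorem IsMinorizedOn.step_compl (hmin : H.IsMinorizedOn F₀ B₀ W c β) (μ : Measure S) {a : A}
    (ha : a ∈ B₀) : H.step μ a F₀ᶜ = 0 := by
  rw [DensityHMM.step, withDensity_apply _ hmin.measurableSet_left.compl]
  refine setLIntegral_eq_zero hmin.measurableSet_left.compl fun t ht => ?_
  have : ∀ s, H.m s t a = 0 := hmin.eq_zero a ha t fun h => ht (hmin.subset a ha h)
  simp [stepDens, this]

/-- If the chain is in `F₀`, then with a fixed probability the next step forgets the present
state, so that a fixed proportion of the variance is lost. -/
theorem IsMinorizedOn.mul_variance_le (hmin : H.IsMinorizedOn F₀ B₀ W c β)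
    {r : S → ℝ≥0} {μ : Measure S} (h : H.IsState R r μ)
    (hμ : μ F₀ᶜ = 0) : c * β * H.tau B₀ * variance r μ ≤ H.pointwiseLoss r μ := by
  have := h.isFiniteMeasure
  have hF : ∀ᵐ s ∂μ, s ∈ F₀ := by rwa [ae_iff]
  have h1 : ∀ a ∈ B₀, β * (c * variance r μ) ≤
      ∫⁻ t, ∫⁻ s, H.m s t a * sqDist (r s) (H.ratio r μ a t) ∂μ ∂H.lam := by
    intro a ha
    calc β * (c * variance r μ) ≤ H.lam (W a) * (c * variance r μ) := by
          gcongr; exact hmin.mass_le a ha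
      _ = ∫⁻ t in W a, c * variance r μ ∂H.lam := by
          rw [setLIntegral_const, mul_comm]
      _ ≤ ∫⁻ t in W a, ∫⁻ s, H.m s t a * sqDist (r s) (H.ratio r μ a t) ∂μ ∂H.lam := by
          refine setLIntegral_mono' (hmin.measurableSet_support a) fun t ht => ?_
          have hv : variance r μ ≤ ∫⁻ s, sqDist (r s) (H.ratio r μ a t) ∂μ := by
            rw [lintegral_sqDist_eq h.measurable h.le μ (H.ratio r μ a t)]
            exact le_self_add
          refine (mul_le_mul_right hv c).trans ?_
          rw [← lintegral_const_mul _ (h.measurable.sqDist measurable_const)]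
          refine lintegral_mono_ae ?_
          filter_upwards [hF] with s hs
          gcongr
          exact hmin.le a ha t ht s hs
      _ ≤ _ := setLIntegral_le_lintegral _ _
  calc c * β * H.tau B₀ * variance r μ = ∫⁻ a in B₀, β * (c * variance r μ) ∂H.tau := by
        rw [setLIntegral_const]; ring
    _ ≤ ∫⁻ a in B₀, ∫⁻ t, ∫⁻ s, H.m s t a * sqDist (r s) (H.ratio r μ a t) ∂μ ∂H.lam ∂H.tau :=
        setLIntegral_mono' hmin.measurableSet_right h1
    _ ≤ _ := setLIntegral_le_lintegral _ _

/-- From `F₀` the next observation is in `B₀` with a probability bounded from below. -/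
theorem IsMinorizedOn.le_lintegral (hmin : H.IsMinorizedOn F₀ B₀ W c β) {s : S} (hs : s ∈ F₀) :
    c * β * H.tau B₀ ≤ ∫⁻ t, ∫⁻ a, H.m s t a * B₀.indicator 1 a ∂H.tau ∂H.lam := by
  have hm : Measurable (Function.uncurry fun t a => (H.m s t a : ℝ≥0∞) * B₀.indicator 1 a) :=
    (H.measurable_m_coe.comp (f := fun z : S × A => (s, z.1, z.2)) (by fun_prop)).mul
      ((measurable_one.indicator hmin.measurableSet_right).comp measurable_snd)
  rw [lintegral_lintegral_swap hm.aemeasurable]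
  calc c * β * H.tau B₀ = ∫⁻ a in B₀, c * β ∂H.tau := by rw [setLIntegral_const]
    _ ≤ ∫⁻ a in B₀, ∫⁻ t, H.m s t a * B₀.indicator 1 a ∂H.lam ∂H.tau := by
        refine setLIntegral_mono' hmin.measurableSet_right fun a ha => ?_
        calc c * β ≤ c * H.lam (W a) := by gcongr; exact hmin.mass_le a ha
          _ = ∫⁻ t in W a, c ∂H.lam := by rw [setLIntegral_const]
          _ ≤ ∫⁻ t in W a, H.m s t a * B₀.indicator 1 a ∂H.lam := by
              refine setLIntegral_mono' (hmin.measurableSet_support a) fun t ht => ?_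
              simpa [ha] using hmin.le a ha t ht s hs
          _ ≤ _ := setLIntegral_le_lintegral _ _
    _ ≤ _ := setLIntegral_le_lintegral _ _

/-- Two observations in `B₀` in succession destroy a fixed proportion of the variance that is
present when the chain is in `F₀`. -/
theorem IsMinorizedOn.vanishes_weightedVariance (hmin : H.IsMinorizedOn F₀ B₀ W c β)
    (hH : H.IsBoundedBy C) (hpos : c * β * H.tau B₀ ≠ 0) :
    H.Vanishes R (weightedVariance (F₀.indicator 1)) := by
  obtain ⟨κ, hκ, hκle⟩ : ∃ κ : ℝ≥0, 0 < κ ∧ (κ : ℝ≥0∞) ≤ c * β * H.tau B₀ := by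
    obtain ⟨κ, h1, h2⟩ := ENNReal.lt_iff_exists_nnreal_btwn.1 (pos_iff_ne_zero.2 hpos)
    exact ⟨κ, ENNReal.coe_pos.1 h1, h2.le⟩
  have hκ0 : (κ : ℝ≥0∞) ≠ 0 := by simpa using hκ.ne'
  have hκi : (κ : ℝ≥0∞)⁻¹ ≠ ∞ := ENNReal.inv_ne_top.2 hκ0
  have hD := vanishes_varianceLoss (R := R) hH
  have hB := hmin.measurableSet_right
  refine Vanishes.mono (Vanishes.smul (c := (κ : ℝ≥0∞)⁻¹)
    ((hD.smul hH (c := 3) (by norm_num)).add ((hD.transfer hH).smul hH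
    (c := 3 * (κ : ℝ≥0∞)⁻¹) (by finiteness)) hH) hH hκi) hH
    (isMeasurableFunctional_weightedVariance
      (measurable_one.indicator hmin.measurableSet_left)) ?_
  intro r μ h
  have := h.isFiniteMeasure
  have h1 : weightedVariance (F₀.indicator 1) r μ ≤ (κ : ℝ≥0∞)⁻¹ *
      weightedVariance (fun s => ∫⁻ t, ∫⁻ a, H.m s t a * B₀.indicator 1 a ∂H.tau ∂H.lam) r μ := by
    unfold weightedVariance
    rw [← lintegral_const_mul' _ _ hκi]
    refine lintegral_mono fun s => ?_
    by_cases hs : s ∈ F₀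
    · rw [Set.indicator_of_mem hs, Pi.one_apply, ← mul_assoc]
      gcongr
      rw [← ENNReal.inv_mul_cancel hκ0 ENNReal.coe_ne_top]
      gcongr
      exact hκle.trans (hmin.le_lintegral hs)
    · simp [hs]
  have h2 := weightedVariance_le h (g := fun _ a => B₀.indicator 1 a)
    ((measurable_one.indicator hB).comp measurable_snd)
    (fun _ a => Set.indicator_le_self' (fun _ _ => zero_le) a)
  have h3 : ∫⁻ a, weightedVariance (fun _ => B₀.indicator 1 a) (H.ratio r μ a) (H.step μ a) ∂H.tau
      ≤ (κ : ℝ≥0∞)⁻¹ * H.transfer H.varianceLoss r μ := by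
    unfold transfer
    rw [← lintegral_const_mul' _ _ hκi]
    refine lintegral_mono fun a => ?_
    by_cases ha : a ∈ B₀
    · have hs := h.step hH a
      have e : weightedVariance (fun _ => B₀.indicator 1 a) (H.ratio r μ a) (H.step μ a) =
          variance (H.ratio r μ a) (H.step μ a) := by
        rw [← weightedVariance_one]
        simp [ha]
      have h4 := hmin.mul_variance_le hs (hmin.step_compl μ ha)
      calc _ = (κ : ℝ≥0∞)⁻¹ * (κ * variance (H.ratio r μ a) (H.step μ a)) := by
            rw [e, ← mul_assoc, ENNReal.inv_mul_cancel hκ0 ENNReal.coe_ne_top, one_mul]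
        _ ≤ (κ : ℝ≥0∞)⁻¹ * (c * β * H.tau B₀ * variance (H.ratio r μ a) (H.step μ a)) := by
            gcongr
        _ ≤ _ := by
            gcongr
            exact h4.trans le_self_add
    · simp [weightedVariance, ha]
  refine h1.trans ?_
  change _ ≤ (κ : ℝ≥0∞)⁻¹ * (3 * H.varianceLoss r μ +
    3 * (κ : ℝ≥0∞)⁻¹ * H.transfer H.varianceLoss r μ)
  refine mul_le_mul_right (h2.trans ?_) _
  rw [mul_assoc]
  gcongr

/-- The vanishing of a weighted variance is inherited by the weight one step earlier. -/
theorem Vanishes.weightedVariance_kernel {g : S → ℝ≥0∞} (hg : Measurable g) (hg1 : ∀ s, g s ≤ 1)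
    (h : H.Vanishes R (weightedVariance g)) (hH : H.IsBoundedBy C) :
    H.Vanishes R (weightedVariance fun s => ∫⁻ t, g t ∂H.markovKernel s) := by
  refine Vanishes.mono (((vanishes_varianceLoss hH).smul hH (c := 3) (by norm_num)).add
    ((h.transfer hH).smul hH (c := 3) (by norm_num)) hH) hH
    (isMeasurableFunctional_weightedVariance hg.lintegral_kernel) fun r μ hs => ?_
  have h1 := weightedVariance_le hs (g := fun t _ => g t) (hg.comp measurable_fst)
    fun t _ => hg1 t
  simp_rw [lintegral_lintegral_m_mul _ g hg] at h1
  exact h1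

theorem Vanishes.weightedVariance_pow {F : Set S} (hF : MeasurableSet F)
    (h : H.Vanishes R (weightedVariance (F.indicator 1))) (hH : H.IsBoundedBy C) (N : ℕ) :
    H.Vanishes R (weightedVariance fun s => (H.markovKernel ^ N) s F) := by
  induction N with
  | zero =>
    have e : (fun s => (H.markovKernel ^ 0) s F) = F.indicator 1 := by
      funext s
      change Kernel.id s F = _
      rw [Kernel.id_apply, Measure.dirac_apply' _ hF]
    rw [e]
    exact h
  | succ N ih =>
    have := ih.weightedVariance_kernel (Kernel.measurable_coe _ hF) (fun s => prob_le_one) hH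
    simp_rw [add_comm N 1, Kernel.pow_add_apply_eq_lintegral _ 1 N _ hF, pow_one]
    exact this

/-- The variance vanishes asymptotically: this is the stability of the filter in mean square. -/
theorem IsMinorizedOn.vanishes_variance (hmin : H.IsMinorizedOn F₀ B₀ W c β)
    (hH : H.IsBoundedBy C) (hpos : c * β * H.tau B₀ ≠ 0) {π : Measure S}
    (hπ : StronglyErgodicWith H.markovKernel π) (hπF : π F₀ ≠ 0) : H.Vanishes R variance := by
  have := hπ.1
  refine ⟨isMeasurableFunctional_variance, fun r μ h => ?_⟩
  have := h.isFiniteMeasure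
  have hanti : Antitone fun n => H.transfer^[n] variance r μ := by
    refine antitone_nat_of_succ_le fun n => ?_
    rw [Function.iterate_succ_apply]
    exact LeOn.iterate (fun r μ hs => le_self_add.trans (variance_eq hH hs).ge) hH n r μ h
  -- the variance decreases to some `ℓ`; weights that are close to `π F₀` bound `π F₀ * ℓ`
  have hlim := tendsto_atTop_iInf hanti
  generalize ⨅ n, H.transfer^[n] variance r μ = ℓ at hlim
  -- the deficit of the weight `P^N(s, F₀)` against `π F₀`
  let e : ℕ → S → ℝ≥0∞ := fun N s => π F₀ - (H.markovKernel ^ N) s F₀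
  have he : ∀ N, Measurable (e N) := fun N =>
    measurable_const.sub (Kernel.measurable_coe _ hmin.measurableSet_left)
  have he1 : ∀ N s, e N s ≤ 1 := fun N s => tsub_le_self.trans prob_le_one
  have hle : ∀ N, π F₀ * ℓ ≤ (R : ℝ≥0∞) ^ 2 * (μ Set.univ * ∫⁻ s, e N s ∂π) := by
    intro N
    have hv := (Vanishes.weightedVariance_pow hmin.measurableSet_left
      (hmin.vanishes_weightedVariance hH hpos) hH N).tendsto r μ h
    have hlin := ENNReal.Tendsto.const_mul (a := (R : ℝ≥0∞) ^ 2)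
      (hπ.tendsto_lintegral_lintegral μ (he N) (he1 N)) (Or.inr (by finiteness))
    have hsum := hv.add hlin
    rw [zero_add] at hsum
    refine le_of_tendsto_of_tendsto'
      (ENNReal.Tendsto.const_mul hlim (Or.inr (measure_ne_top π F₀))) hsum fun n => ?_
    have hpt : H.LeOn R (π F₀ • variance) (weightedVariance (fun s => (H.markovKernel ^ N) s F₀) +
        (R : ℝ≥0∞) ^ 2 • integralFunctional (e N)) := by
      intro r μ h
      have hsq : Measurable fun s => sqDist (r s) (mean r μ) :=
        h.measurable.sqDist measurable_const
      change π F₀ * ∫⁻ s, sqDist (r s) (mean r μ) ∂μ ≤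
        ∫⁻ s, (H.markovKernel ^ N) s F₀ * sqDist (r s) (mean r μ) ∂μ +
          (R : ℝ≥0∞) ^ 2 * ∫⁻ s, e N s ∂μ
      rw [← lintegral_const_mul _ hsq, ← lintegral_const_mul _ (he N),
        ← lintegral_add_right _ ((he N).const_mul _)]
      refine lintegral_mono fun s => ?_
      calc π F₀ * sqDist (r s) (mean r μ)
          ≤ ((H.markovKernel ^ N) s F₀ + e N s) * sqDist (r s) (mean r μ) := by
            gcongr; exact le_add_tsub
        _ = (H.markovKernel ^ N) s F₀ * sqDist (r s) (mean r μ) +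
            sqDist (r s) (mean r μ) * e N s := by ring
        _ ≤ _ := by
            gcongr; exact sqDist_le (h.le s) (mean_le h.le μ)
    have := hpt.iterate hH n r μ h
    rw [iterate_smul isMeasurableFunctional_variance hH _ n h,
      iterate_add (isMeasurableFunctional_weightedVariance
        (Kernel.measurable_coe _ hmin.measurableSet_left)) hH n h,
      iterate_smul (isMeasurableFunctional_integral (he N)) hH _ n h,
      iterate_integralFunctional hH (he N) n h] at this
    exact this
  -- by strong ergodicity the bound tends to zero with the number `N` of steps
  have hzero : Tendsto (fun N => ∫⁻ s, e N s ∂π) atTop (𝓝 0) := by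
    rw [show (0 : ℝ≥0∞) = ∫⁻ _, 0 ∂π by simp]
    refine tendsto_lintegral_of_dominated_convergence (fun _ => 1) he
      (fun N => Eventually.of_forall (he1 N)) (by simp) (Eventually.of_forall fun s => ?_)
    have h1 := tendsto_lintegral_of_tendsto_tvDist (hπ.2 s)
      (φ := F₀.indicator 1) (measurable_one.indicator hmin.measurableSet_left)
      (fun x => Set.indicator_le_self' (fun _ _ => zero_le) x)
    simp_rw [lintegral_indicator_one hmin.measurableSet_left] at h1
    simpa using ENNReal.Tendsto.sub tendsto_const_nhds h1 (Or.inl (measure_ne_top π F₀))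
  have h0 : π F₀ * ℓ ≤ 0 := by
    have hlim0 := ENNReal.Tendsto.const_mul (a := (R : ℝ≥0∞) ^ 2)
      (ENNReal.Tendsto.const_mul (a := μ Set.univ) hzero (Or.inr (measure_ne_top _ _)))
      (Or.inr (by finiteness))
    rw [mul_zero, mul_zero] at hlim0
    exact ge_of_tendsto' hlim0 hle
  have hℓ : ℓ = 0 := by
    rcases mul_eq_zero.1 (nonpos_iff_eq_zero.1 h0) with h | h
    · exact absurd h hπF
    · exact h
  rwa [hℓ] at hlim

/-- The bound `|x| ≤ ε + ε⁻¹ x²` reduces the mean deviation to the variance. -/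
theorem Vanishes.meanDeviation (h : H.Vanishes R variance) (hH : H.IsBoundedBy C) :
    H.Vanishes R meanDeviation := by
  refine ⟨isMeasurableFunctional_meanDeviation, fun r μ hs => ?_⟩
  have := hs.isFiniteMeasure
  have key : ∀ ε : ℝ≥0, 0 < ε → ∀ n, H.transfer^[n] HiddenMarkov.DensityHMM.meanDeviation r μ ≤
      ε * μ Set.univ + (ε : ℝ≥0∞)⁻¹ * H.transfer^[n] variance r μ := by
    intro ε hε n
    have hε0 : (ε : ℝ≥0∞) ≠ 0 := by simpa using hε.ne'
    have hpt : H.LeOn R HiddenMarkov.DensityHMM.meanDeviation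
        ((ε : ℝ≥0∞) • integralFunctional (fun _ => 1) + (ε : ℝ≥0∞)⁻¹ • variance) := by
      intro r μ h
      have hsq : Measurable fun s => sqDist (r s) (mean r μ) :=
        h.measurable.sqDist measurable_const
      change ∫⁻ s, ENNReal.ofReal |(r s : ℝ) - mean r μ| ∂μ ≤
        ε * ∫⁻ _, 1 ∂μ + (ε : ℝ≥0∞)⁻¹ * ∫⁻ s, sqDist (r s) (mean r μ) ∂μ
      rw [← lintegral_const_mul _ hsq, ← lintegral_const_mul _ measurable_const,
        ← lintegral_add_left measurable_const]
      refine lintegral_mono fun s => ?_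
      have hε' : (0 : ℝ) < ε := hε
      rw [mul_one, sqDist, ← ENNReal.ofReal_coe_nnreal, ← ENNReal.ofReal_inv_of_pos hε',
        ← ENNReal.ofReal_mul (by positivity), ← ENNReal.ofReal_add (by positivity) (by positivity)]
      refine ENNReal.ofReal_le_ofReal ?_
      generalize (r s : ℝ) - mean r μ = x
      rw [← sq_abs, ← sub_nonneg]
      have e : (ε : ℝ) + (ε : ℝ)⁻¹ * |x| ^ 2 - |x| =
          (ε : ℝ)⁻¹ * ((ε - |x|) ^ 2 + ε * |x|) := by
        field_simp
        ring
      rw [e]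
      positivity
    have h1 := hpt.iterate hH n r μ hs
    rw [iterate_add ((isMeasurableFunctional_integral measurable_const).smul _) hH n hs,
      iterate_smul (isMeasurableFunctional_integral measurable_const) hH _ n hs,
      iterate_smul isMeasurableFunctional_variance hH _ n hs,
      iterate_integralFunctional hH measurable_const n hs] at h1
    simpa only [lintegral_one, measure_univ] using h1
  refine ENNReal.tendsto_nhds_zero.2 fun δ hδ => ?_
  obtain ⟨ε, hε, hεle⟩ : ∃ ε : ℝ≥0, 0 < ε ∧ ε * μ Set.univ < δ / 2 :=
    ENNReal.exists_nnreal_pos_mul_lt (measure_ne_top _ _) (ENNReal.half_pos hδ.ne').ne'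
  have hε0 : (ε : ℝ≥0∞)⁻¹ ≠ ∞ := by simpa using hε.ne'
  have hlim := ENNReal.Tendsto.const_mul (a := (ε : ℝ≥0∞)⁻¹) (h.tendsto r μ hs) (Or.inr hε0)
  rw [mul_zero] at hlim
  filter_upwards [ENNReal.tendsto_nhds_zero.1 hlim (δ / 2) (ENNReal.half_pos hδ.ne')] with n hn
  calc _ ≤ _ := key ε hε n
    _ ≤ δ / 2 + δ / 2 := add_le_add hεle.le hn
    _ = δ := ENNReal.add_halves δ

/-- The updates of `r` form a martingale. -/
theorem transfer_firstMoment (hH : H.IsBoundedBy C) {r : S → ℝ≥0} {μ : Measure S}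
    (h : H.IsState R r μ) : H.transfer firstMoment r μ = firstMoment r μ := by
  have := h.isFiniteMeasure
  have hr : Measurable fun s => (r s : ℝ≥0∞) := h.measurable.coe_nnreal_ennreal
  have e : ∀ a, firstMoment (H.ratio r μ a) (H.step μ a) =
      ∫⁻ t, ∫⁻ s, H.m s t a * r s ∂μ ∂H.lam := by
    intro a
    have hs := h.step hH a
    rw [firstMoment, H.lintegral_step μ a hs.measurable.coe_nnreal_ennreal]
    refine lintegral_congr fun t => ?_
    rw [H.stepDens_mul_ratio hH h.measurable h.le]
    simp_rw [mul_comm]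
  unfold transfer
  simp_rw [e]
  rw [H.lintegral_triple_swap μ (φ := fun s _ _ => (r s : ℝ≥0∞)) (hr.comp measurable_fst)]
  refine lintegral_congr fun s => ?_
  rw [lintegral_lintegral_m_mul s (fun _ => (r s : ℝ≥0∞)) measurable_const]
  simp

theorem iterate_firstMoment (hH : H.IsBoundedBy C) (n : ℕ) {r : S → ℝ≥0} {μ : Measure S}
    (h : H.IsState R r μ) : H.transfer^[n] firstMoment r μ = firstMoment r μ := by
  induction n with
  | zero => rfl
  | succ n ih =>
    rw [Function.iterate_succ_apply,
      LeOn.iterate_congr (fun r μ hs => transfer_firstMoment hH hs) hH n h, ih]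

theorem leOn_meanDeviation : H.LeOn R meanDeviation ((2 : ℝ≥0∞) • firstMoment) := by
  intro r μ h
  have := h.isFiniteMeasure
  calc ∫⁻ s, ENNReal.ofReal |(r s : ℝ) - mean r μ| ∂μ ≤ ∫⁻ s, (r s + mean r μ : ℝ≥0∞) ∂μ := by
        refine lintegral_mono fun s => ?_
        rw [← ENNReal.coe_add, ← ENNReal.ofReal_coe_nnreal]
        refine ENNReal.ofReal_le_ofReal ?_
        rw [NNReal.coe_add]
        have h1 := (r s).coe_nonneg
        have h2 := (mean r μ).coe_nonneg
        exact abs_le.2 ⟨by linarith, by linarith⟩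
    _ = ∫⁻ s, r s ∂μ + mean r μ * μ Set.univ := by
        rw [lintegral_add_right _ measurable_const, lintegral_const]
    _ = 2 * ∫⁻ s, r s ∂μ := by rw [mean_mul_mass h.le, two_mul]

end DensityHMM

/-! ### The filter with and without additional information -/

namespace DensityHMM

universe v

variable {S : Type*} {A : Type v} [MeasurableSpace S] [MeasurableSpace A] {H : DensityHMM S A}
  {R C : ℝ≥0}

open DensityProbability

/-- The positively homogeneous extension of a function on `K` to the finite measures with a
density. -/
def homExt (u : DensityProbability H.lam → ℝ≥0∞) (ν : Measure S) : ℝ≥0∞ :=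
  ν Set.univ * evalNormalized u ν

/-- The homogeneous extension of `u`, evaluated at the measure with density `r` with respect to
`μ`: the filter is started at the law of the state given the information that `r` encodes. -/
def informedFilter (u : DensityProbability H.lam → ℝ≥0∞) : Functional S :=
  fun r μ => homExt u (μ.withDensity fun s => (r s : ℝ≥0∞))

/-- The value of `u` at the normalization of `μ`, weighted by the mass of the measure with density
`r` with respect to `μ`: the filter ignores the information that `r` encodes. -/
def uninformedFilter (u : DensityProbability H.lam → ℝ≥0∞) : Functional S :=
  fun r μ => firstMoment r μ * evalNormalized u μ

theorem homExt_smul (u : DensityProbability H.lam → ℝ≥0∞) (x : DensityProbability H.lam)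
    {c : ℝ≥0∞} (hc : c ≠ ∞) : homExt u (c • x.1.toMeasure) = c * u x := by
  rcases eq_or_ne c 0 with rfl | h0
  · simp [homExt]
  · rw [homExt, evalNormalized_smul u x h0 hc, Measure.smul_apply, x.2, smul_eq_mul, mul_one]

theorem homExt_toMeasure (u : DensityProbability H.lam → ℝ≥0∞) (x : DensityProbability H.lam) :
    homExt u x.1.toMeasure = u x := by
  simpa using homExt_smul u x ENNReal.one_ne_top

theorem withDensity_eq_smul_normalized {f : S → ℝ≥0∞} (hf : Measurable f)
    (h0 : ∫⁻ t, f t ∂H.lam ≠ 0) (h1 : ∫⁻ t, f t ∂H.lam ≠ ∞) :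
    H.lam.withDensity f = (∫⁻ t, f t ∂H.lam) • (normalized f hf h0 h1).1.toMeasure := by
  rw [normalized_toMeasure, smul_smul, withDensity_apply _ MeasurableSet.univ,
    Measure.restrict_univ, ENNReal.mul_inv_cancel h0 h1, one_smul]

theorem step_smul (c : ℝ≥0∞) (ν : Measure S) [SFinite ν] (a : A) :
    H.step (c • ν) a = c • H.step ν a := by
  have e : H.stepDens (c • ν) a = c • H.stepDens ν a := by
    funext t
    simp [stepDens, lintegral_smul_measure]
  rw [step, e, withDensity_smul _ (H.measurable_stepDens_right ν a)]
  rfl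

/-- Updating the information and then inserting it is the same as inserting it and then updating. -/
theorem step_withDensity_ratio (hH : H.IsBoundedBy C) {r : S → ℝ≥0} {μ : Measure S}
    (h : H.IsState R r μ) (a : A) :
    (H.step μ a).withDensity (fun t => (H.ratio r μ a t : ℝ≥0∞)) =
      H.step (μ.withDensity fun s => (r s : ℝ≥0∞)) a := by
  have := h.isFiniteMeasure
  have hs := h.step hH a
  rw [step, ← withDensity_mul _ (H.measurable_stepDens_right μ a)
    hs.measurable.coe_nnreal_ennreal, step]
  congr 1
  funext t
  rw [Pi.mul_apply, H.stepDens_mul_ratio hH h.measurable h.le, stepDens,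
    lintegral_withDensity_eq_lintegral_mul _ h.measurable.coe_nnreal_ennreal
      (H.measurable_m_fst t a)]
  rfl

theorem withDensity_withDensity_coe {r : S → ℝ≥0} {f : S → ℝ≥0∞} (hr : Measurable r)
    (hf : Measurable f) :
    (H.lam.withDensity f).withDensity (fun s => (r s : ℝ≥0∞)) =
      H.lam.withDensity fun s => f s * r s :=
  (withDensity_mul _ hf hr.coe_nnreal_ennreal).symm

theorem lintegral_mul_ne_top {r : S → ℝ≥0} (hr : ∀ s, r s ≤ R) {f : S → ℝ≥0∞}
    (hf : ∫⁻ s, f s ∂H.lam ≠ ∞) : ∫⁻ s, f s * r s ∂H.lam ≠ ∞ := by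
  refine ne_top_of_le_ne_top (ENNReal.mul_ne_top hf (ENNReal.coe_ne_top (r := R))) ?_
  rw [← lintegral_mul_const' _ _ ENNReal.coe_ne_top]
  exact lintegral_mono fun s => by gcongr; exact hr s

/-- The filter kernel is, up to homogeneous extension, the integral of the linear maps `x ↦ x M_a`;
the normalizations disappear. -/
theorem obsDensity_mul_filterUpdate [TopologicalSpace A] (hreg : H.IsRegular)
    (x : DensityProbability H.lam) (u : DensityProbability H.lam → ℝ≥0∞) (a : A) :
    H.obsDensity x a * u (H.filterUpdate x a) = homExt u (H.step x.1.toMeasure a) := by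
  rcases eq_or_ne (H.obsDensity x a) 0 with h0 | h0
  · have h1 : H.step x.1.toMeasure a Set.univ = 0 := h0
    rw [h0, homExt, h1, zero_mul, zero_mul]
  · have e : evalNormalized u (H.step x.1.toMeasure a) = u (H.filterUpdate x a) :=
      evalNormalized_eq u (filterUpdate_toMeasure H x a h0 (hreg.obsDensity_ne_top x a))
    rw [homExt, e]
    rfl

section FilterKernel

variable [MetricSpace A] [SecondCountableTopology A] [BorelSpace A]

theorem lintegral_filterKernel (hreg : H.IsRegular) (x : DensityProbability H.lam)
    {u : DensityProbability H.lam → ℝ≥0∞} (hu : Measurable u) :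
    ∫⁻ y, u y ∂(H.filterKernel hreg x) =
      ∫⁻ a, H.obsDensity x a * u (H.filterUpdate x a) ∂H.tau := by
  have hh : Measurable (H.filterUpdate x) :=
    hreg.measurable_filterUpdate.comp (g := fun z : DensityProbability H.lam × A =>
      H.filterUpdate z.1 z.2) (f := fun a => (x, a)) measurable_prodMk_left
  have hg : Measurable (H.obsDensity x) :=
    hreg.measurable_obsDensity.comp (g := fun z : DensityProbability H.lam × A =>
      H.obsDensity z.1 z.2) (f := fun a => (x, a)) measurable_prodMk_left
  change ∫⁻ y, u y ∂((H.tau.withDensity (H.obsDensity x)).map (H.filterUpdate x)) = _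
  have huh : Measurable fun a => u (H.filterUpdate x a) := hu.comp hh
  rw [lintegral_map hu hh, lintegral_withDensity_eq_lintegral_mul _ hg huh]
  rfl

theorem lintegral_homExt_step (hreg : H.IsRegular) {u : DensityProbability H.lam → ℝ≥0∞}
    (hu : Measurable u) {f : S → ℝ≥0∞} (hf : Measurable f) (hfin : ∫⁻ t, f t ∂H.lam ≠ ∞) :
    ∫⁻ a, homExt u (H.step (H.lam.withDensity f) a) ∂H.tau =
      homExt (fun x => ∫⁻ y, u y ∂(H.filterKernel hreg x)) (H.lam.withDensity f) := by
  rcases eq_or_ne (∫⁻ t, f t ∂H.lam) 0 with h0 | h0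
  · have e : H.lam.withDensity f = 0 := by
      rw [← Measure.measure_univ_eq_zero, withDensity_apply _ MeasurableSet.univ,
        Measure.restrict_univ, h0]
    have e2 : ∀ a, H.step 0 a = 0 := by
      intro a
      have h := step_smul (H := H) 0 (0 : Measure S) a
      rwa [zero_smul, zero_smul] at h
    simp [e, e2, homExt]
  · rw [withDensity_eq_smul_normalized hf h0 hfin, homExt_smul _ _ hfin,
      lintegral_filterKernel hreg _ hu,
      ← lintegral_const_mul' _ _ hfin]
    refine lintegral_congr fun a => ?_
    rw [step_smul, obsDensity_mul_filterUpdate hreg, homExt, homExt, Measure.smul_apply,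
      smul_eq_mul, mul_assoc]
    congr 2
    unfold evalNormalized
    rw [Measure.smul_apply, smul_smul, smul_eq_mul,
      ENNReal.mul_inv (Or.inl h0) (Or.inl hfin), mul_assoc, mul_comm _ (∫⁻ t, f t ∂H.lam),
      ← mul_assoc, ENNReal.inv_mul_cancel h0 hfin, one_mul]

theorem transfer_informedFilter (hH : H.IsBoundedBy C) (hreg : H.IsRegular)
    {u : DensityProbability H.lam → ℝ≥0∞} (hu : Measurable u) {r : S → ℝ≥0} {μ : Measure S}
    (h : H.IsState R r μ) : H.transfer (informedFilter u) r μ =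
      informedFilter (fun x => ∫⁻ y, u y ∂(H.filterKernel hreg x)) r μ := by
  unfold transfer informedFilter
  simp_rw [step_withDensity_ratio hH h]
  obtain ⟨f, hf, hfin, rfl⟩ := h.exists_density
  rw [withDensity_withDensity_coe h.measurable hf]
  exact lintegral_homExt_step hreg hu (hf.mul h.measurable.coe_nnreal_ennreal)
    (lintegral_mul_ne_top h.le hfin)

/-- The iterated transfer operator computes the iterates of the filter kernel. -/
theorem iterate_informedFilter (hH : H.IsBoundedBy C) (hreg : H.IsRegular) (n : ℕ)
    {u : DensityProbability H.lam → ℝ≥0∞} (hu : Measurable u) {r : S → ℝ≥0} {μ : Measure S}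
    (h : H.IsState R r μ) : H.transfer^[n] (informedFilter u) r μ =
      informedFilter (fun x => ∫⁻ y, u y ∂((H.filterKernel hreg ^ n) x)) r μ := by
  induction n generalizing u with
  | zero =>
    have e : (fun x => ∫⁻ y, u y ∂((H.filterKernel hreg ^ 0) x)) = u := by
      funext x
      change ∫⁻ y, u y ∂(Kernel.id x) = _
      rw [Kernel.id_apply, lintegral_dirac' _ hu]
    rw [e]
    rfl
  | succ n ih =>
    rw [Function.iterate_succ_apply, LeOn.iterate_congr
      (fun r μ hs => transfer_informedFilter hH hreg hu hs) hH n h, ih hu.lintegral_kernel]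
    congr 1
    funext x
    rw [add_comm n 1, Kernel.pow_add, Kernel.lintegral_comp _ _ _ hu, pow_one]

end FilterKernel

theorem isMeasurableFunctional_uninformedFilter [MeasurableSpace.CountablyGenerated S]
    {u : DensityProbability H.lam → ℝ≥0∞} (hu : Measurable u) :
    H.IsMeasurableFunctional (uninformedFilter u) := fun Ω _ r f hr hf hfin =>
  (isMeasurableFunctional_firstMoment Ω r f hr hf hfin).mul
    (measurable_evalNormalized hu hf hfin)

/-- The filters that use and ignore the information are, after weighting, at a distance equal to the
mean deviation of `r`. -/
theorem edist_normalized_mul {r : S → ℝ≥0} {f : S → ℝ≥0∞} (hf : Measurable f)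
    (hfin : ∫⁻ s, f s ∂H.lam ≠ ∞) (h : H.IsState R r (H.lam.withDensity f))
    (h0 : ∫⁻ s, f s ∂H.lam ≠ 0) (hr0 : ∫⁻ s, f s * r s ∂H.lam ≠ 0) :
    firstMoment r (H.lam.withDensity f) *
      edist (normalized (fun s => f s * r s) (hf.mul h.measurable.coe_nnreal_ennreal) hr0
        (lintegral_mul_ne_top h.le hfin)) (normalized f hf h0 hfin) =
      meanDeviation r (H.lam.withDensity f) := by
  have hfm := h.isFiniteMeasure
  have hM : H.lam.withDensity f Set.univ = ∫⁻ s, f s ∂H.lam := by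
    rw [withDensity_apply _ MeasurableSet.univ, Measure.restrict_univ]
  have hfirst : firstMoment r (H.lam.withDensity f) = ∫⁻ s, f s * r s ∂H.lam := by
    rw [firstMoment, lintegral_withDensity_eq_lintegral_mul _ hf h.measurable.coe_nnreal_ennreal]
    rfl
  have hmean := mean_mul_mass h.le (H.lam.withDensity f)
  rw [show ∫⁻ s, r s ∂(H.lam.withDensity f) = ∫⁻ s, f s * r s ∂H.lam from hfirst, hM] at hmean
  have hdev : Measurable fun s =>
      ENNReal.ofReal |(r s : ℝ) - mean r (H.lam.withDensity f)| :=
    (h.measurable.coe_nnreal_real.sub measurable_const).abs.ennreal_ofReal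
  rw [meanDeviation, lintegral_withDensity_eq_lintegral_mul _ hf hdev, hfirst, normalized,
    normalized, edist_ofDensity, densDist, ← lintegral_const_mul' _ _
      (lintegral_mul_ne_top h.le hfin)]
  refine lintegral_congr_ae ?_
  filter_upwards [ae_lt_top hf hfin] with s hs
  have hfr := lintegral_mul_ne_top h.le hfin
  rw [Pi.mul_apply]
  generalize mean r (H.lam.withDensity f) = m at *
  generalize ∫⁻ s, f s * r s ∂H.lam = I at *
  generalize ∫⁻ s, f s ∂H.lam = M at *
  have e1 : I * (I⁻¹ * (f s * r s)) = f s * r s := by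
    rw [← mul_assoc, ENNReal.mul_inv_cancel hr0 hfr, one_mul]
  have e2 : I * (M⁻¹ * f s) = f s * m := by
    rw [← hmean, mul_assoc, ← mul_assoc M, ENNReal.mul_inv_cancel h0 hfin, one_mul, mul_comm]
  rw [mul_add, ENNReal.mul_sub fun _ _ => hfr, ENNReal.mul_sub fun _ _ => hfr, e1, e2,
    ← ENNReal.mul_sub fun _ _ => hs.ne, ← ENNReal.mul_sub fun _ _ => hs.ne, ← mul_add,
    ← FiniteDensityMeasure.enorm_coe_sub_coe, ← ofReal_norm, Real.norm_eq_abs]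

theorem informedFilter_eq {r : S → ℝ≥0} {f : S → ℝ≥0∞} (hf : Measurable f)
    (hfin : ∫⁻ s, f s ∂H.lam ≠ ∞) (h : H.IsState R r (H.lam.withDensity f))
    (hr0 : ∫⁻ s, f s * r s ∂H.lam ≠ 0) (u : DensityProbability H.lam → ℝ≥0∞) :
    informedFilter u r (H.lam.withDensity f) = firstMoment r (H.lam.withDensity f) *
      u (normalized (fun s => f s * r s) (hf.mul h.measurable.coe_nnreal_ennreal) hr0
        (lintegral_mul_ne_top h.le hfin)) := by
  rw [informedFilter, homExt, withDensity_withDensity_coe h.measurable hf, firstMoment,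
    lintegral_withDensity_eq_lintegral_mul _ hf h.measurable.coe_nnreal_ennreal,
    withDensity_apply _ MeasurableSet.univ, Measure.restrict_univ]
  congr 1
  exact evalNormalized_withDensity u (hf.mul h.measurable.coe_nnreal_ennreal) hr0
    (lintegral_mul_ne_top h.le hfin)

/-- For `1`-Lipschitz functions, ignoring the information costs at most the mean deviation. -/
theorem leOn_informedFilter_uninformedFilter {u : DensityProbability H.lam → ℝ≥0∞}
    (hu : ∀ x y, u x ≤ u y + edist x y) :
    H.LeOn R (informedFilter u) (uninformedFilter u + meanDeviation) ∧
      H.LeOn R (uninformedFilter u) (informedFilter u + meanDeviation) := by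
  have key : ∀ r μ, H.IsState R r μ → informedFilter u r μ ≤
      uninformedFilter u r μ + meanDeviation r μ ∧
      uninformedFilter u r μ ≤ informedFilter u r μ + meanDeviation r μ := by
    intro r μ h
    obtain ⟨f, hf, hfin, rfl⟩ := h.exists_density
    have hfirst : firstMoment r (H.lam.withDensity f) = ∫⁻ s, f s * r s ∂H.lam := by
      rw [firstMoment, lintegral_withDensity_eq_lintegral_mul _ hf
        h.measurable.coe_nnreal_ennreal]
      rfl
    rcases eq_or_ne (∫⁻ s, f s * r s ∂H.lam) 0 with hr0 | hr0
    · have e1 : informedFilter u r (H.lam.withDensity f) = 0 := by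
        rw [informedFilter, homExt, withDensity_withDensity_coe h.measurable hf,
          withDensity_apply _ MeasurableSet.univ, Measure.restrict_univ, hr0, zero_mul]
      have e2 : uninformedFilter u r (H.lam.withDensity f) = 0 := by
        rw [uninformedFilter, hfirst, hr0, zero_mul]
      rw [e1, e2]
      exact ⟨zero_le, zero_le⟩
    · have h0 : ∫⁻ s, f s ∂H.lam ≠ 0 := by
        intro h0
        have := lintegral_le_mul_mass h.le (H.lam.withDensity f)
        rw [withDensity_apply _ MeasurableSet.univ, Measure.restrict_univ, h0, mul_zero] at this
        exact hr0 (hfirst.symm.trans (nonpos_iff_eq_zero.1 this))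
      rw [informedFilter_eq hf hfin h hr0, uninformedFilter,
        evalNormalized_withDensity u hf h0 hfin,
        ← edist_normalized_mul hf hfin h h0 hr0, ← mul_add, ← mul_add]
      refine ⟨mul_le_mul_right (hu _ _) _, mul_le_mul_right ?_ _⟩
      rw [edist_comm]
      exact hu _ _
  exact ⟨fun r μ h => (key r μ h).1, fun r μ h => (key r μ h).2⟩

theorem coe_ratio {r : S → ℝ≥0} (hrm : Measurable r)
    (hr : ∀ s, r s ≤ R) (μ : Measure S) (a : A) (t : S) :
    (H.ratio r μ a t : ℝ≥0∞) = (∫⁻ s, r s * H.m s t a ∂μ) / H.stepDens μ a t := by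
  rw [H.ratio_eq hrm, ENNReal.coe_toNNReal]
  refine ne_top_of_le_ne_top (ENNReal.coe_ne_top (r := R)) (ENNReal.div_le_of_le_mul ?_)
  rw [stepDens, ← lintegral_const_mul' _ _ ENNReal.coe_ne_top]
  exact lintegral_mono fun s => by gcongr; exact hr s

variable (H) in
/-- A functional that commutes with integration over the observation space in its first
argument. -/
def IsAveraging (R : ℝ≥0) (Φ : Functional S) : Prop :=
  ∀ (r : A → S → ℝ≥0) (r' : S → ℝ≥0) (μ : Measure S), Measurable (Function.uncurry r) →
    (∀ a, H.IsState R (r a) μ) → H.IsState R r' μ → (∀ s, ∫⁻ a, r a s ∂H.tau = r' s) →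
    ∫⁻ a, Φ (r a) μ ∂H.tau = Φ r' μ

/-- The filter that ignores the information is linear in `r`; this is what makes it possible to sum
over the values of an observation that is to be forgotten. -/
theorem isAveraging_uninformedFilter (u : DensityProbability H.lam → ℝ≥0∞) :
    H.IsAveraging R (uninformedFilter u) := by
  intro r r' μ hr hs hs' heq
  have := hs'.isFiniteMeasure
  have hm : Measurable fun a => firstMoment (r a) μ :=
    hr.coe_nnreal_ennreal.lintegral_prod_right'
  unfold uninformedFilter
  rw [lintegral_mul_const _ hm]
  congr 1
  unfold firstMoment
  rw [lintegral_lintegral_swap hr.coe_nnreal_ennreal.aemeasurable]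
  exact lintegral_congr heq

theorem IsAveraging.transfer {Φ : Functional S} (hΦ : H.IsAveraging R Φ)
    (hm : H.IsMeasurableFunctional Φ) (hH : H.IsBoundedBy C) :
    H.IsAveraging R (H.transfer Φ) := by
  intro r r' μ hr hs hs' heq
  have hfin := hs'.isFiniteMeasure
  have hmeas : Measurable fun z : A × A => Φ (H.ratio (r z.1) μ z.2) (H.step μ z.2) := by
    obtain ⟨f, hf, hf', rfl⟩ := hs'.exists_density
    exact hm.comp_step hH (f := fun _ => f) hr (hf.comp measurable_snd) fun _ => hf'
  unfold DensityHMM.transfer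
  rw [lintegral_lintegral_swap hmeas.aemeasurable]
  refine lintegral_congr fun a => ?_
  refine hΦ (fun b => H.ratio (r b) μ a) (H.ratio r' μ a) (H.step μ a) ?_
    (fun b => (hs b).step hH a) (hs'.step hH a) fun t => ?_
  · obtain ⟨f, hf, hf', rfl⟩ := hs'.exists_density
    exact (H.measurable_ratio_uncurry (f := fun _ => f) hr (hf.comp measurable_snd)).comp
      (f := fun z : A × S => ((z.1, a), z.2)) (by fun_prop)
  · have hrm : Measurable (Function.uncurry fun b s => (r b s : ℝ≥0∞) * H.m s t a) :=
      hr.coe_nnreal_ennreal.mul ((H.measurable_m_fst t a).comp measurable_snd)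
    simp_rw [fun b => coe_ratio (H := H) (hs b).measurable (hs b).le μ a t,
      coe_ratio hs'.measurable hs'.le μ a t, div_eq_mul_inv]
    have hrm' : Measurable fun b => ∫⁻ s, (r b s : ℝ≥0∞) * H.m s t a ∂μ :=
      hrm.lintegral_prod_right'
    rw [lintegral_mul_const _ hrm', lintegral_lintegral_swap hrm.aemeasurable]
    congr 1
    refine lintegral_congr fun s => ?_
    have hrs : Measurable fun b => (r b s : ℝ≥0∞) :=
      hr.coe_nnreal_ennreal.comp (f := fun b => (b, s)) (by fun_prop)
    rw [lintegral_mul_const _ hrs, ← heq s]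

theorem IsAveraging.iterate {Φ : Functional S} (hΦ : H.IsAveraging R Φ)
    (hm : H.IsMeasurableFunctional Φ) (hH : H.IsBoundedBy C) (n : ℕ) :
    H.IsAveraging R (H.transfer^[n] Φ) := by
  induction n generalizing Φ with
  | zero => exact hΦ
  | succ n ih =>
    rw [Function.iterate_succ_apply]
    exact ih (hΦ.transfer hm hH) (hm.transfer hH)

end DensityHMM

/-! ### Forgetting the first observations -/

theorem ofReal_tvDist_le {X : Type*} [MeasurableSpace X] (μ ν : Measure X) [IsFiniteMeasure μ]
    [IsFiniteMeasure ν] {d : ℝ≥0∞} (h1 : ∀ F, MeasurableSet F → μ F ≤ ν F + d)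
    (h2 : ∀ F, MeasurableSet F → ν F ≤ μ F + d) : ENNReal.ofReal (tvDist μ ν) ≤ 2 * d := by
  rcases eq_or_ne d ∞ with rfl | hd
  · simp
  have key : ∀ (μ ν : Measure X) [IsFiniteMeasure μ] [IsFiniteMeasure ν],
      (∀ F, MeasurableSet F → μ F ≤ ν F + d) → ∀ F, MeasurableSet F →
      μ.real F - ν.real F ≤ d.toReal := by
    intro μ ν _ _ h F hF
    rw [sub_le_iff_le_add, add_comm, measureReal_def, measureReal_def,
      ← ENNReal.toReal_add (measure_ne_top _ _) hd]
    exact ENNReal.toReal_mono (ENNReal.add_ne_top.2 ⟨measure_ne_top _ _, hd⟩) (h F hF)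
  have h := tvDist_le μ ν (c := d.toReal) fun F hF =>
    abs_sub_le_iff.2 ⟨key μ ν h1 F hF, key ν μ h2 F hF⟩
  refine (ENNReal.ofReal_le_ofReal h).trans (le_of_eq ?_)
  rw [← two_mul, ENNReal.ofReal_mul (by norm_num), ENNReal.ofReal_toReal hd]
  simp

theorem tvDist_le_two {X : Type*} [MeasurableSpace X] (μ ν : Measure X) [IsProbabilityMeasure μ]
    [IsProbabilityMeasure ν] : tvDist μ ν ≤ 2 := by
  have h := tvDist_le μ ν (c := 1) fun F _ => by
    have h1 : μ.real F ≤ 1 := measureReal_le_one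
    have h2 : ν.real F ≤ 1 := measureReal_le_one
    have h3 : 0 ≤ μ.real F := measureReal_nonneg
    have h4 : 0 ≤ ν.real F := measureReal_nonneg
    exact abs_le.2 ⟨by linarith, by linarith⟩
  linarith

/-- The `1`-Lipschitz test functions with values in `[0, 4]`. On a space of diameter at most two,
such as `K`, the bound is no restriction, up to translation. -/
structure IsTest {Y : Type*} [MetricSpace Y] [MeasurableSpace Y] (u : Y → ℝ≥0∞) : Prop where
  measurable : Measurable u
  le : ∀ y, u y ≤ 4
  lipschitz : ∀ y z, u y ≤ u z + edist y z

/-- On a space of diameter at most two, every `1`-Lipschitz function is a translate of a test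
function. -/
theorem exists_isTest_integral_eq {Y : Type*} [MetricSpace Y] [MeasurableSpace Y] [BorelSpace Y]
    (hdiam : ∀ y z : Y, dist y z ≤ 2) (y₀ : Y) {u : Y →ᵇ ℝ} (hu : LipschitzWith 1 u) :
    ∃ v : Y → ℝ≥0∞, IsTest v ∧ ∃ c : ℝ, ∀ (ρ : Measure Y) [IsProbabilityMeasure ρ],
      ∫ y, u y ∂ρ = (∫⁻ y, v y ∂ρ).toReal + c := by
  have hL : ∀ y z, u y - u z ≤ dist y z := by
    intro y z
    have := hu.dist_le_mul y z
    rw [Real.dist_eq, NNReal.coe_one, one_mul] at this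
    exact (le_abs_self _).trans this
  have hnonneg : ∀ y, 0 ≤ u y - u y₀ + 2 := by
    intro y
    have h1 := hL y₀ y
    have h2 := hdiam y₀ y
    linarith
  have hle : ∀ y, u y - u y₀ + 2 ≤ 4 := by
    intro y
    have h1 := hL y y₀
    have h2 := hdiam y y₀
    linarith
  have hcont : Continuous fun y => u y - u y₀ + 2 := by fun_prop
  refine ⟨fun y => ENNReal.ofReal (u y - u y₀ + 2),
    ⟨hcont.measurable.ennreal_ofReal, fun y => ?_, fun y z => ?_⟩, u y₀ - 2, fun ρ _ => ?_⟩
  · exact (ENNReal.ofReal_le_ofReal (hle y)).trans (by simp)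
  · rw [edist_dist, ← ENNReal.ofReal_add (hnonneg z) dist_nonneg]
    exact ENNReal.ofReal_le_ofReal (by linarith [hL y z])
  · rw [← integral_eq_lintegral_of_nonneg_ae (Eventually.of_forall hnonneg)
      hcont.aestronglyMeasurable]
    have h1 : Integrable (fun y => u y - u y₀) ρ := (u.integrable ρ).sub (integrable_const _)
    rw [integral_add h1 (integrable_const _), integral_sub (u.integrable ρ) (integrable_const _)]
    simp only [integral_const, probReal_univ, one_smul]
    ring

theorem IsTest.lintegral_ne_top {Y : Type*} [MetricSpace Y] [MeasurableSpace Y] {u : Y → ℝ≥0∞}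
    (hu : IsTest u) (ρ : Measure Y) [IsProbabilityMeasure ρ] : ∫⁻ y, u y ∂ρ ≠ ∞ := by
  refine ne_top_of_le_ne_top ?_ (lintegral_mono hu.le)
  simp

/-- On a space of diameter at most two it suffices to compare the integrals of test functions. -/
theorem ofReal_integral_sub_le {Y : Type*} [MetricSpace Y] [MeasurableSpace Y] [BorelSpace Y]
    (hdiam : ∀ y z : Y, dist y z ≤ 2) {μ ν : Measure Y} [IsProbabilityMeasure μ]
    [IsProbabilityMeasure ν] {d : ℝ≥0∞}
    (h : ∀ u : Y → ℝ≥0∞, IsTest u → ∫⁻ y, u y ∂μ ≤ ∫⁻ y, u y ∂ν + d)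
    {u : Y →ᵇ ℝ} (hu : LipschitzWith 1 u) :
    ENNReal.ofReal (∫ y, u y ∂μ - ∫ y, u y ∂ν) ≤ d := by
  obtain ⟨y₀⟩ := nonempty_of_isProbabilityMeasure μ
  obtain ⟨v, hv, c, hc⟩ := exists_isTest_integral_eq hdiam y₀ hu
  rw [hc μ, hc ν, add_sub_add_right_eq_sub, ENNReal.ofReal_sub _ ENNReal.toReal_nonneg,
    ENNReal.ofReal_toReal (hv.lintegral_ne_top μ), ENNReal.ofReal_toReal (hv.lintegral_ne_top ν)]
  exact tsub_le_iff_left.2 (h _ hv)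

namespace DensityHMM

universe v

variable {S : Type*} {A : Type v} [MeasurableSpace S] [MeasurableSpace A] {H : DensityHMM S A}
  {R C : ℝ≥0}

open DensityProbability

variable (H) in
/-- The factorization `m s t a = p s t * q t a`: given the new state `t`, the observation does not
depend on the previous state. -/
structure IsEmission (q : S → A → ℝ≥0) : Prop where
  measurable : Measurable (Function.uncurry q)
  eq_mul : ∀ s t a, H.m s t a = H.p s t * q t a
  lintegral_eq_one : ∀ t, ∫⁻ a, (q t a : ℝ≥0∞) ∂H.tau = 1

variable (H) in
theorem lintegral_lintegral_p (μ : Measure S) [SFinite μ] {φ : S → ℝ≥0∞} (hφ : Measurable φ) :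
    ∫⁻ t, (∫⁻ s, (H.p s t : ℝ≥0∞) ∂μ) * φ t ∂H.lam = ∫⁻ s, ∫⁻ t, φ t ∂H.markovKernel s ∂μ := by
  have hp : ∀ t, Measurable fun s => (H.p s t : ℝ≥0∞) := fun t =>
    H.measurable_p.comp (f := fun s => (s, t)) (by fun_prop)
  have hm : Measurable (Function.uncurry fun t s => (H.p s t : ℝ≥0∞) * φ t) :=
    (H.measurable_p.comp measurable_swap).mul (hφ.comp measurable_fst)
  simp_rw [H.lintegral_markovKernel _ hφ]
  rw [← lintegral_lintegral_swap hm.aemeasurable]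
  exact lintegral_congr fun t => (lintegral_mul_const _ (hp t)).symm

variable (H) in
theorem measurable_lintegral_p (μ : Measure S) [SFinite μ] :
    Measurable fun t => ∫⁻ s, (H.p s t : ℝ≥0∞) ∂μ :=
  Measurable.lintegral_prod_right' (f := fun z : S × S => (H.p z.2 z.1 : ℝ≥0∞))
    (H.measurable_p.comp measurable_swap)

/-- The law of the next state, if the present state has law `x`. -/
def predict (x : DensityProbability H.lam) : DensityProbability H.lam :=
  ofDensity (fun t => ∫⁻ s, (H.p s t : ℝ≥0∞) ∂x.1.toMeasure) (H.measurable_lintegral_p _) (by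
    have h := H.lintegral_lintegral_p x.1.toMeasure (φ := fun _ => 1) measurable_const
    simpa using h)

theorem predict_toMeasure (x : DensityProbability H.lam) : (predict x).1.toMeasure =
    H.lam.withDensity fun t => ∫⁻ s, (H.p s t : ℝ≥0∞) ∂x.1.toMeasure := rfl

theorem lintegral_predict (x : DensityProbability H.lam) {φ : S → ℝ≥0∞} (hφ : Measurable φ) :
    ∫⁻ t, φ t ∂(predict x).1.toMeasure = ∫⁻ s, ∫⁻ t, φ t ∂H.markovKernel s ∂x.1.toMeasure := by
  rw [predict_toMeasure, lintegral_withDensity_eq_lintegral_mul _ (H.measurable_lintegral_p _) hφ,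
    ← H.lintegral_lintegral_p _ hφ]
  rfl

theorem lintegral_predict_iterate (x : DensityProbability H.lam) {φ : S → ℝ≥0∞}
    (hφ : Measurable φ) (k : ℕ) : ∫⁻ t, φ t ∂(predict^[k] x).1.toMeasure =
      ∫⁻ s, ∫⁻ t, φ t ∂((H.markovKernel ^ k) s) ∂x.1.toMeasure := by
  induction k generalizing φ with
  | zero =>
    refine lintegral_congr fun s => ?_
    change _ = ∫⁻ t, φ t ∂(Kernel.id s)
    rw [Kernel.id_apply, lintegral_dirac' _ hφ]
  | succ k ih =>
    rw [Function.iterate_succ_apply', lintegral_predict _ hφ, ih hφ.lintegral_kernel]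
    refine lintegral_congr fun s => ?_
    rw [add_comm k 1, Kernel.pow_add, Kernel.lintegral_comp _ _ _ hφ, pow_one]

namespace IsEmission

variable {q : S → A → ℝ≥0}

theorem measurable_left (hq : H.IsEmission q) (a : A) : Measurable fun t => q t a :=
  hq.measurable.comp (f := fun t => (t, a)) (by fun_prop)

theorem stepDens_eq (hq : H.IsEmission q) (μ : Measure S) (a : A) (t : S) :
    H.stepDens μ a t = (∫⁻ s, (H.p s t : ℝ≥0∞) ∂μ) * q t a := by
  have hp : Measurable fun s => (H.p s t : ℝ≥0∞) :=
    H.measurable_p.comp (f := fun s => (s, t)) (by fun_prop)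
  rw [stepDens, ← lintegral_mul_const _ hp]
  simp_rw [hq.eq_mul, ENNReal.coe_mul]

theorem step_eq (hq : H.IsEmission q) (x : DensityProbability H.lam) (a : A) :
    H.step x.1.toMeasure a = (predict x).1.toMeasure.withDensity fun t => (q t a : ℝ≥0∞) := by
  rw [predict_toMeasure, ← withDensity_mul _ (H.measurable_lintegral_p _)
    (hq.measurable_left a).coe_nnreal_ennreal, step]
  congr 1
  funext t
  exact hq.stepDens_eq _ a t

end IsEmission

theorem isState_toMeasure (x : DensityProbability H.lam) {r : S → ℝ≥0} (hr : Measurable r)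
    (hrR : ∀ s, r s ≤ R) : H.IsState R r x.1.toMeasure :=
  ⟨hr, hrR, _, x.1.measurable_dens.coe_nnreal_ennreal, x.1.lintegral_dens_ne_top,
    x.1.toMeasure_eq⟩

theorem IsMeasurableFunctional.measurable_emission {Φ : Functional S} {q : S → A → ℝ≥0}
    (hΦ : H.IsMeasurableFunctional Φ) (hq : H.IsEmission q) (x : DensityProbability H.lam) :
    Measurable fun a => Φ (fun t => q t a) x.1.toMeasure := by
  have h := hΦ A (fun a t => q t a) (fun _ t => x.1.dens t)
    (hq.measurable.comp measurable_swap) (x.1.measurable_dens.coe_nnreal_ennreal.comp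
      measurable_snd) fun _ => x.1.lintegral_dens_ne_top
  simp_rw [← x.1.toMeasure_eq] at h
  exact h

variable (H) in
/-- A bound for the effect on the filter at time `n + 1` of forgetting the first observation. -/
def forgetError (q : S → A → ℝ≥0) (x : DensityProbability H.lam) (n : ℕ) : ℝ≥0∞ :=
  H.transfer^[n] meanDeviation (fun _ => 1) (predict x).1.toMeasure +
    ∫⁻ a, H.transfer^[n] meanDeviation (fun t => q t a) (predict x).1.toMeasure ∂H.tau

theorem tendsto_forgetError (hH : H.IsBoundedBy C) {q : S → A → ℝ≥0} (hq : H.IsEmission q)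
    (hR1 : 1 ≤ R) (hqR : ∀ t a, q t a ≤ R) (hv : H.Vanishes R meanDeviation)
    (x : DensityProbability H.lam) : Tendsto (H.forgetError q x) atTop (𝓝 0) := by
  have hst : ∀ a, H.IsState R (fun t => q t a) (predict x).1.toMeasure := fun a =>
    isState_toMeasure _ (hq.measurable_left a) fun t => hqR t a
  have hone : H.IsState R (fun _ => 1) (predict x).1.toMeasure :=
    isState_toMeasure _ measurable_const fun _ => hR1
  have h1 := hv.tendsto _ _ hone
  have h2 : Tendsto (fun n => ∫⁻ a, H.transfer^[n] meanDeviation (fun t => q t a)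
      (predict x).1.toMeasure ∂H.tau) atTop (𝓝 (∫⁻ _, 0 ∂H.tau)) := by
    refine tendsto_lintegral_of_dominated_convergence
      (fun a => 2 * firstMoment (fun t => q t a) (predict x).1.toMeasure)
      (fun n => (isMeasurableFunctional_meanDeviation.iterate hH n).measurable_emission hq _)
      (fun n => Eventually.of_forall fun a => ?_) ?_
      (Eventually.of_forall fun a => hv.tendsto _ _ (hst a))
    · have := leOn_meanDeviation.iterate hH n _ _ (hst a)
      rwa [iterate_smul isMeasurableFunctional_firstMoment hH _ n (hst a),
        iterate_firstMoment hH n (hst a)] at this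
    · rw [lintegral_const_mul' _ _ (by norm_num)]
      unfold firstMoment
      rw [lintegral_lintegral_swap
        (hq.measurable.comp measurable_swap).coe_nnreal_ennreal.aemeasurable]
      simp [hq.lintegral_eq_one]
  have h := h1.add h2
  simp only [lintegral_zero, add_zero] at h
  exact h

theorem edist_eq_ofReal_tvDist (x y : DensityProbability H.lam) :
    edist x y = ENNReal.ofReal (tvDist x.1.toMeasure y.1.toMeasure) := edist_dist _ _

section FilterKernel

variable [MetricSpace A] [SecondCountableTopology A] [BorelSpace A]

instance (hreg : H.IsRegular) : IsMarkovKernel (H.filterKernel hreg) := by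
  refine ⟨fun x => ⟨?_⟩⟩
  have h := lintegral_filterKernel hreg x (u := fun _ => 1) measurable_const
  rw [lintegral_one] at h
  rw [h]
  simp_rw [mul_one]
  exact (H.lintegral_step_univ x.1.toMeasure).trans x.2

theorem lintegral_filterKernel_pow_succ (hreg : H.IsRegular) (n : ℕ)
    {u : DensityProbability H.lam → ℝ≥0∞} (hu : Measurable u) (x : DensityProbability H.lam) :
    ∫⁻ y, u y ∂((H.filterKernel hreg ^ (n + 1)) x) =
      ∫⁻ a, homExt (fun y => ∫⁻ z, u z ∂((H.filterKernel hreg ^ n) y))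
        (H.step x.1.toMeasure a) ∂H.tau := by
  rw [Kernel.pow_add, Kernel.lintegral_comp _ _ _ hu, pow_one,
    lintegral_filterKernel hreg x hu.lintegral_kernel]
  exact lintegral_congr fun a => obsDensity_mul_filterUpdate hreg x
    (fun y => ∫⁻ z, u z ∂((H.filterKernel hreg ^ n) y)) a

/-- The filter at time `n + 1` that is started at `x` is close in law to the filter at time `n`
that is started at the predicted law of the first state. -/
theorem lintegral_pow_succ_le [MeasurableSpace.CountablyGenerated S] (hH : H.IsBoundedBy C)
    (hreg : H.IsRegular) {q : S → A → ℝ≥0}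
    (hq : H.IsEmission q) (hR1 : 1 ≤ R) (hqR : ∀ t a, q t a ≤ R)
    {u : DensityProbability H.lam → ℝ≥0∞} (hu : IsTest u) (x : DensityProbability H.lam) (n : ℕ) :
    ∫⁻ y, u y ∂((H.filterKernel hreg ^ (n + 1)) x) ≤
        ∫⁻ y, u y ∂((H.filterKernel hreg ^ n) (predict x)) + H.forgetError q x n ∧
      ∫⁻ y, u y ∂((H.filterKernel hreg ^ n) (predict x)) ≤
        ∫⁻ y, u y ∂((H.filterKernel hreg ^ (n + 1)) x) + H.forgetError q x n := by
  have hst : ∀ a, H.IsState R (fun t => q t a) (predict x).1.toMeasure := fun a =>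
    isState_toMeasure _ (hq.measurable_left a) fun t => hqR t a
  have hone : H.IsState R (fun _ => 1) (predict x).1.toMeasure :=
    isState_toMeasure _ measurable_const fun _ => hR1
  have hwm := isMeasurableFunctional_uninformedFilter hu.measurable
  have hdm := isMeasurableFunctional_meanDeviation (H := H)
  have hcmp := leOn_informedFilter_uninformedFilter (R := R) hu.lipschitz
  have e1 : ∫⁻ y, u y ∂((H.filterKernel hreg ^ (n + 1)) x) =
      ∫⁻ a, H.transfer^[n] (informedFilter u) (fun t => q t a) (predict x).1.toMeasure ∂H.tau := by
    rw [lintegral_filterKernel_pow_succ hreg n hu.measurable]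
    refine lintegral_congr fun a => ?_
    rw [iterate_informedFilter hH hreg n hu.measurable (hst a), hq.step_eq]
    rfl
  have e2 : ∫⁻ y, u y ∂((H.filterKernel hreg ^ n) (predict x)) =
      H.transfer^[n] (informedFilter u) (fun _ => 1) (predict x).1.toMeasure := by
    rw [iterate_informedFilter hH hreg n hu.measurable hone, informedFilter]
    simp only [ENNReal.coe_one]
    rw [show (fun _ : S => (1 : ℝ≥0∞)) = 1 from rfl, withDensity_one, homExt_toMeasure]
  have e3 : ∫⁻ a, H.transfer^[n] (uninformedFilter u) (fun t => q t a)
      (predict x).1.toMeasure ∂H.tau =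
      H.transfer^[n] (uninformedFilter u) (fun _ => 1) (predict x).1.toMeasure := by
    refine (isAveraging_uninformedFilter u).iterate hwm hH n (fun a t => q t a) _ _
      (hq.measurable.comp measurable_swap) hst hone fun s => ?_
    rw [hq.lintegral_eq_one, ENNReal.coe_one]
  -- the informed and the uninformed filter are compared both with the first observation and without
  have g1 : ∀ r μ, H.IsState R r μ → H.transfer^[n] (informedFilter u) r μ ≤
      H.transfer^[n] (uninformedFilter u) r μ + H.transfer^[n] meanDeviation r μ := by
    intro r μ h
    rw [← iterate_add hwm hH n h]
    exact hcmp.1.iterate hH n r μ h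
  have g2 : ∀ r μ, H.IsState R r μ → H.transfer^[n] (uninformedFilter u) r μ ≤
      H.transfer^[n] (informedFilter u) r μ + H.transfer^[n] meanDeviation r μ := by
    intro r μ h
    rw [add_comm, ← iterate_add hdm hH n h, add_comm]
    exact hcmp.2.iterate hH n r μ h
  have hdma := (hdm.iterate hH n).measurable_emission hq (predict x)
  rw [e1, e2, forgetError]
  constructor
  · calc _ ≤ ∫⁻ a, (H.transfer^[n] (uninformedFilter u) (fun t => q t a) (predict x).1.toMeasure +
          H.transfer^[n] meanDeviation (fun t => q t a) (predict x).1.toMeasure) ∂H.tau :=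
          lintegral_mono fun a => g1 _ _ (hst a)
      _ = H.transfer^[n] (uninformedFilter u) (fun _ => 1) (predict x).1.toMeasure +
          ∫⁻ a, H.transfer^[n] meanDeviation (fun t => q t a) (predict x).1.toMeasure ∂H.tau := by
          rw [lintegral_add_right _ hdma, e3]
      _ ≤ _ := by
          rw [← add_assoc]
          gcongr
          exact g2 _ _ hone
  · calc _ ≤ H.transfer^[n] (uninformedFilter u) (fun _ => 1) (predict x).1.toMeasure +
          H.transfer^[n] meanDeviation (fun _ => 1) (predict x).1.toMeasure := g1 _ _ hone
      _ ≤ ∫⁻ a, (H.transfer^[n] (informedFilter u) (fun t => q t a) (predict x).1.toMeasure +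
          H.transfer^[n] meanDeviation (fun t => q t a) (predict x).1.toMeasure) ∂H.tau +
          H.transfer^[n] meanDeviation (fun _ => 1) (predict x).1.toMeasure := by
          rw [← e3]
          gcongr
          exact g2 _ _ (hst _)
      _ = _ := by
          rw [lintegral_add_right _ hdma]
          ring

/-- The first `k` observations can be forgotten, with an error that is uniform over the test
functions and tends to zero as the number of the later observations grows. -/
theorem exists_forget [MeasurableSpace.CountablyGenerated S] (hH : H.IsBoundedBy C)
    (hreg : H.IsRegular) {q : S → A → ℝ≥0} (hq : H.IsEmission q) (hR1 : 1 ≤ R)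
    (hqR : ∀ t a, q t a ≤ R) (hv : H.Vanishes R meanDeviation) (k : ℕ)
    (x : DensityProbability H.lam) : ∃ ρ : ℕ → ℝ≥0∞, Tendsto ρ atTop (𝓝 0) ∧
      ∀ n (u : DensityProbability H.lam → ℝ≥0∞), IsTest u →
        ∫⁻ y, u y ∂((H.filterKernel hreg ^ (n + k)) x) ≤
          ∫⁻ y, u y ∂((H.filterKernel hreg ^ n) (predict^[k] x)) + ρ n ∧
        ∫⁻ y, u y ∂((H.filterKernel hreg ^ n) (predict^[k] x)) ≤
          ∫⁻ y, u y ∂((H.filterKernel hreg ^ (n + k)) x) + ρ n := by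
  induction k generalizing x with
  | zero => exact ⟨fun _ => 0, tendsto_const_nhds, fun n u _ => ⟨le_self_add, le_self_add⟩⟩
  | succ k ih =>
    obtain ⟨ρ, hρ, hle⟩ := ih (predict x)
    refine ⟨fun n => ρ n + H.forgetError q x (n + k), ?_, fun n u hu => ?_⟩
    · simpa using hρ.add ((tendsto_forgetError hH hq hR1 hqR hv x).comp (tendsto_add_atTop_nat k))
    · have h1 := hle n u hu
      have h2 := lintegral_pow_succ_le hH hreg hq hR1 hqR hu x (n + k)
      rw [Function.iterate_succ_apply, ← add_assoc n k 1]
      change _ ≤ _ + (ρ n + H.forgetError q x (n + k)) ∧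
        _ ≤ _ + (ρ n + H.forgetError q x (n + k))
      constructor
      · refine h2.1.trans ?_
        rw [← add_assoc]
        gcongr
        exact h1.1
      · refine h1.2.trans ?_
        rw [add_comm (ρ n), ← add_assoc]
        gcongr
        exact h2.2

end FilterKernel

end DensityHMM

/-! ### Weak contraction -/

theorem setLIntegral_le_add_densDist {X : Type*} [MeasurableSpace X] (lam : Measure X)
    (f : X → ℝ≥0∞) {g : X → ℝ≥0∞} (hg : Measurable g) (F : Set X) :
    ∫⁻ t in F, f t ∂lam ≤ ∫⁻ t in F, g t ∂lam + densDist lam f g := by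
  calc ∫⁻ t in F, f t ∂lam ≤ ∫⁻ t in F, (g t + (f t - g t)) ∂lam :=
        lintegral_mono fun t => le_add_tsub
    _ = ∫⁻ t in F, g t ∂lam + ∫⁻ t in F, (f t - g t) ∂lam := lintegral_add_left hg _
    _ ≤ _ := by
        gcongr
        exact (setLIntegral_le_lintegral _ _).trans (lintegral_mono fun t => le_self_add)

theorem densDist_comm {X : Type*} [MeasurableSpace X] (lam : Measure X) (f g : X → ℝ≥0∞) :
    densDist lam f g = densDist lam g f :=
  lintegral_congr fun _ => add_comm _ _

/-- Bounded convergence to zero for functions that need not be measurable: the usual theorem applies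
to measurable minorants with the same lower integrals. -/
theorem tendsto_lintegral_zero_of_le {X : Type*} [MeasurableSpace X] (μ : Measure X)
    [IsFiniteMeasure μ] {f : ℕ → X → ℝ≥0∞} {c : ℝ≥0} (hc : ∀ n x, f n x ≤ c)
    (hf : ∀ x, Tendsto (fun n => f n x) atTop (𝓝 0)) :
    Tendsto (fun n => ∫⁻ x, f n x ∂μ) atTop (𝓝 0) := by
  choose g hgm hgle hgeq using fun n : ℕ => exists_measurable_le_lintegral_eq μ (f n)
  simp_rw [hgeq]
  rw [← lintegral_zero (μ := μ)]
  refine tendsto_lintegral_of_dominated_convergence (fun _ => c) hgm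
    (fun n => Eventually.of_forall fun x => (hgle n x).trans (hc n x)) (by simp; finiteness)
    (Eventually.of_forall fun x => ?_)
  exact tendsto_of_tendsto_of_tendsto_of_le_of_le tendsto_const_nhds (hf x) (fun _ => zero_le)
    fun n => hgle n x

/-- The total variation distance need not be a measurable function of the initial state; the
integral is the lower integral. -/
theorem StronglyErgodicWith.tendsto_lintegral_tvDist {X : Type*} [MeasurableSpace X]
    {Q : Kernel X X} [IsMarkovKernel Q] {π : Measure X} (h : StronglyErgodicWith Q π)
    (μ : Measure X) [IsFiniteMeasure μ] :
    Tendsto (fun n => ∫⁻ s, ENNReal.ofReal (tvDist ((Q ^ n) s) π) ∂μ) atTop (𝓝 0) := by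
  have := h.1
  refine tendsto_lintegral_zero_of_le μ (c := 2) (fun n s => ?_) fun s => ?_
  · exact (ENNReal.ofReal_le_ofReal (tvDist_le_two _ _)).trans (by simp)
  · simpa using ENNReal.tendsto_ofReal (h.2 s)

namespace DensityHMM

universe v

variable {S : Type*} {A : Type v} [MeasurableSpace S] [MeasurableSpace A] {H : DensityHMM S A}
  {R C : ℝ≥0}

open DensityProbability

/-- The homogeneous extension of a test function is Lipschitz for the `L¹` distance of
densities. -/
theorem homExt_le_of_isTest {u : DensityProbability H.lam → ℝ≥0∞} (hu : IsTest u)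
    {f g : S → ℝ≥0∞} (hf : Measurable f) (hg : Measurable g) (hf' : ∫⁻ t, f t ∂H.lam ≠ ∞)
    (hg' : ∫⁻ t, g t ∂H.lam ≠ ∞) :
    homExt u (H.lam.withDensity f) ≤
      homExt u (H.lam.withDensity g) + 8 * densDist H.lam f g := by
  set d := densDist H.lam f g with hd
  have hle : ∀ F : Set S, ∫⁻ t in F, f t ∂H.lam ≤ ∫⁻ t in F, g t ∂H.lam + d :=
    setLIntegral_le_add_densDist _ _ hg
  have hge : ∀ F : Set S, ∫⁻ t in F, g t ∂H.lam ≤ ∫⁻ t in F, f t ∂H.lam + d := fun F => by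
    rw [hd, densDist_comm]
    exact setLIntegral_le_add_densDist _ _ hf F
  have hFG := hle Set.univ
  have hGF := hge Set.univ
  rw [Measure.restrict_univ] at hFG hGF
  rcases eq_or_ne (∫⁻ t, f t ∂H.lam) 0 with hF | hF
  · rw [homExt, withDensity_apply _ MeasurableSet.univ, Measure.restrict_univ, hF, zero_mul]
    exact zero_le
  rw [withDensity_eq_smul_normalized hf hF hf', homExt_smul _ _ hf']
  rcases eq_or_ne (∫⁻ t, g t ∂H.lam) 0 with hG | hG
  · rw [hG, zero_add] at hFG
    calc _ ≤ d * 4 := mul_le_mul' hFG (hu.le _)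
      _ ≤ 8 * d := by rw [mul_comm]; gcongr; norm_num
      _ ≤ _ := le_add_self
  rw [withDensity_eq_smul_normalized hg hG hg', homExt_smul _ _ hg']
  generalize hx : normalized f hf hF hf' = x
  generalize hy : normalized g hg hG hg' = y
  have ex : ∀ F, MeasurableSet F → (∫⁻ t, f t ∂H.lam) * x.1.toMeasure F =
      ∫⁻ t in F, f t ∂H.lam := by
    intro F hF'
    rw [← hx, ← smul_eq_mul, ← Measure.smul_apply, ← withDensity_eq_smul_normalized hf hF hf',
      withDensity_apply _ hF']
  have ey : ∀ F, MeasurableSet F → (∫⁻ t, g t ∂H.lam) * y.1.toMeasure F =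
      ∫⁻ t in F, g t ∂H.lam := by
    intro F hF'
    rw [← hy, ← smul_eq_mul, ← Measure.smul_apply, ← withDensity_eq_smul_normalized hg hG hg',
      withDensity_apply _ hF']
  clear hx hy
  generalize (∫⁻ t, f t ∂H.lam) = a at *
  generalize (∫⁻ t, g t ∂H.lam) = b at *
  have h1 : ∀ z : DensityProbability H.lam, ∀ F, z.1.toMeasure F ≤ 1 := fun z F => prob_le_one
  have hxy : a * edist x y ≤ 4 * d := by
    rw [edist_eq_ofReal_tvDist]
    have key := ofReal_tvDist_le x.1.toMeasure y.1.toMeasure (d := 2 * d / a)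
      (fun F hF' => ?_) fun F hF' => ?_
    · calc a * ENNReal.ofReal (tvDist x.1.toMeasure y.1.toMeasure) ≤ a * (2 * (2 * d / a)) := by
            gcongr
        _ = 2 * (a * (2 * d / a)) := by ring
        _ = 2 * (2 * d) := by rw [ENNReal.mul_div_cancel hF hf']
        _ = 4 * d := by ring
    · rw [← ENNReal.mul_le_mul_iff_right hF hf', mul_add, ENNReal.mul_div_cancel hF hf', ex F hF']
      calc _ ≤ b * y.1.toMeasure F + d := (hle F).trans_eq (by rw [ey F hF'])
        _ ≤ (a + d) * y.1.toMeasure F + d := by gcongr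
        _ = a * y.1.toMeasure F + (d * y.1.toMeasure F + d) := by ring
        _ ≤ a * y.1.toMeasure F + (d * 1 + d) := by gcongr; exact h1 y F
        _ = _ := by ring
    · rw [← ENNReal.mul_le_mul_iff_right hF hf', mul_add, ENNReal.mul_div_cancel hF hf', ex F hF']
      calc a * y.1.toMeasure F ≤ (b + d) * y.1.toMeasure F := by gcongr
        _ = b * y.1.toMeasure F + d * y.1.toMeasure F := by ring
        _ ≤ (∫⁻ t in F, f t ∂H.lam + d) + d * 1 := by
            rw [ey F hF']
            gcongr
            · exact hge F
            · exact h1 y F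
        _ = _ := by ring
  calc a * u x ≤ a * (u y + edist x y) := by gcongr; exact hu.lipschitz x y
    _ = a * u y + a * edist x y := mul_add _ _ _
    _ ≤ (b + d) * u y + 4 * d := by gcongr
    _ = b * u y + (d * u y + 4 * d) := by ring
    _ ≤ b * u y + (d * 4 + 4 * d) := by gcongr; exact hu.le y
    _ = _ := by ring

/-- The steps of the filter contract the `L¹` distance on average. -/
theorem lintegral_densDist_stepDens_le {f g : S → ℝ≥0∞} (hf : Measurable f) (hg : Measurable g)
    (hf' : ∫⁻ t, f t ∂H.lam ≠ ∞) (hg' : ∫⁻ t, g t ∂H.lam ≠ ∞) :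
    ∫⁻ a, densDist H.lam (H.stepDens (H.lam.withDensity f) a)
      (H.stepDens (H.lam.withDensity g) a) ∂H.tau ≤ densDist H.lam f g := by
  have key : ∀ f g : S → ℝ≥0∞, Measurable f → Measurable g → ∀ a t,
      H.stepDens (H.lam.withDensity f) a t - H.stepDens (H.lam.withDensity g) a t ≤
        H.stepDens (H.lam.withDensity fun t => f t - g t) a t := by
    intro f g hf hg a t
    rw [tsub_le_iff_left, H.stepDens_withDensity hf, H.stepDens_withDensity hg,
      H.stepDens_withDensity (f := fun t => f t - g t) (hf.sub hg),
      ← lintegral_add_left (f := fun s => g s * H.m s t a) (hg.mul (H.measurable_m_fst t a))]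
    refine lintegral_mono fun s => ?_
    rw [← add_mul]
    gcongr
    exact le_add_tsub
  have hfin : ∀ f g : S → ℝ≥0∞, ∫⁻ t, f t ∂H.lam ≠ ∞ →
      IsFiniteMeasure (H.lam.withDensity fun t => f t - g t) := fun f g h =>
    isFiniteMeasure_withDensity (ne_top_of_le_ne_top h (lintegral_mono fun t => tsub_le_self))
  have i1 := hfin f g hf'
  have i2 := hfin g f hg'
  have e1 := H.lintegral_step_univ (H.lam.withDensity fun t => f t - g t)
  have e2 := H.lintegral_step_univ (H.lam.withDensity fun t => g t - f t)
  simp_rw [step, withDensity_apply _ MeasurableSet.univ, Measure.restrict_univ] at e1 e2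
  have m1 := H.measurable_stepDens (H.lam.withDensity fun t => f t - g t)
  calc _ ≤ ∫⁻ a, (∫⁻ t, H.stepDens (H.lam.withDensity fun t => f t - g t) a t ∂H.lam +
        ∫⁻ t, H.stepDens (H.lam.withDensity fun t => g t - f t) a t ∂H.lam) ∂H.tau := by
        refine lintegral_mono fun a => ?_
        rw [← lintegral_add_left (H.measurable_stepDens_right _ a)]
        exact lintegral_mono fun t => add_le_add (key f g hf hg a t) (key g f hg hf a t)
    _ = _ := by
        rw [lintegral_add_left (m1.lintegral_prod_right' (f := fun z : A × S => _)), e1, e2,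
          densDist, lintegral_add_left (f := fun t => f t - g t) (hf.sub hg)]

theorem dist_le_two (x y : DensityProbability H.lam) : dist x y ≤ 2 := tvDist_le_two _ _

theorem edist_eq_densDist (x y : DensityProbability H.lam) :
    edist x y = densDist H.lam (fun t => x.1.dens t) (fun t => y.1.dens t) :=
  FiniteDensityMeasure.edist_eq x.1 y.1

theorem predict_iterate_apply (x : DensityProbability H.lam) (k : ℕ) {F : Set S}
    (hF : MeasurableSet F) : (predict^[k] x).1.toMeasure F =
      ∫⁻ s, (H.markovKernel ^ k) s F ∂x.1.toMeasure := by
  have h := lintegral_predict_iterate x (measurable_one.indicator hF) k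
  simpa [lintegral_indicator_one hF] using h

/-- By strong ergodicity the predictions from two initial laws approach each other. -/
theorem tendsto_edist_predict_iterate {π : Measure S}
    (hπ : StronglyErgodicWith H.markovKernel π) (x y : DensityProbability H.lam) :
    Tendsto (fun k => edist (predict^[k] x) (predict^[k] y)) atTop (𝓝 0) := by
  have := hπ.1
  have key : ∀ (x : DensityProbability H.lam) (k : ℕ) (F : Set S), MeasurableSet F →
      (predict^[k] x).1.toMeasure F ≤ π F +
        ∫⁻ s, ENNReal.ofReal (tvDist ((H.markovKernel ^ k) s) π) ∂x.1.toMeasure ∧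
      π F ≤ (predict^[k] x).1.toMeasure F +
        ∫⁻ s, ENNReal.ofReal (tvDist ((H.markovKernel ^ k) s) π) ∂x.1.toMeasure := by
    intro x k F hF
    have hc : π F = ∫⁻ _, π F ∂x.1.toMeasure := by simp
    rw [predict_iterate_apply x k hF]
    constructor
    · rw [hc, ← lintegral_add_left measurable_const]
      exact lintegral_mono fun s => measure_le_add_tvDist _ _ hF
    · rw [hc, ← lintegral_add_left (Kernel.measurable_coe _ hF)]
      refine lintegral_mono fun s => ?_
      simp only
      rw [tvDist_comm]
      exact measure_le_add_tvDist _ _ hF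
  have h0 := (hπ.tendsto_lintegral_tvDist x.1.toMeasure).add
    (hπ.tendsto_lintegral_tvDist y.1.toMeasure)
  have h1 := ENNReal.Tendsto.const_mul (a := 2) h0 (Or.inr (by norm_num))
  rw [add_zero, mul_zero] at h1
  refine tendsto_of_tendsto_of_tendsto_of_le_of_le tendsto_const_nhds h1 (fun _ => zero_le)
    fun k => ?_
  simp only
  rw [edist_eq_ofReal_tvDist]
  refine ofReal_tvDist_le _ _ (fun F hF => ?_) fun F hF => ?_
  · refine (key x k F hF).1.trans ?_
    rw [add_comm (∫⁻ s, _ ∂x.1.toMeasure), ← add_assoc]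
    gcongr
    exact (key y k F hF).2
  · refine (key y k F hF).1.trans ?_
    rw [← add_assoc]
    gcongr
    exact (key x k F hF).2

section FilterKernel

variable [MetricSpace A] [SecondCountableTopology A] [BorelSpace A]

/-- Iterates of the filter kernel map test functions to functions whose homogeneous extensions
have a common Lipschitz constant. -/
theorem homExt_pow_le (hH : H.IsBoundedBy C) (hreg : H.IsRegular)
    {u : DensityProbability H.lam → ℝ≥0∞} (hu : IsTest u) (n : ℕ) {f g : S → ℝ≥0∞}
    (hf : Measurable f) (hg : Measurable g) (hf' : ∫⁻ t, f t ∂H.lam ≠ ∞)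
    (hg' : ∫⁻ t, g t ∂H.lam ≠ ∞) :
    homExt (fun x => ∫⁻ y, u y ∂((H.filterKernel hreg ^ n) x)) (H.lam.withDensity f) ≤
      homExt (fun x => ∫⁻ y, u y ∂((H.filterKernel hreg ^ n) x)) (H.lam.withDensity g) +
        8 * densDist H.lam f g := by
  induction n generalizing f g with
  | zero =>
    have e : (fun x => ∫⁻ y, u y ∂((H.filterKernel hreg ^ 0) x)) = u := by
      funext x
      change ∫⁻ y, u y ∂(Kernel.id x) = _
      rw [Kernel.id_apply, lintegral_dirac' _ hu.measurable]
    rw [e]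
    exact homExt_le_of_isTest hu hf hg hf' hg'
  | succ n ih =>
    have e : (fun x => ∫⁻ y, u y ∂((H.filterKernel hreg ^ (n + 1)) x)) =
        fun x => ∫⁻ y, (∫⁻ z, u z ∂((H.filterKernel hreg ^ n) y)) ∂(H.filterKernel hreg x) := by
      funext x
      rw [Kernel.pow_add, Kernel.lintegral_comp _ _ _ hu.measurable, pow_one]
    have i1 : IsFiniteMeasure (H.lam.withDensity f) := isFiniteMeasure_withDensity hf'
    have i2 : IsFiniteMeasure (H.lam.withDensity g) := isFiniteMeasure_withDensity hg'
    have hm : Measurable fun a => densDist H.lam (H.stepDens (H.lam.withDensity f) a)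
        (H.stepDens (H.lam.withDensity g) a) := by
      have m1 := H.measurable_stepDens (H.lam.withDensity f)
      have m2 := H.measurable_stepDens (H.lam.withDensity g)
      exact ((m1.sub m2).add (m2.sub m1)).lintegral_prod_right'
    rw [e, ← lintegral_homExt_step hreg hu.measurable.lintegral_kernel hf hf',
      ← lintegral_homExt_step hreg hu.measurable.lintegral_kernel hg hg']
    calc _ ≤ ∫⁻ a, (homExt (fun x => ∫⁻ y, u y ∂((H.filterKernel hreg ^ n) x))
          (H.step (H.lam.withDensity g) a) +
          8 * densDist H.lam (H.stepDens (H.lam.withDensity f) a)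
            (H.stepDens (H.lam.withDensity g) a)) ∂H.tau :=
          lintegral_mono fun a => ih (H.measurable_stepDens_right _ a)
            (H.measurable_stepDens_right _ a) (hH.lintegral_stepDens_ne_top _ a)
            (hH.lintegral_stepDens_ne_top _ a)
      _ ≤ _ := by
          rw [lintegral_add_right _ (hm.const_mul 8), lintegral_const_mul _ hm]
          gcongr
          exact lintegral_densDist_stepDens_le hf hg hf' hg'

/-- The iterates of the filter kernel map test functions to functions with a common Lipschitz
constant. -/
theorem lintegral_pow_le_add_edist (hH : H.IsBoundedBy C) (hreg : H.IsRegular)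
    {u : DensityProbability H.lam → ℝ≥0∞} (hu : IsTest u) (n : ℕ) (x y : DensityProbability H.lam) :
    ∫⁻ z, u z ∂((H.filterKernel hreg ^ n) x) ≤
      ∫⁻ z, u z ∂((H.filterKernel hreg ^ n) y) + 8 * edist x y := by
  have h := homExt_pow_le hH hreg hu n x.1.measurable_dens.coe_nnreal_ennreal
    y.1.measurable_dens.coe_nnreal_ennreal x.1.lintegral_dens_ne_top y.1.lintegral_dens_ne_top
  rwa [← x.1.toMeasure_eq, ← y.1.toMeasure_eq, homExt_toMeasure, homExt_toMeasure,
    ← edist_eq_densDist] at h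

/-- The greatest difference of the integrals of test functions with respect to the laws of the
filter at time `n`, for the initial values `x` and `y`. -/
def testGap (hreg : H.IsRegular) (x y : DensityProbability H.lam) (n : ℕ) : ℝ≥0∞ :=
  ⨆ u : {u : DensityProbability H.lam → ℝ≥0∞ // IsTest u},
    (∫⁻ z, u.1 z ∂((H.filterKernel hreg ^ n) x) - ∫⁻ z, u.1 z ∂((H.filterKernel hreg ^ n) y))

theorem lintegral_pow_le_add_testGap (hreg : H.IsRegular)
    {u : DensityProbability H.lam → ℝ≥0∞} (hu : IsTest u) (n : ℕ) (x y : DensityProbability H.lam) :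
    ∫⁻ z, u z ∂((H.filterKernel hreg ^ n) x) ≤
      ∫⁻ z, u z ∂((H.filterKernel hreg ^ n) y) + testGap hreg x y n := by
  rw [← tsub_le_iff_left]
  exact le_iSup (fun u : {u : DensityProbability H.lam → ℝ≥0∞ // IsTest u} =>
    ∫⁻ z, u.1 z ∂((H.filterKernel hreg ^ n) x) - ∫⁻ z, u.1 z ∂((H.filterKernel hreg ^ n) y))
    ⟨u, hu⟩

/-- The filter forgets its initial value: the first `k` observations are dropped, after which the
two filters start at the predictions, which are close if `k` is large. -/
theorem tendsto_testGap [MeasurableSpace.CountablyGenerated S] (hH : H.IsBoundedBy C)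
    (hreg : H.IsRegular) {q : S → A → ℝ≥0} (hq : H.IsEmission q) (hR1 : 1 ≤ R)
    (hqR : ∀ t a, q t a ≤ R) (hv : H.Vanishes R meanDeviation) {π : Measure S}
    (hπ : StronglyErgodicWith H.markovKernel π) (x y : DensityProbability H.lam) :
    Tendsto (testGap hreg x y) atTop (𝓝 0) := by
  rw [ENNReal.tendsto_atTop_zero]
  intro ε hε
  have hε2 : 0 < ε / 2 := ENNReal.half_pos hε.ne'
  have h8 := ENNReal.Tendsto.const_mul (a := 8) (tendsto_edist_predict_iterate hπ x y)
    (Or.inr (by norm_num))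
  rw [mul_zero, ENNReal.tendsto_atTop_zero] at h8
  obtain ⟨k, hk⟩ := h8 _ hε2
  obtain ⟨ρ, hρ, hρle⟩ := exists_forget hH hreg hq hR1 hqR hv k x
  obtain ⟨σ, hσ, hσle⟩ := exists_forget hH hreg hq hR1 hqR hv k y
  have h0 := hρ.add hσ
  rw [add_zero, ENNReal.tendsto_atTop_zero] at h0
  obtain ⟨N, hN⟩ := h0 _ hε2
  refine ⟨N + k, fun n hn => iSup_le fun u => tsub_le_iff_left.2 ?_⟩
  obtain ⟨n, rfl⟩ := Nat.exists_eq_add_of_le' (le_of_add_le_right hn)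
  calc _ ≤ ∫⁻ z, u.1 z ∂((H.filterKernel hreg ^ n) (predict^[k] x)) + ρ n := (hρle n _ u.2).1
    _ ≤ (∫⁻ z, u.1 z ∂((H.filterKernel hreg ^ n) (predict^[k] y)) +
          8 * edist (predict^[k] x) (predict^[k] y)) + ρ n := by
        gcongr
        exact lintegral_pow_le_add_edist hH hreg u.2 n _ _
    _ ≤ ((∫⁻ z, u.1 z ∂((H.filterKernel hreg ^ (n + k)) y) + σ n) + ε / 2) + ρ n := by
        gcongr
        · exact (hσle n _ u.2).2
        · exact hk k le_rfl
    _ = ∫⁻ z, u.1 z ∂((H.filterKernel hreg ^ (n + k)) y) + (ε / 2 + (ρ n + σ n)) := by ring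
    _ ≤ ∫⁻ z, u.1 z ∂((H.filterKernel hreg ^ (n + k)) y) + (ε / 2 + ε / 2) := by
        gcongr
        exact hN n (by omega)
    _ = _ := by rw [ENNReal.add_halves]

theorem weaklyContracting_filterKernel (hreg : H.IsRegular)
    (h : ∀ x y, Tendsto (testGap hreg x y) atTop (𝓝 0)) :
    WeaklyContracting (H.filterKernel hreg) := by
  intro x y
  refine tendsto_of_tendsto_of_tendsto_of_le_of_le tendsto_const_nhds (h x y) (fun _ => zero_le)
    fun n => iSup_le fun u => ?_
  exact ofReal_integral_sub_le dist_le_two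
    (fun u hu => lintegral_pow_le_add_testGap hreg hu n x y) u.2

end FilterKernel

end DensityHMM

/-! ### Regularity and minorization for emission densities -/

theorem exists_ofReal_mul_le {K : ℝ≥0∞} (hK : K ≠ ∞) {ε : ℝ≥0∞} (hε : 0 < ε) :
    ∃ e : ℝ, 0 < e ∧ ENNReal.ofReal e * K ≤ ε := by
  have h0 : Tendsto (fun e : ℝ => ENNReal.ofReal e * K) (𝓝[>] 0) (𝓝 0) := by
    have h1 : Tendsto (fun e : ℝ => ENNReal.ofReal e) (𝓝[>] 0) (𝓝 0) := by
      have := (ENNReal.continuous_ofReal.tendsto 0).mono_left (nhdsWithin_le_nhds (s := Set.Ioi 0))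
      simpa using this
    simpa using ENNReal.Tendsto.mul_const h1 (Or.inr hK)
  obtain ⟨e, he, he0⟩ := ((ENNReal.tendsto_nhds_zero.1 h0 ε hε).and self_mem_nhdsWithin).exists
  exact ⟨e, he0, he⟩

theorem measurable_apply_toMeasure {S : Type*} [MeasurableSpace S] {lam : Measure S} {F : Set S}
    (hF : MeasurableSet F) :
    Measurable fun x : DensityProbability lam => x.1.toMeasure F := by
  have h : Continuous fun x : DensityProbability lam => x.1.toMeasure.real F := by
    refine LipschitzWith.continuous (K := 1) (LipschitzWith.of_dist_le_mul fun y z => ?_)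
    rw [Real.dist_eq, NNReal.coe_one, one_mul, Subtype.dist_eq, FiniteDensityMeasure.dist_def]
    exact abs_sub_le_tvDist _ _ hF
  have e : (fun x : DensityProbability lam => x.1.toMeasure F) =
      fun x => ENNReal.ofReal (x.1.toMeasure.real F) := by
    funext x
    rw [measureReal_def, ENNReal.ofReal_toReal (measure_ne_top _ _)]
  rw [e]
  exact h.measurable.ennreal_ofReal

namespace FiniteDensityMeasure

variable {S : Type*} [MeasurableSpace S] {lam : Measure S}

theorem edist_eq_ofReal_tvDist (x y : FiniteDensityMeasure lam) :
    edist x y = ENNReal.ofReal (tvDist x.toMeasure y.toMeasure) := edist_dist _ _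

theorem edist_le {x y : FiniteDensityMeasure lam} {d : ℝ≥0∞}
    (h1 : ∀ F, MeasurableSet F → x.toMeasure F ≤ y.toMeasure F + d)
    (h2 : ∀ F, MeasurableSet F → y.toMeasure F ≤ x.toMeasure F + d) : edist x y ≤ 2 * d := by
  rw [edist_eq_ofReal_tvDist]
  exact ofReal_tvDist_le _ _ h1 h2

/-- Integration of bounded functions against finite measures is Lipschitz. -/
theorem lintegral_le_add_edist (x y : FiniteDensityMeasure lam) {φ : S → ℝ≥0∞}
    (hφ : Measurable φ) {c : ℝ≥0} (hc : ∀ t, φ t ≤ c) :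
    ∫⁻ t, φ t ∂x.toMeasure ≤ ∫⁻ t, φ t ∂y.toMeasure + c * edist x y := by
  rw [edist_eq_ofReal_tvDist]
  exact lintegral_le_add_tvDist _ _ hφ hc

/-- The measure with density `f` with respect to `x`. -/
def weight (x : FiniteDensityMeasure lam) (f : S → ℝ≥0∞) (hf : Measurable f) {R : ℝ≥0}
    (hR : ∀ t, f t ≤ R) : FiniteDensityMeasure lam :=
  ofDensity lam (fun t => x.dens t * f t) (x.measurable_dens.coe_nnreal_ennreal.mul hf) (by
    refine ne_top_of_le_ne_top
      (ENNReal.mul_ne_top x.lintegral_dens_ne_top (ENNReal.coe_ne_top (r := R))) ?_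
    rw [← lintegral_mul_const' _ _ ENNReal.coe_ne_top]
    exact lintegral_mono fun t => by gcongr; exact hR t)

theorem weight_toMeasure (x : FiniteDensityMeasure lam) {f : S → ℝ≥0∞} (hf : Measurable f)
    {R : ℝ≥0} (hR : ∀ t, f t ≤ R) :
    (x.weight f hf hR).toMeasure = x.toMeasure.withDensity f := by
  conv_rhs => rw [x.toMeasure_eq]
  exact withDensity_mul _ x.measurable_dens.coe_nnreal_ennreal hf

theorem weight_apply (x : FiniteDensityMeasure lam) {f : S → ℝ≥0∞} (hf : Measurable f)
    {R : ℝ≥0} (hR : ∀ t, f t ≤ R) {F : Set S} (hF : MeasurableSet F) :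
    (x.weight f hf hR).toMeasure F = ∫⁻ t, F.indicator f t ∂x.toMeasure := by
  rw [weight_toMeasure, withDensity_apply _ hF, lintegral_indicator hF]

theorem indicator_le_of_le {S : Type*} {f : S → ℝ≥0∞} {R : ℝ≥0} (hR : ∀ t, f t ≤ R)
    (F : Set S) (t : S) : F.indicator f t ≤ R :=
  (Set.indicator_le_self F f t).trans (hR t)

theorem edist_weight_le (x y : FiniteDensityMeasure lam) {f : S → ℝ≥0∞} (hf : Measurable f)
    {R : ℝ≥0} (hR : ∀ t, f t ≤ R) :
    edist (x.weight f hf hR) (y.weight f hf hR) ≤ 2 * (R * edist x y) := by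
  refine edist_le (fun F hF => ?_) fun F hF => ?_
  · rw [weight_apply _ _ _ hF, weight_apply _ _ _ hF]
    exact lintegral_le_add_edist x y (hf.indicator hF) (indicator_le_of_le hR F)
  · rw [weight_apply _ _ _ hF, weight_apply _ _ _ hF, edist_comm]
    exact lintegral_le_add_edist y x (hf.indicator hF) (indicator_le_of_le hR F)

end FiniteDensityMeasure

/-- A continuity condition on the emission density: if `a` and `b` are close, then the supports
of `q · a` and `q · b` differ by a set of small measure and the densities are uniformly close on
the common support. -/
def IsUniformlyContinuousEmission {S A : Type*} [MeasurableSpace S] [MetricSpace A]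
    (lam : Measure S) (q : S → A → ℝ≥0) : Prop :=
  ∀ ε : ℝ, 0 < ε → ∃ η : ℝ, 0 < η ∧ ∀ a b : A, dist a b < η →
    lam (symmDiff {t | 0 < q t a} {t | 0 < q t b}) < ENNReal.ofReal ε ∧
    ∀ t ∈ {t | 0 < q t a} ∩ {t | 0 < q t b}, |(q t a : ℝ) - (q t b : ℝ)| < ε

namespace DensityHMM

universe v

variable {S : Type*} {A : Type v} [MeasurableSpace S] [MeasurableSpace A] {H : DensityHMM S A}
  {R C : ℝ≥0} {q : S → A → ℝ≥0}

open FiniteDensityMeasure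

/-- The measure with density `q · a` with respect to `x`. -/
def emissionWeight (hq : H.IsEmission q) (hqR : ∀ t a, q t a ≤ R) (x : FiniteDensityMeasure H.lam)
    (a : A) : FiniteDensityMeasure H.lam :=
  x.weight (fun t => q t a) (hq.measurable_left a).coe_nnreal_ennreal (R := R)
    fun t => ENNReal.coe_le_coe.2 (hqR t a)

theorem emissionWeight_toMeasure (hq : H.IsEmission q) (hqR : ∀ t a, q t a ≤ R)
    (x : FiniteDensityMeasure H.lam) (a : A) : (emissionWeight hq hqR x a).toMeasure =
      x.toMeasure.withDensity fun t => (q t a : ℝ≥0∞) := weight_toMeasure _ _ _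

/-- The effect of a change of the observation on the weighted measure. -/
theorem edist_emissionWeight_le (hq : H.IsEmission q) (hqR : ∀ t a, q t a ≤ R)
    (x : FiniteDensityMeasure H.lam) {a b : A} {ε : ℝ}
    (h : ∀ t ∈ {t | 0 < q t a} ∩ {t | 0 < q t b}, |(q t a : ℝ) - (q t b : ℝ)| < ε) :
    edist (emissionWeight hq hqR x a) (emissionWeight hq hqR x b) ≤
      2 * (ENNReal.ofReal ε * x.toMeasure Set.univ +
        R * x.toMeasure (symmDiff {t | 0 < q t a} {t | 0 < q t b})) := by
  have hW : ∀ a, MeasurableSet {t | 0 < q t a} := fun a =>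
    measurableSet_lt measurable_const (hq.measurable_left a)
  have key : ∀ a b : A,
      (∀ t ∈ {t | 0 < q t a} ∩ {t | 0 < q t b}, |(q t a : ℝ) - (q t b : ℝ)| < ε) →
      ∀ F, MeasurableSet F → (emissionWeight hq hqR x a).toMeasure F ≤
        (emissionWeight hq hqR x b).toMeasure F + (ENNReal.ofReal ε * x.toMeasure Set.univ +
          R * x.toMeasure (symmDiff {t | 0 < q t a} {t | 0 < q t b})) := by
    intro a b h F hF
    set D := symmDiff {t | 0 < q t a} {t | 0 < q t b} with hD
    have hDm : MeasurableSet D := (hW a).symmDiff (hW b)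
    have hpt : ∀ t, F.indicator (fun t => (q t a : ℝ≥0∞)) t ≤
        F.indicator (fun t => (q t b : ℝ≥0∞)) t +
          (ENNReal.ofReal ε + D.indicator (fun _ => (R : ℝ≥0∞)) t) := by
      intro t
      by_cases hF : t ∈ F
      · rw [Set.indicator_of_mem hF, Set.indicator_of_mem hF]
        by_cases ha : 0 < q t a
        · by_cases hb : 0 < q t b
          · have h1 : (q t a : ℝ) ≤ q t b + ε := by
              linarith [(abs_lt.1 (h t ⟨ha, hb⟩)).2]
            have hε : 0 ≤ ε := (abs_nonneg _).trans (h t ⟨ha, hb⟩).le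
            have h2 : (q t a : ℝ≥0∞) ≤ q t b + ENNReal.ofReal ε := by
              rw [← ENNReal.ofReal_coe_nnreal, ← ENNReal.ofReal_coe_nnreal (p := q t b),
                ← ENNReal.ofReal_add (NNReal.coe_nonneg _) hε]
              exact ENNReal.ofReal_le_ofReal h1
            refine h2.trans ?_
            gcongr
            exact le_self_add
          · have : t ∈ D := Or.inl ⟨ha, hb⟩
            rw [Set.indicator_of_mem this]
            exact (ENNReal.coe_le_coe.2 (hqR t a)).trans (le_add_self.trans le_add_self)
        · have : q t a = 0 := nonpos_iff_eq_zero.1 (not_lt.1 ha)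
          rw [this, ENNReal.coe_zero]
          exact zero_le
      · rw [Set.indicator_of_notMem hF]
        exact zero_le
    rw [emissionWeight, weight_apply _ _ _ hF, emissionWeight, weight_apply _ _ _ hF]
    refine (lintegral_mono hpt).trans (le_of_eq ?_)
    rw [lintegral_add_left ((hq.measurable_left b).coe_nnreal_ennreal.indicator hF),
      lintegral_add_left measurable_const, lintegral_const, lintegral_indicator_const hDm]
  refine edist_le (key a b h) fun F hF => ?_
  rw [symmDiff_comm]
  refine key b a (fun t ht => ?_) F hF
  rw [abs_sub_comm]
  exact h t ⟨ht.2, ht.1⟩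

theorem continuous_emissionWeight [MetricSpace A] (hq : H.IsEmission q)
    (hqR : ∀ t a, q t a ≤ R) (hc : IsUniformlyContinuousEmission H.lam q) :
    Continuous fun z : FiniteDensityMeasure H.lam × A => emissionWeight hq hqR z.1 z.2 := by
  rw [continuous_iff_continuousAt]
  rintro ⟨x, a⟩
  have h1 : Tendsto (fun z : FiniteDensityMeasure H.lam × A => 2 * (R * edist z.1 x))
      (𝓝 (x, a)) (𝓝 0) := by
    have h0 : Tendsto (fun z : FiniteDensityMeasure H.lam × A => edist z.1 x) (𝓝 (x, a))
        (𝓝 0) := by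
      have := (tendsto_iff_edist_tendsto_0.1 (continuous_fst.tendsto (x, a)))
      exact this
    have h2 := ENNReal.Tendsto.const_mul (a := (2 : ℝ≥0∞) * R) h0
      (Or.inr (ENNReal.mul_ne_top (by norm_num) ENNReal.coe_ne_top))
    simpa [mul_assoc] using h2
  -- the symmetric difference of the supports is small for `λ`, hence for `x` by absolute continuity
  have h2 : Tendsto (fun z : FiniteDensityMeasure H.lam × A =>
      edist (emissionWeight hq hqR x z.2) (emissionWeight hq hqR x a)) (𝓝 (x, a)) (𝓝 0) := by
    rw [ENNReal.tendsto_nhds_zero]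
    intro ε hε
    obtain ⟨e, he, hle⟩ := exists_ofReal_mul_le
      (K := 2 * (x.toMeasure Set.univ + R)) (by finiteness) hε
    obtain ⟨δ, hδ, hac⟩ := exists_pos_setLIntegral_lt_of_measure_lt x.lintegral_dens_ne_top
      (ENNReal.ofReal_pos.2 he).ne'
    obtain ⟨d, hd, hdδ⟩ : ∃ d : ℝ, 0 < d ∧ ENNReal.ofReal d ≤ δ := by
      obtain ⟨d, hd, hdle⟩ := exists_ofReal_mul_le (K := 1) (by simp) hδ
      exact ⟨d, hd, by simpa using hdle⟩
    obtain ⟨η, hη, hcl⟩ := hc (min e d) (lt_min he hd)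
    have hev : ∀ᶠ z : FiniteDensityMeasure H.lam × A in 𝓝 (x, a), dist z.2 a < η :=
      (continuous_snd.tendsto (x, a)).eventually (Metric.ball_mem_nhds a hη)
    filter_upwards [hev] with z hz
    obtain ⟨c1, c2⟩ := hcl z.2 a hz
    have hW : ∀ a, MeasurableSet {t | 0 < q t a} := fun a =>
      measurableSet_lt measurable_const (hq.measurable_left a)
    have c3 : x.toMeasure (symmDiff {t | 0 < q t z.2} {t | 0 < q t a}) ≤ ENNReal.ofReal e := by
      rw [x.toMeasure_eq, withDensity_apply _ ((hW _).symmDiff (hW _))]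
      exact (hac _ (c1.trans_le
        ((ENNReal.ofReal_le_ofReal (min_le_right _ _)).trans hdδ))).le
    calc _ ≤ 2 * (ENNReal.ofReal e * x.toMeasure Set.univ +
          R * x.toMeasure (symmDiff {t | 0 < q t z.2} {t | 0 < q t a})) :=
          edist_emissionWeight_le hq hqR x fun t ht => (c2 t ht).trans_le (min_le_left _ _)
      _ ≤ 2 * (ENNReal.ofReal e * x.toMeasure Set.univ + R * ENNReal.ofReal e) := by gcongr
      _ = ENNReal.ofReal e * (2 * (x.toMeasure Set.univ + R)) := by ring
      _ ≤ ε := hle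
  have h3 := h1.add h2
  rw [add_zero] at h3
  refine tendsto_iff_edist_tendsto_0.2 (tendsto_of_tendsto_of_tendsto_of_le_of_le
    tendsto_const_nhds h3 (fun _ => zero_le) fun z => ?_)
  exact (edist_triangle _ (emissionWeight hq hqR x z.2) _).trans
    (add_le_add_left (edist_weight_le _ _ _ _) _)

variable (H) in
/-- The finite measure with density `t ↦ ∫ p s t μ(ds)`, that is the image of the finite measure
`μ` under the Markov kernel. -/
def predictFinite (μ : Measure S) [IsFiniteMeasure μ] : FiniteDensityMeasure H.lam :=
  ofDensity H.lam (fun t => ∫⁻ s, (H.p s t : ℝ≥0∞) ∂μ) (H.measurable_lintegral_p _) (by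
    have h := H.lintegral_lintegral_p μ (φ := fun _ => 1) measurable_const
    simp only [mul_one] at h
    rw [h]
    simp)

theorem lintegral_predictFinite (μ : Measure S) [IsFiniteMeasure μ] {φ : S → ℝ≥0∞}
    (hφ : Measurable φ) : ∫⁻ t, φ t ∂(H.predictFinite μ).toMeasure =
      ∫⁻ s, ∫⁻ t, φ t ∂H.markovKernel s ∂μ := by
  rw [← H.lintegral_lintegral_p _ hφ]
  exact lintegral_withDensity_eq_lintegral_mul _ (H.measurable_lintegral_p _) hφ

theorem predictFinite_apply (μ : Measure S) [IsFiniteMeasure μ] {F : Set S}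
    (hF : MeasurableSet F) : (H.predictFinite μ).toMeasure F = ∫⁻ s, H.markovKernel s F ∂μ := by
  have h := H.lintegral_predictFinite μ (measurable_one.indicator hF)
  simpa [lintegral_indicator_one hF] using h

theorem continuous_predictFinite :
    Continuous fun x : FiniteDensityMeasure H.lam => H.predictFinite x.toMeasure := by
  have key : ∀ (x y : FiniteDensityMeasure H.lam) (F : Set S), MeasurableSet F →
      (H.predictFinite x.toMeasure).toMeasure F ≤
        (H.predictFinite y.toMeasure).toMeasure F + edist x y := by
    intro x y F hF
    rw [predictFinite_apply _ hF, predictFinite_apply _ hF]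
    have h := lintegral_le_add_edist x y (Kernel.measurable_coe H.markovKernel hF) (c := 1)
      fun s => by simpa using prob_le_one
    simpa using h
  refine LipschitzWith.continuous (K := 2) fun x y => ?_
  refine edist_le (key x y) fun F hF => ?_
  rw [edist_comm]
  exact key y x F hF

theorem IsEmission.stepMeasure_eq (hq : H.IsEmission q) (hqR : ∀ t a, q t a ≤ R)
    (x : FiniteDensityMeasure H.lam) (a : A) : H.stepMeasure x a =
      (emissionWeight hq hqR (H.predictFinite x.toMeasure) a).toMeasure := by
  rw [emissionWeight_toMeasure]
  change H.step x.toMeasure a = (H.lam.withDensity _).withDensity _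
  rw [← withDensity_mul _ (H.measurable_lintegral_p _)
    (hq.measurable_left a).coe_nnreal_ennreal, step]
  congr 1
  funext t
  exact hq.stepDens_eq _ a t

/-- The step `x M_a` is the prediction of the next state, weighted with the emission density; both
operations are continuous. -/
theorem IsEmission.isRegular [MetricSpace A] (hq : H.IsEmission q)
    (hqR : ∀ t a, q t a ≤ R) (hc : IsUniformlyContinuousEmission H.lam q) : H.IsRegular := by
  refine ⟨fun z => emissionWeight hq hqR (H.predictFinite z.1.toMeasure) z.2, ?_,
    fun x a => (hq.stepMeasure_eq hqR x a).symm⟩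
  have h : Continuous fun z : FiniteDensityMeasure H.lam × A =>
      (H.predictFinite z.1.toMeasure, z.2) :=
    (continuous_predictFinite.comp continuous_fst).prodMk continuous_snd
  have hg := continuous_emissionWeight hq hqR hc
  generalize emissionWeight hq hqR = Φ at hg ⊢
  exact Continuous.comp (g := fun z : FiniteDensityMeasure H.lam × A => Φ z.1 z.2) hg h

theorem IsEmission.isBoundedBy (hq : H.IsEmission q) {Cp Cq : ℝ≥0} (hp : ∀ s t, H.p s t ≤ Cp)
    (hqC : ∀ t a, q t a ≤ Cq) : H.IsBoundedBy (max (Cp * Cq) Cq) := by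
  refine ⟨fun s t a => ?_, fun s a => ?_⟩
  · rw [hq.eq_mul]
    exact (mul_le_mul' (hp s t) (hqC t a)).trans (le_max_left _ _)
  · calc ∫⁻ t, (H.m s t a : ℝ≥0∞) ∂H.lam ≤ ∫⁻ t, H.p s t * (Cq : ℝ≥0∞) ∂H.lam := by
          refine lintegral_mono fun t => ?_
          rw [hq.eq_mul, ENNReal.coe_mul]
          gcongr
          exact hqC t a
      _ = Cq := by rw [lintegral_mul_const _ (H.measurable_p_right s), H.lintegral_p, one_mul]
      _ ≤ _ := ENNReal.coe_le_coe.2 (le_max_right _ _)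

theorem IsEmission.isMinorizedOn (hq : H.IsEmission q) {F₀ : Set S} (hF₀ : MeasurableSet F₀)
    {B₀ : Set A} (hB₀ : MeasurableSet B₀) (hsub : ∀ a ∈ B₀, {t | 0 < q t a} ⊆ F₀) {β c₀ c₁ : ℝ}
    (hβ : ∀ a ∈ B₀, ENNReal.ofReal β ≤ H.lam {t | 0 < q t a}) (hc₁ : 0 < c₁)
    (hc : ∀ a ∈ B₀, {t | 0 < q t a ∧ (q t a : ℝ) < c₀} = ∅)
    (hp : ∀ s ∈ F₀, ∀ t ∈ F₀, c₁ ≤ (H.p s t : ℝ)) :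
    H.IsMinorizedOn F₀ B₀ (fun a => {t | 0 < q t a}) (ENNReal.ofReal (c₁ * c₀))
      (ENNReal.ofReal β) where
  measurableSet_left := hF₀
  measurableSet_right := hB₀
  measurableSet_support a := measurableSet_lt measurable_const (hq.measurable_left a)
  eq_zero a _ t ht s := by
    have h0 : q t a = 0 := nonpos_iff_eq_zero.1 (not_lt.1 ht)
    rw [hq.eq_mul, h0, mul_zero]
  subset := hsub
  le a ha t ht s hs := by
    have h0 : c₀ ≤ q t a := by
      by_contra h
      exact (Set.eq_empty_iff_forall_notMem.1 (hc a ha)) t ⟨ht, not_le.1 h⟩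
    have h1 := hp s hs t (hsub a ha ht)
    rw [hq.eq_mul, ← ENNReal.ofReal_coe_nnreal, NNReal.coe_mul]
    exact ENNReal.ofReal_le_ofReal ((mul_le_mul_of_nonneg_left h0 hc₁.le).trans
      (mul_le_mul_of_nonneg_right h1 (NNReal.coe_nonneg _)))
  mass_le := hβ

end DensityHMM

/-! ### Criteria for tightness and the mean of the filter -/

/-- A sequence of finite measures on a complete separable metric space is tight if almost all of
its members are, up to a small mass, carried by a small neighbourhood of a compact set. The
compact set may lie in a larger space. -/
theorem isTightMeasureSet_range_of_infEDist {Y E : Type*} [MetricSpace Y] [CompleteSpace Y]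
    [SecondCountableTopology Y] [MeasurableSpace Y] [BorelSpace Y] [MetricSpace E] {ι : Y → E}
    (hι : Isometry ι) {μ : ℕ → Measure Y} [∀ n, IsFiniteMeasure (μ n)]
    (h : ∀ ε : ℝ≥0∞, 0 < ε → ∀ δ : ℝ≥0∞, 0 < δ → ∃ D : Set E, IsCompact D ∧
      ∀ᶠ n in atTop, μ n {y | δ < Metric.infEDist (ι y) D} ≤ ε) :
    IsTightMeasureSet (Set.range μ) := by
  -- the finitely many exceptional measures are tight by themselves
  have hall : ∀ ε : ℝ≥0∞, 0 < ε → ∀ δ : ℝ≥0∞, 0 < δ → ∃ D : Set E, IsCompact D ∧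
      ∀ n, μ n {y | δ < Metric.infEDist (ι y) D} ≤ ε := by
    intro ε hε δ hδ
    obtain ⟨D, hD, hev⟩ := h ε hε δ hδ
    obtain ⟨N, hN⟩ := eventually_atTop.1 hev
    have hn : ∀ n, ∃ G : Set Y, IsCompact G ∧ μ n Gᶜ ≤ ε := fun n => by
      obtain ⟨G, hG, hle⟩ := isTightMeasureSet_iff_exists_isCompact_measure_compl_le.1
        (isTightMeasureSet_singleton (μ := μ n)) ε hε
      exact ⟨G, hG, hle _ rfl⟩
    choose G hG hGle using hn
    refine ⟨D ∪ ⋃ n ∈ Finset.range N, ι '' G n, hD.union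
      ((Finset.range N).isCompact_biUnion fun n _ => (hG n).image hι.continuous), fun n => ?_⟩
    rcases le_or_gt N n with hNn | hNn
    · refine (measure_mono fun y hy => ?_).trans (hN n hNn)
      exact hy.trans_le (Metric.infEDist_anti Set.subset_union_left)
    · refine (measure_mono fun y hy hyG => ?_).trans (hGle n)
      have hmem : ι y ∈ D ∪ ⋃ n ∈ Finset.range N, ι '' G n :=
        Or.inr (Set.mem_biUnion (Finset.mem_coe.2 (Finset.mem_range.2 hNn)) ⟨y, hyG, rfl⟩)
      have hy' : δ < Metric.infEDist (ι y) (D ∪ ⋃ n ∈ Finset.range N, ι '' G n) := hy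
      rw [Metric.infEDist_zero_of_mem hmem] at hy'
      exact absurd hy' (not_lt.2 zero_le)
  -- the intersection of the neighbourhoods for radii `1 / (j + 1)` is totally bounded
  rw [isTightMeasureSet_iff_exists_isCompact_measure_compl_le]
  intro ε hε
  obtain ⟨e, he, hesum⟩ := ENNReal.exists_pos_sum_of_countable' hε.ne' ℕ
  choose D hD hDle using fun j : ℕ => hall (e j) (he j) (((j : ℝ≥0∞) + 1)⁻¹) (by simp)
  have htb : TotallyBounded (⋂ j : ℕ, {z : E | Metric.infEDist z (D j) ≤ ((j : ℝ≥0∞) + 1)⁻¹}) := by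
    rw [EMetric.totallyBounded_iff]
    intro r hr
    have hr2 : 0 < r / 2 := ENNReal.half_pos hr.ne'
    obtain ⟨j, hj⟩ : ∃ j : ℕ, ((j : ℝ≥0∞) + 1)⁻¹ < r / 2 := by
      obtain ⟨j, hj⟩ := ENNReal.exists_inv_nat_lt hr2.ne'
      exact ⟨j, lt_of_le_of_lt (ENNReal.inv_le_inv.2 le_self_add) hj⟩
    obtain ⟨t, ht, hcov⟩ := EMetric.totallyBounded_iff.1 (hD j).totallyBounded _ hr2
    refine ⟨t, ht, fun z hz => ?_⟩
    have h1 : Metric.infEDist z (D j) < r / 2 := (Set.mem_iInter.1 hz j).trans_lt hj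
    obtain ⟨d, hd, hzd⟩ := Metric.infEDist_lt_iff.1 h1
    obtain ⟨c, hc, hdc⟩ := Set.mem_iUnion₂.1 (hcov hd)
    refine Set.mem_iUnion₂.2 ⟨c, hc, ?_⟩
    calc edist z c ≤ edist z d + edist d c := edist_triangle _ _ _
      _ < r / 2 + r / 2 := ENNReal.add_lt_add hzd hdc
      _ = r := ENNReal.add_halves r
  have hclosed : IsClosed (ι ⁻¹' ⋂ j : ℕ,
      {z : E | Metric.infEDist z (D j) ≤ ((j : ℝ≥0∞) + 1)⁻¹}) :=
    (isClosed_iInter fun j => isClosed_le Metric.continuous_infEDist continuous_const).preimage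
      hι.continuous
  refine ⟨_, (totallyBounded_preimage hι.isUniformInducing htb).isCompact_of_isClosed hclosed, ?_⟩
  rintro _ ⟨n, rfl⟩
  have e1 : (ι ⁻¹' ⋂ j : ℕ, {z : E | Metric.infEDist z (D j) ≤ ((j : ℝ≥0∞) + 1)⁻¹})ᶜ =
      ⋃ j : ℕ, {y | ((j : ℝ≥0∞) + 1)⁻¹ < Metric.infEDist (ι y) (D j)} := by
    ext y
    simp only [Set.mem_compl_iff, Set.mem_preimage, Set.mem_iInter, Set.mem_ofPred_eq, not_forall,
      not_le, Set.mem_iUnion]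
  rw [e1]
  exact (measure_iUnion_le _).trans ((ENNReal.tsum_le_tsum fun j => hDle j n).trans hesum.le)

theorem exists_measure_compl_lt {X : Type*} [MeasurableSpace X] (μ : Measure X)
    [IsFiniteMeasure μ] {U : ℕ → Set X} (hU : ∀ n, MeasurableSet (U n)) (hmono : Monotone U)
    (huniv : ⋃ n, U n = Set.univ) {ε : ℝ≥0∞} (hε : 0 < ε) : ∃ n, μ (U n)ᶜ < ε := by
  have h := tendsto_measure_iInter_atTop (μ := μ) (s := fun n => (U n)ᶜ)
    (fun n => (hU n).compl.nullMeasurableSet)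
    (fun m n hmn => Set.compl_subset_compl.2 (hmono hmn)) ⟨0, measure_ne_top _ _⟩
  rw [← Set.compl_iUnion, huniv, Set.compl_univ, measure_empty] at h
  exact ((h.eventually (gt_mem_nhds hε))).exists

/-- A probability density with respect to a σ-finite measure is, up to a small mass, carried by a
subset of a compact set with finite measure. -/
theorem exists_measurableSet_subset_isCompact {A : Type*} [MetricSpace A] [CompleteSpace A]
    [SecondCountableTopology A] [MeasurableSpace A] [BorelSpace A] (tau : Measure A)
    [SigmaFinite tau] (α : Measure A) [IsFiniteMeasure α] {ε : ℝ≥0∞} (hε : 0 < ε) :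
    ∃ G B : Set A, IsCompact G ∧ MeasurableSet B ∧ B ⊆ G ∧ tau B ≠ ∞ ∧ α Bᶜ < ε := by
  have hε2 : 0 < ε / 2 := ENNReal.half_pos hε.ne'
  obtain ⟨n, hn⟩ := exists_measure_compl_lt α (measurableSet_spanningSets tau)
    (monotone_spanningSets tau) (iUnion_spanningSets tau) hε2
  obtain ⟨G, hG, hGle⟩ := isTightMeasureSet_iff_exists_isCompact_measure_compl_le.1
    (isTightMeasureSet_singleton (μ := α)) (ε / 2) hε2
  refine ⟨G, G ∩ spanningSets tau n, hG, hG.measurableSet.inter (measurableSet_spanningSets tau n),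
    Set.inter_subset_left, ne_top_of_le_ne_top (measure_spanningSets_lt_top tau n).ne
      (measure_mono Set.inter_subset_right), ?_⟩
  rw [Set.compl_inter]
  calc _ ≤ α Gᶜ + α (spanningSets tau n)ᶜ := measure_union_le _ _
    _ < ε / 2 + ε / 2 := by
        have h1 := hGle α rfl
        exact ENNReal.add_lt_add_of_le_of_lt (measure_ne_top _ _) h1 hn
    _ = ε := ENNReal.add_halves ε

theorem measurable_toMeasure {S : Type*} [MeasurableSpace S] {lam : Measure S} :
    Measurable fun x : DensityProbability lam => x.1.toMeasure :=
  Measure.measurable_of_measurable_coe _ fun _ hF => measurable_apply_toMeasure hF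

theorem measurable_lintegral_toMeasure {S : Type*} [MeasurableSpace S] {lam : Measure S}
    {φ : S → ℝ≥0∞} (hφ : Measurable φ) :
    Measurable fun x : DensityProbability lam => ∫⁻ s, φ s ∂x.1.toMeasure :=
  (Measure.measurable_lintegral hφ).comp measurable_toMeasure

namespace DensityHMM

universe v

variable {S : Type*} {A : Type v} [MeasurableSpace S] [MeasurableSpace A] {H : DensityHMM S A}
  {R C : ℝ≥0} {q : S → A → ℝ≥0}

open FiniteDensityMeasure

instance (m : ℕ) (b : Fin m → ℝ≥0) (s : Fin m → S) :
    IsFiniteMeasure (∑ i, b i • Measure.dirac (s i)) := by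
  refine ⟨?_⟩
  simp only [Measure.coe_finsetSum, Finset.sum_apply, Measure.smul_apply, measure_univ]
  exact ENNReal.sum_lt_top.2 fun i _ => by
    rw [ENNReal.smul_def, smul_eq_mul, mul_one]
    exact ENNReal.coe_lt_top

theorem lintegral_sum_dirac {m : ℕ} (b : Fin m → ℝ≥0) (s : Fin m → S) {φ : S → ℝ≥0∞}
    (hφ : Measurable φ) :
    ∫⁻ t, φ t ∂(∑ i, b i • Measure.dirac (s i)) = ∑ i, b i * φ (s i) := by
  rw [lintegral_finsetSum_measure]
  refine Finset.sum_congr rfl fun i _ => ?_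
  rw [lintegral_smul_measure, lintegral_dirac' _ hφ]
  rfl

theorem coe_le_add_edist (a b : ℝ≥0) : (a : ℝ≥0∞) ≤ b + edist a b := by
  rw [edist_nndist, ← ENNReal.coe_add, ENNReal.coe_le_coe, NNReal.nndist_eq]
  exact le_add_tsub.trans (by gcongr; exact le_max_left _ _)

theorem continuous_predictFinite_sum_dirac {m : ℕ} (s : Fin m → S) :
    Continuous fun b : Fin m → ℝ≥0 => H.predictFinite (∑ i, b i • Measure.dirac (s i)) := by
  have key : ∀ (b c : Fin m → ℝ≥0) (F : Set S), MeasurableSet F →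
      (H.predictFinite (∑ i, b i • Measure.dirac (s i))).toMeasure F ≤
        (H.predictFinite (∑ i, c i • Measure.dirac (s i))).toMeasure F + m * edist b c := by
    intro b c F hF
    rw [predictFinite_apply _ hF, predictFinite_apply _ hF,
      lintegral_sum_dirac _ _ (Kernel.measurable_coe _ hF),
      lintegral_sum_dirac _ _ (Kernel.measurable_coe _ hF)]
    calc _ ≤ ∑ i, (c i * H.markovKernel (s i) F + edist b c) := by
          refine Finset.sum_le_sum fun i _ => ?_
          calc _ ≤ ((c i : ℝ≥0∞) + edist (b i) (c i)) * H.markovKernel (s i) F := by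
                gcongr
                exact coe_le_add_edist _ _
            _ ≤ c i * H.markovKernel (s i) F + edist b c * 1 := by
                rw [add_mul]
                gcongr
                · exact edist_le_pi_edist b c i
                · exact prob_le_one
            _ = _ := by rw [mul_one]
      _ = _ := by rw [Finset.sum_add_distrib]; simp
  refine LipschitzWith.continuous (K := 2 * m) fun b c => ?_
  push_cast
  rw [mul_assoc]
  refine edist_le (key b c) fun F hF => ?_
  rw [edist_comm]
  exact key c b F hF

theorem tendsto_lintegral_predict_iterate {π : Measure S}
    (hπ : StronglyErgodicWith H.markovKernel π) (x : DensityProbability H.lam) {φ : S → ℝ≥0∞}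
    (hφ : Measurable φ) (hφ1 : ∀ s, φ s ≤ 1) :
    Tendsto (fun n => ∫⁻ s, φ s ∂(predict^[n] x).1.toMeasure) atTop (𝓝 (∫⁻ s, φ s ∂π)) := by
  have h := hπ.tendsto_lintegral_lintegral x.1.toMeasure hφ hφ1
  simp_rw [lintegral_predict_iterate x hφ]
  rwa [x.2, one_mul] at h

/-- If the state space is partitioned into cells on which the transition probabilities vary little,
then the filter update of `w` is, up to a small error, determined by the observation and the masses
of the cells. -/
theorem edist_filterUpdate_le [TopologicalSpace A] (hq : H.IsEmission q) (hqR : ∀ t a, q t a ≤ R)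
    (hreg : H.IsRegular) {P : ℕ → Set S} (hP : ∀ i, MeasurableSet (P i))
    (hdisj : Pairwise fun i j => Disjoint (P i) (P j)) (s : ℕ → S) {ε : ℝ≥0∞}
    (hs : ∀ i, ∀ t ∈ P i,
      ENNReal.ofReal (tvDist (H.markovKernel t) (H.markovKernel (s i))) ≤ ε) (m : ℕ)
    (w : DensityProbability H.lam) (a : A) (h0 : H.obsDensity w a ≠ 0) :
    edist (H.filterUpdate w a).1 (emissionWeight hq hqR (H.predictFinite
        (∑ i : Fin m, ((H.obsDensity w a)⁻¹ * w.1.toMeasure (P i)).toNNReal •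
          Measure.dirac (s i))) a) ≤
      2 * ((H.obsDensity w a)⁻¹ *
        (R * (ε + w.1.toMeasure (⋃ i : Fin m, P i)ᶜ))) := by
  set κ := (H.obsDensity w a)⁻¹ with hκ
  have hκtop : κ ≠ ∞ := ENNReal.inv_ne_top.2 h0
  set U : Set S := ⋃ i : Fin m, P i with hU
  have hUm : MeasurableSet U := MeasurableSet.iUnion fun i => hP i
  have hb : ∀ i, ((κ * w.1.toMeasure (P i)).toNNReal : ℝ≥0∞) = κ * w.1.toMeasure (P i) :=
    fun i => ENNReal.coe_toNNReal (ENNReal.mul_ne_top hκtop (measure_ne_top _ _))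
  have hqm : Measurable fun t => (q t a : ℝ≥0∞) := (hq.measurable_left a).coe_nnreal_ennreal
  have hqle : ∀ t, (q t a : ℝ≥0∞) ≤ R := fun t => ENNReal.coe_le_coe.2 (hqR t a)
  have hdisj' : Pairwise fun i j : Fin m => Disjoint (P i) (P j) := fun i j hij =>
    hdisj fun h => hij (Fin.ext h)
  have hsum : ∑ i : Fin m, w.1.toMeasure (P i) ≤ 1 := by
    have h := measure_iUnion (μ := w.1.toMeasure) hdisj' fun i => hP i
    rw [tsum_fintype] at h
    rw [← h]
    exact prob_le_one
  have e1 : ∀ F, MeasurableSet F → (H.filterUpdate w a).1.toMeasure F =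
      κ * ∫⁻ t, ∫⁻ z, F.indicator (fun z => (q z a : ℝ≥0∞)) z ∂H.markovKernel t
        ∂w.1.toMeasure := by
    intro F hF
    rw [filterUpdate_toMeasure H w a h0 (hreg.obsDensity_ne_top w a), Measure.smul_apply,
      smul_eq_mul, hq.stepMeasure_eq hqR, emissionWeight, weight_apply _ _ _ hF,
      lintegral_predictFinite _ (hqm.indicator hF)]
  have e2 : ∀ F, MeasurableSet F → (emissionWeight hq hqR (H.predictFinite
        (∑ i : Fin m, (κ * w.1.toMeasure (P i)).toNNReal • Measure.dirac (s i))) a).toMeasure F =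
      ∑ i : Fin m, κ * w.1.toMeasure (P i) *
        ∫⁻ z, F.indicator (fun z => (q z a : ℝ≥0∞)) z ∂H.markovKernel (s i) := by
    intro F hF
    rw [emissionWeight, weight_apply _ _ _ hF, lintegral_predictFinite _ (hqm.indicator hF),
      lintegral_sum_dirac _ _ (hqm.indicator hF).lintegral_kernel]
    simp_rw [hb]
  have hκR : κ * (R * ε) ≤ κ * (R * (ε + w.1.toMeasure Uᶜ)) := by
    gcongr
    exact le_self_add
  have hvar : ∀ F, MeasurableSet F → ∀ i, ∀ t ∈ P i,
      ∫⁻ z, F.indicator (fun z => (q z a : ℝ≥0∞)) z ∂H.markovKernel t ≤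
        ∫⁻ z, F.indicator (fun z => (q z a : ℝ≥0∞)) z ∂H.markovKernel (s i) + R * ε ∧
      ∫⁻ z, F.indicator (fun z => (q z a : ℝ≥0∞)) z ∂H.markovKernel (s i) ≤
        ∫⁻ z, F.indicator (fun z => (q z a : ℝ≥0∞)) z ∂H.markovKernel t + R * ε := by
    intro F hF i t ht
    have h := hs i t ht
    constructor
    · refine (lintegral_le_add_tvDist (H.markovKernel t) (H.markovKernel (s i))
        (hqm.indicator hF) (indicator_le_of_le hqle F)).trans ?_
      gcongr
    · rw [tvDist_comm] at h
      refine (lintegral_le_add_tvDist (H.markovKernel (s i)) (H.markovKernel t)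
        (hqm.indicator hF) (indicator_le_of_le hqle F)).trans ?_
      gcongr
  refine edist_le (fun F hF => ?_) fun F hF => ?_
  · rw [e1 F hF, e2 F hF]
    set ψ : S → ℝ≥0∞ := fun t => ∫⁻ z, F.indicator (fun z => (q z a : ℝ≥0∞)) z ∂H.markovKernel t
    have hψR : ∀ t, ψ t ≤ R := fun t => by
      refine (lintegral_mono (indicator_le_of_le hqle F)).trans ?_
      simp
    calc κ * ∫⁻ t, ψ t ∂w.1.toMeasure
        = κ * (∑ i : Fin m, ∫⁻ t in P i, ψ t ∂w.1.toMeasure +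
            ∫⁻ t in Uᶜ, ψ t ∂w.1.toMeasure) := by
          rw [← lintegral_add_compl ψ hUm, hU, lintegral_iUnion (fun i : Fin m => hP i) hdisj',
            tsum_fintype]
      _ ≤ κ * (∑ i : Fin m, (ψ (s i) + R * ε) * w.1.toMeasure (P i) +
            R * w.1.toMeasure Uᶜ) := by
          gcongr with i
          · refine (setLIntegral_mono' (hP i) fun t ht => (hvar F hF i t ht).1).trans ?_
            rw [setLIntegral_const]
          · refine (lintegral_mono hψR).trans ?_
            rw [setLIntegral_const]
      _ = ∑ i : Fin m, κ * w.1.toMeasure (P i) * ψ (s i) +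
            κ * (R * ε * ∑ i : Fin m, w.1.toMeasure (P i) + R * w.1.toMeasure Uᶜ) := by
          simp_rw [add_mul, Finset.sum_add_distrib, mul_add, ← Finset.mul_sum]
          rw [add_assoc]
          congr 1
          rw [Finset.mul_sum]
          exact Finset.sum_congr rfl fun i _ => by ring
      _ ≤ ∑ i : Fin m, κ * w.1.toMeasure (P i) * ψ (s i) +
            κ * (R * ε * 1 + R * w.1.toMeasure Uᶜ) := by gcongr
      _ = _ := by ring
  · rw [e1 F hF, e2 F hF]
    set ψ : S → ℝ≥0∞ := fun t => ∫⁻ z, F.indicator (fun z => (q z a : ℝ≥0∞)) z ∂H.markovKernel t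
    calc ∑ i : Fin m, κ * w.1.toMeasure (P i) * ψ (s i)
        = κ * ∑ i : Fin m, ∫⁻ _ in P i, ψ (s i) ∂w.1.toMeasure := by
          rw [Finset.mul_sum]
          refine Finset.sum_congr rfl fun i _ => ?_
          rw [setLIntegral_const]
          ring
      _ ≤ κ * ∑ i : Fin m, ∫⁻ t in P i, (ψ t + R * ε) ∂w.1.toMeasure :=
          mul_le_mul' le_rfl (Finset.sum_le_sum fun i _ =>
            setLIntegral_mono' (hP i) fun t ht => (hvar F hF i t ht).2)
      _ = κ * ∫⁻ t in U, (ψ t + R * ε) ∂w.1.toMeasure := by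
          rw [hU, lintegral_iUnion (fun i : Fin m => hP i) hdisj', tsum_fintype]
      _ ≤ κ * ∫⁻ t, (ψ t + R * ε) ∂w.1.toMeasure := by
          gcongr
          exact Measure.restrict_le_self
      _ = κ * ∫⁻ t, ψ t ∂w.1.toMeasure + κ * (R * ε) := by
          rw [lintegral_add_right _ measurable_const, lintegral_const, measure_univ, mul_one,
            mul_add]
      _ ≤ _ := by gcongr

section FilterKernel

variable [MetricSpace A] [SecondCountableTopology A] [BorelSpace A]

/-- One step of the filter does not change the mean of the filter except for the transition of the
hidden chain. -/
theorem lintegral_lintegral_filterKernel (hreg : H.IsRegular) (x : DensityProbability H.lam)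
    {φ : S → ℝ≥0∞} (hφ : Measurable φ) :
    ∫⁻ y, ∫⁻ s, φ s ∂y.1.toMeasure ∂(H.filterKernel hreg x) =
      ∫⁻ s, φ s ∂(predict x).1.toMeasure := by
  rw [lintegral_filterKernel hreg x (measurable_lintegral_toMeasure hφ), lintegral_predict x hφ]
  have e := H.lintegral_lintegral_step x.1.toMeasure (φ := fun t _ => φ t)
    (hφ.comp measurable_fst)
  simp_rw [lintegral_lintegral_m_mul _ φ hφ] at e
  rw [← e]
  refine lintegral_congr fun a => ?_
  rcases eq_or_ne (H.obsDensity x a) 0 with h0 | h0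
  · have h1 : H.step x.1.toMeasure a = 0 := Measure.measure_univ_eq_zero.1 h0
    rw [h0, h1, zero_mul, lintegral_zero_measure]
  · have htop := hreg.obsDensity_ne_top x a
    rw [filterUpdate_toMeasure H x a h0 htop, lintegral_smul_measure, smul_eq_mul, ← mul_assoc,
      ENNReal.mul_inv_cancel h0 htop, one_mul]
    rfl

theorem lintegral_lintegral_filterKernel_pow (hreg : H.IsRegular) (n : ℕ)
    (x : DensityProbability H.lam) {φ : S → ℝ≥0∞} (hφ : Measurable φ) :
    ∫⁻ y, ∫⁻ s, φ s ∂y.1.toMeasure ∂((H.filterKernel hreg ^ n) x) =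
      ∫⁻ s, φ s ∂(predict^[n] x).1.toMeasure := by
  induction n generalizing x with
  | zero =>
    change ∫⁻ y, _ ∂(Kernel.id x) = _
    rw [Kernel.id_apply, lintegral_dirac' _ (measurable_lintegral_toMeasure hφ)]
    rfl
  | succ n ih =>
    rw [Kernel.pow_add, Kernel.lintegral_comp _ _ _ (measurable_lintegral_toMeasure hφ), pow_one]
    simp_rw [ih, lintegral_predict_iterate _ hφ]
    rw [lintegral_lintegral_filterKernel hreg x hφ.lintegral_kernel,
      ← lintegral_predict_iterate _ hφ, ← lintegral_predict_iterate _ hφ,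
      Function.iterate_succ_apply]

end FilterKernel

end DensityHMM

/-! ### Tightness of the laws of the filter -/

namespace DensityHMM

universe v

variable {S : Type*} {A : Type v} [MeasurableSpace S] [MeasurableSpace A] {H : DensityHMM S A}
  {R C : ℝ≥0} {q : S → A → ℝ≥0}

open DensityProbability

variable (H) in
/-- The transition probability `P(s, ·)` as an element of `K`. -/
def transition (s : S) : DensityProbability H.lam :=
  ofDensity (fun t => (H.p s t : ℝ≥0∞)) (H.measurable_p_right s) (H.lintegral_p s)

theorem transition_toMeasure (s : S) : (H.transition s).1.toMeasure = H.markovKernel s :=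
  (H.markovKernel_eq s).symm

theorem measurable_transition [MeasurableSpace.CountablyGenerated S] :
    Measurable H.transition := by
  refine measurable_of_measurable_edist fun y => ?_
  have e : ∀ s, edist (H.transition s) y =
      densDist H.lam (fun t => (H.p s t : ℝ≥0∞)) fun t => (y.1.dens t : ℝ≥0∞) := by
    intro s
    conv_lhs => rw [← ofDensity_dens y]
    exact edist_ofDensity _ _ _ _
  simp_rw [e]
  have hy : Measurable fun z : S × S => (y.1.dens z.2 : ℝ≥0∞) :=
    y.1.measurable_dens.coe_nnreal_ennreal.comp measurable_snd
  exact ((H.measurable_p.sub hy).add (hy.sub H.measurable_p)).lintegral_prod_right'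

variable (H) in
/-- As `K` is separable, the state space has a countable measurable partition into cells on which
the transition probabilities vary little. -/
theorem exists_cells [MeasurableSpace.CountablyGenerated S] [Nonempty S] {e : ℝ} (he : 0 < e) :
    ∃ (P : ℕ → Set S) (s : ℕ → S), (∀ i, MeasurableSet (P i)) ∧
      (Pairwise fun i j => Disjoint (P i) (P j)) ∧ ⋃ i, P i = Set.univ ∧
      ∀ i, ∀ t ∈ P i, ENNReal.ofReal (tvDist (H.markovKernel t) (H.markovKernel (s i))) ≤
        ENNReal.ofReal e := by
  obtain ⟨Q, hQm, hQb, hQd, hQu, hQdisj⟩ :=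
    SeparableSpace.exists_measurable_partition_diam_le (DensityProbability H.lam) he
  have hs : ∀ i, ∃ s : S, (H.transition ⁻¹' Q i).Nonempty → s ∈ H.transition ⁻¹' Q i := by
    intro i
    by_cases h : (H.transition ⁻¹' Q i).Nonempty
    · exact ⟨h.some, fun _ => h.some_mem⟩
    · exact ⟨Classical.arbitrary S, fun h' => absurd h' h⟩
  choose s hs using hs
  refine ⟨fun i => H.transition ⁻¹' Q i, s, fun i => measurable_transition (hQm i),
    fun i j hij => (hQdisj hij).preimage _, ?_, fun i t ht => ?_⟩
  · rw [← Set.preimage_iUnion, hQu, Set.preimage_univ]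
  · rw [← transition_toMeasure, ← transition_toMeasure, ← edist_eq_ofReal_tvDist, edist_dist]
    exact ENNReal.ofReal_le_ofReal
      ((Metric.dist_le_diam_of_mem (hQb i) ht (hs i ⟨t, ht⟩)).trans (hQd i))

theorem lintegral_obsDensity_compl (hq : H.IsEmission q) (w : DensityProbability H.lam)
    (B : Set A) : ∫⁻ a in Bᶜ, H.obsDensity w a ∂H.tau =
      ∫⁻ t, ∫⁻ a in Bᶜ, (q t a : ℝ≥0∞) ∂H.tau ∂(predict w).1.toMeasure := by
  rw [lintegral_lintegral_swap hq.measurable.coe_nnreal_ennreal.aemeasurable]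
  refine lintegral_congr fun a => ?_
  change H.step w.1.toMeasure a Set.univ = _
  rw [hq.step_eq, withDensity_apply _ MeasurableSet.univ, Measure.restrict_univ]

section FilterKernel

variable [MetricSpace A] [SecondCountableTopology A] [BorelSpace A]

/-- The probability that one step of the filter enters a set `E`, if the update is outside `E`
for all observations in `B` with density at least `η`. -/
theorem filterKernel_le (hq : H.IsEmission q) (hreg : H.IsRegular) (w : DensityProbability H.lam)
    {E : Set (DensityProbability H.lam)} (hE : MeasurableSet E) {B : Set A}
    (hB : MeasurableSet B) {η : ℝ≥0∞}
    (h : ∀ a ∈ B, H.obsDensity w a ≠ 0 → η ≤ H.obsDensity w a → H.filterUpdate w a ∉ E) :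
    H.filterKernel hreg w E ≤
      ∫⁻ t, ∫⁻ a in Bᶜ, (q t a : ℝ≥0∞) ∂H.tau ∂(predict w).1.toMeasure + η * H.tau B := by
  have e : H.filterKernel hreg w E =
      ∫⁻ a, H.obsDensity w a * E.indicator 1 (H.filterUpdate w a) ∂H.tau := by
    rw [← lintegral_filterKernel hreg w (measurable_one.indicator hE), lintegral_indicator_one hE]
  have hg : Measurable (H.obsDensity w) :=
    hreg.measurable_obsDensity.comp (g := fun z : DensityProbability H.lam × A =>
      H.obsDensity z.1 z.2) (f := fun a => (w, a)) measurable_prodMk_left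
  rw [e, ← lintegral_obsDensity_compl hq, ← lintegral_indicator hB.compl,
    ← lintegral_indicator_const hB, ← lintegral_add_left (hg.indicator hB.compl)]
  refine lintegral_mono fun a => ?_
  have h1 : E.indicator (1 : DensityProbability H.lam → ℝ≥0∞) (H.filterUpdate w a) ≤ 1 :=
    Set.indicator_le_self' (fun _ _ => zero_le) _
  by_cases ha : a ∈ B
  · rw [Set.indicator_of_mem ha]
    rcases eq_or_ne (H.obsDensity w a) 0 with h0 | h0
    · rw [h0, zero_mul]
      exact zero_le
    rcases le_total η (H.obsDensity w a) with hle | hle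
    · rw [Set.indicator_of_notMem (h a ha h0 hle), mul_zero]
      exact zero_le
    · exact ((mul_le_mul' hle h1).trans_eq (mul_one η)).trans le_add_self
  · rw [Set.indicator_of_mem (Set.mem_compl ha)]
    exact ((mul_le_mul' le_rfl h1).trans_eq (mul_one _)).trans le_self_add

/-- The laws of the filter are tight. An update is determined by the observation, which is likely
to be in a compact set, and the last value `w` of the filter; the latter enters only through the
averages of the transition densities with respect to `w`, and these are close to combinations of
finitely many transition densities. -/
theorem isTightMeasureSet_range_filterKernel_pow [CompleteSpace A]
    [MeasurableSpace.CountablyGenerated S] (hq : H.IsEmission q) (hqR : ∀ t a, q t a ≤ R)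
    (hc : IsUniformlyContinuousEmission H.lam q) (hreg : H.IsRegular) {π : Measure S}
    (hπ : StronglyErgodicWith H.markovKernel π) (x : DensityProbability H.lam) :
    IsTightMeasureSet (Set.range fun n => (H.filterKernel hreg ^ n) x) := by
  have := hπ.1
  have : Nonempty S := nonempty_of_isProbabilityMeasure π
  refine isTightMeasureSet_range_of_infEDist (ι := Subtype.val) isometry_subtype_coe ?_
  intro ε hε δ hδ
  have hε3 : 0 < ε / 3 := ENNReal.div_pos hε.ne' (by norm_num)
  have hqm : Measurable fun z : S × A => (q z.1 z.2 : ℝ≥0∞) := hq.measurable.coe_nnreal_ennreal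
  have hqs : Measurable (Function.uncurry fun (a : A) (t : S) => (q t a : ℝ≥0∞)) :=
    hqm.comp measurable_swap
  -- the law of the observation in the stationary regime
  have hα : ∀ B : Set A, MeasurableSet B →
      H.tau.withDensity (fun a => ∫⁻ t, (q t a : ℝ≥0∞) ∂π) B =
        ∫⁻ t, ∫⁻ a in B, (q t a : ℝ≥0∞) ∂H.tau ∂π := by
    intro B hB
    rw [withDensity_apply _ hB, lintegral_lintegral_swap hqs.aemeasurable]
  have hαfin : IsFiniteMeasure (H.tau.withDensity fun a => ∫⁻ t, (q t a : ℝ≥0∞) ∂π) := by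
    refine ⟨?_⟩
    rw [hα _ MeasurableSet.univ, Measure.restrict_univ]
    simp [hq.lintegral_eq_one]
  obtain ⟨G, B, hG, hB, hBG, hBtau, hBα⟩ := exists_measurableSet_subset_isCompact H.tau
    (H.tau.withDensity fun a => ∫⁻ t, (q t a : ℝ≥0∞) ∂π) hε3
  rw [hα _ hB.compl] at hBα
  have hψm : Measurable fun t => ∫⁻ a in Bᶜ, (q t a : ℝ≥0∞) ∂H.tau :=
    hqm.lintegral_prod_right'
  have hψ1 : ∀ t, ∫⁻ a in Bᶜ, (q t a : ℝ≥0∞) ∂H.tau ≤ 1 := fun t =>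
    (setLIntegral_le_lintegral _ _).trans_eq (hq.lintegral_eq_one t)
  -- observations in `B` whose density is less than `η` have probability at most `ε / 3`
  obtain ⟨η', hη', hηle⟩ := exists_ofReal_mul_le hBtau hε3
  obtain ⟨η, rfl⟩ : ∃ η : ℝ≥0, (η : ℝ) = η' := ⟨⟨η', hη'.le⟩, rfl⟩
  rw [ENNReal.ofReal_coe_nnreal] at hηle
  have hη0 : (η : ℝ≥0∞) ≠ 0 := by
    rw [ENNReal.coe_ne_zero]
    exact fun h => hη'.ne' (by rw [h]; rfl)
  have hηi : (η : ℝ≥0∞)⁻¹ ≠ ∞ := ENNReal.inv_ne_top.2 hη0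
  obtain ⟨e, he, hele⟩ := exists_ofReal_mul_le (K := 4 * ((η : ℝ≥0∞)⁻¹ * R))
    (ENNReal.mul_ne_top (by norm_num) (ENNReal.mul_ne_top hηi ENNReal.coe_ne_top)) hδ
  have he0 : 0 < ENNReal.ofReal e := ENNReal.ofReal_pos.2 he
  obtain ⟨P, s, hP, hdisj, hPu, hs⟩ := H.exists_cells he
  have hUm : ∀ m : ℕ, MeasurableSet (⋃ i : Fin m, P i) := fun m =>
    MeasurableSet.iUnion fun i => hP i
  obtain ⟨m, hm⟩ := exists_measure_compl_lt π (U := fun m : ℕ => ⋃ i : Fin m, P i) hUm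
    (fun m n hmn => Set.iUnion_subset fun i =>
      Set.subset_iUnion_of_subset (Fin.castLE hmn i) subset_rfl)
    (Set.eq_univ_of_forall fun t => by
      obtain ⟨i, hi⟩ := Set.mem_iUnion.1 (hPu.symm ▸ Set.mem_univ t : t ∈ ⋃ i, P i)
      exact Set.mem_iUnion.2 ⟨i + 1, Set.mem_iUnion.2 ⟨Fin.last i, hi⟩⟩)
    (ε := ENNReal.ofReal e * (ε / 3)) (ENNReal.mul_pos he0.ne' hε3.ne')
  set U : Set S := ⋃ i : Fin m, P i with hU
  have hUc : MeasurableSet Uᶜ := (hUm m).compl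
  have hind : Measurable (Uᶜ.indicator (1 : S → ℝ≥0∞)) := measurable_one.indicator hUc
  have hindle : ∀ t, Uᶜ.indicator (1 : S → ℝ≥0∞) t ≤ 1 := fun t =>
    Set.indicator_le_self' (fun _ _ => zero_le) _
  have ev1 : ∀ᶠ n in atTop, (predict^[n] x).1.toMeasure Uᶜ < ENNReal.ofReal e * (ε / 3) := by
    have h := tendsto_lintegral_predict_iterate hπ x hind hindle
    simp_rw [lintegral_indicator_one hUc] at h
    exact h.eventually (gt_mem_nhds hm)
  have ev2 : ∀ᶠ n in atTop, ∫⁻ t, ∫⁻ a in Bᶜ, (q t a : ℝ≥0∞) ∂H.tau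
      ∂(predict^[n + 1] x).1.toMeasure < ε / 3 :=
    ((tendsto_lintegral_predict_iterate hπ x hψm hψ1).comp (tendsto_add_atTop_nat 1)).eventually
      (gt_mem_nhds hBα)
  refine ⟨(fun z : (Fin m → ℝ≥0) × A => emissionWeight hq hqR
      (H.predictFinite (∑ i, z.1 i • Measure.dirac (s i))) z.2) ''
      ((Set.univ.pi fun _ => Set.Icc 0 η⁻¹) ×ˢ G), ?_, ?_⟩
  · refine ((isCompact_univ_pi fun _ => isCompact_Icc).prod hG).image ?_
    have hcont := continuous_emissionWeight hq hqR hc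
    have hinner : Continuous fun z : (Fin m → ℝ≥0) × A =>
        (H.predictFinite (∑ i, z.1 i • Measure.dirac (s i)), z.2) :=
      ((continuous_predictFinite_sum_dirac fun i => s i).comp continuous_fst).prodMk continuous_snd
    generalize emissionWeight hq hqR = Φ at hcont ⊢
    exact Continuous.comp (g := fun z : FiniteDensityMeasure H.lam × A => Φ z.1 z.2) hcont hinner
  generalize hD : (fun z : (Fin m → ℝ≥0) × A => emissionWeight hq hqR
      (H.predictFinite (∑ i, z.1 i • Measure.dirac (s i))) z.2) ''
      ((Set.univ.pi fun _ => Set.Icc 0 η⁻¹) ×ˢ G) = D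
  have hEm : MeasurableSet {y : DensityProbability H.lam | δ < Metric.infEDist y.1 D} :=
    (isOpen_lt continuous_const
      (Metric.continuous_infEDist.comp continuous_subtype_val)).measurableSet
  -- the updates of a filter that gives small mass to the remaining cells are close to `D`
  have hgood : ∀ w : DensityProbability H.lam, w.1.toMeasure Uᶜ ≤ ENNReal.ofReal e →
      ∀ a ∈ B, H.obsDensity w a ≠ 0 → (η : ℝ≥0∞) ≤ H.obsDensity w a →
        H.filterUpdate w a ∉ {y : DensityProbability H.lam | δ < Metric.infEDist y.1 D} := by
    intro w hw a ha h0 hle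
    have hinv : (H.obsDensity w a)⁻¹ ≤ (η : ℝ≥0∞)⁻¹ := ENNReal.inv_le_inv.2 hle
    refine not_lt.2 ((Metric.infEDist_le_edist_of_mem (y := emissionWeight hq hqR
      (H.predictFinite (∑ i : Fin m, ((H.obsDensity w a)⁻¹ * w.1.toMeasure (P i)).toNNReal •
          Measure.dirac (s i))) a) ?_).trans
      ((edist_filterUpdate_le hq hqR hreg hP hdisj s hs m w a h0).trans ?_))
    · rw [← hD]
      refine ⟨(fun i : Fin m => ((H.obsDensity w a)⁻¹ * w.1.toMeasure (P i)).toNNReal, a),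
        ⟨fun i _ => ⟨zero_le, ?_⟩, hBG ha⟩, rfl⟩
      have h1 : (H.obsDensity w a)⁻¹ * w.1.toMeasure (P i) ≤ (η : ℝ≥0∞)⁻¹ :=
        (mul_le_mul' hinv prob_le_one).trans_eq (mul_one _)
      have h2 := ENNReal.toNNReal_mono hηi h1
      rwa [ENNReal.toNNReal_inv, ENNReal.toNNReal_coe] at h2
    · calc _ ≤ 2 * ((η : ℝ≥0∞)⁻¹ * (R * (ENNReal.ofReal e + ENNReal.ofReal e))) := by gcongr
        _ = ENNReal.ofReal e * (4 * ((η : ℝ≥0∞)⁻¹ * R)) := by ring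
        _ ≤ δ := hele
  have hstep : ∀ w : DensityProbability H.lam,
      H.filterKernel hreg w {y | δ < Metric.infEDist y.1 D} ≤
        {w : DensityProbability H.lam | ENNReal.ofReal e ≤ w.1.toMeasure Uᶜ}.indicator 1 w +
        (∫⁻ t, ∫⁻ t', ∫⁻ a in Bᶜ, (q t' a : ℝ≥0∞) ∂H.tau ∂H.markovKernel t ∂w.1.toMeasure +
          ε / 3) := by
    intro w
    by_cases hw : w.1.toMeasure Uᶜ ≤ ENNReal.ofReal e
    · refine le_trans ?_ le_add_self
      rw [← lintegral_predict w hψm]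
      refine (filterKernel_le hq hreg w hEm hB (hgood w hw)).trans ?_
      gcongr
    · rw [Set.indicator_of_mem (show w ∈ {w : DensityProbability H.lam | ENNReal.ofReal e ≤
        w.1.toMeasure Uᶜ} from (not_le.1 hw).le)]
      exact prob_le_one.trans le_self_add
  obtain ⟨N, hN⟩ := eventually_atTop.1 (ev1.and ev2)
  refine eventually_atTop.2 ⟨N + 1, fun n hn => ?_⟩
  obtain ⟨n, rfl⟩ := Nat.exists_eq_add_of_le' (le_of_add_le_right hn)
  obtain ⟨h1, h2⟩ := hN n (by omega)
  have hWm : MeasurableSet {w : DensityProbability H.lam | ENNReal.ofReal e ≤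
      w.1.toMeasure Uᶜ} :=
    measurableSet_le measurable_const (measurable_apply_toMeasure hUc)
  -- the mean of the filter is the prediction, so Markov's inequality applies
  have hmark : (H.filterKernel hreg ^ n) x {w | ENNReal.ofReal e ≤ w.1.toMeasure Uᶜ} ≤ ε / 3 := by
    have h3 := mul_meas_ge_le_lintegral (μ := (H.filterKernel hreg ^ n) x)
      (measurable_apply_toMeasure (lam := H.lam) hUc) (ENNReal.ofReal e)
    have h4 := lintegral_lintegral_filterKernel_pow hreg n x hind
    simp_rw [lintegral_indicator_one hUc] at h4
    rw [h4] at h3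
    exact (ENNReal.mul_le_mul_iff_right he0.ne' ENNReal.ofReal_ne_top).1 (h3.trans h1.le)
  have hPψ : Measurable fun t => ∫⁻ t', ∫⁻ a in Bᶜ, (q t' a : ℝ≥0∞) ∂H.tau ∂H.markovKernel t :=
    hψm.lintegral_kernel
  change (H.filterKernel hreg ^ (n + 1)) x _ ≤ ε
  rw [add_comm n 1, Kernel.pow_add, pow_one, Kernel.comp_apply' _ _ _ hEm]
  calc _ ≤ ∫⁻ w, ({w : DensityProbability H.lam | ENNReal.ofReal e ≤
            w.1.toMeasure Uᶜ}.indicator 1 w +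
          (∫⁻ t, ∫⁻ t', ∫⁻ a in Bᶜ, (q t' a : ℝ≥0∞) ∂H.tau ∂H.markovKernel t ∂w.1.toMeasure +
            ε / 3)) ∂((H.filterKernel hreg ^ n) x) := lintegral_mono hstep
    _ = (H.filterKernel hreg ^ n) x {w | ENNReal.ofReal e ≤ w.1.toMeasure Uᶜ} +
        (∫⁻ t, ∫⁻ a in Bᶜ, (q t a : ℝ≥0∞) ∂H.tau ∂(predict^[n + 1] x).1.toMeasure + ε / 3) := by
        rw [lintegral_add_left (measurable_one.indicator hWm), lintegral_indicator_one hWm,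
          lintegral_add_right _ measurable_const, lintegral_const, measure_univ, mul_one,
          lintegral_lintegral_filterKernel_pow hreg n x hPψ, Function.iterate_succ_apply',
          lintegral_predict _ hψm]
    _ ≤ ε / 3 + (ε / 3 + ε / 3) := by gcongr
    _ = ε := by rw [← add_assoc, ENNReal.add_thirds]

end FilterKernel

end DensityHMM

/-! ### Weak ergodicity -/

theorem tendsto_of_le_add {f e : ℕ → ℝ≥0∞} {L : ℝ≥0∞} (hL : L ≠ ∞)
    (he : Tendsto e atTop (𝓝 0)) (h1 : ∀ n, f n ≤ L + e n) (h2 : ∀ n, L ≤ f n + e n) :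
    Tendsto f atTop (𝓝 L) := by
  have h3 : Tendsto (fun n => L - e n) atTop (𝓝 L) := by
    simpa using ENNReal.Tendsto.sub (tendsto_const_nhds (x := L)) he (Or.inl hL)
  have h4 : Tendsto (fun n => L + e n) atTop (𝓝 L) := by
    simpa using (tendsto_const_nhds (x := L)).add he
  exact tendsto_of_tendsto_of_tendsto_of_le_of_le h3 h4 (fun n => tsub_le_iff_right.2 (h2 n)) h1

/-- On a space of diameter at most two, the convergence of the integrals of test functions implies
weak convergence. -/
theorem tendsto_integral_of_isTest {Y : Type*} [MetricSpace Y] [MeasurableSpace Y] [BorelSpace Y]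
    (hdiam : ∀ y z : Y, dist y z ≤ 2) {μ : ℕ → Measure Y} [∀ n, IsProbabilityMeasure (μ n)]
    {ν : Measure Y} [IsProbabilityMeasure ν]
    (h : ∀ u : Y → ℝ≥0∞, IsTest u →
      Tendsto (fun n => ∫⁻ y, u y ∂(μ n)) atTop (𝓝 (∫⁻ y, u y ∂ν))) (u : Y →ᵇ ℝ) :
    Tendsto (fun n => ∫ y, u y ∂(μ n)) atTop (𝓝 (∫ y, u y ∂ν)) := by
  obtain ⟨y₀⟩ := nonempty_of_isProbabilityMeasure ν
  obtain ⟨M, hM⟩ : ∃ M : ℕ → ProbabilityMeasure Y, ∀ n, (M n : Measure Y) = μ n :=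
    ⟨fun n => ⟨μ n, inferInstance⟩, fun n => rfl⟩
  obtain ⟨N, hN⟩ : ∃ N : ProbabilityMeasure Y, (N : Measure Y) = ν := ⟨⟨ν, inferInstance⟩, rfl⟩
  have hw : Tendsto M atTop (𝓝 N) := by
    rw [tendsto_iff_forall_lipschitz_integral_tendsto]
    rintro f ⟨C, hC⟩ ⟨L, hL⟩
    have hL0 : (L : ℝ) + 1 ≠ 0 := by positivity
    obtain ⟨g, hg⟩ : ∃ g : Y →ᵇ ℝ, ∀ y, g y = ((L : ℝ) + 1)⁻¹ * f y :=
      ⟨((L : ℝ) + 1)⁻¹ • BoundedContinuousFunction.mkOfBound ⟨f, hL.continuous⟩ C hC,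
        fun y => rfl⟩
    have hg1 : LipschitzWith 1 g := by
      refine LipschitzWith.of_dist_le_mul fun y z => ?_
      have h1 := hL.dist_le_mul y z
      rw [hg, hg, Real.dist_eq, ← mul_sub, abs_mul, abs_of_nonneg (by positivity),
        inv_mul_le_iff₀ (by positivity), NNReal.coe_one, one_mul]
      rw [Real.dist_eq] at h1
      have := dist_nonneg (x := y) (y := z)
      linarith
    obtain ⟨v, hv, c, hc⟩ := exists_isTest_integral_eq hdiam y₀ hg1
    have e : ∀ (ρ : Measure Y) [IsProbabilityMeasure ρ],
        ∫ y, f y ∂ρ = ((L : ℝ) + 1) * ((∫⁻ y, v y ∂ρ).toReal + c) := by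
      intro ρ _
      rw [← hc ρ]
      simp_rw [hg]
      rw [integral_const_mul, ← mul_assoc, mul_inv_cancel₀ hL0, one_mul]
    have ht := (ENNReal.tendsto_toReal (hv.lintegral_ne_top ν)).comp (h v hv)
    simp_rw [hM]
    rw [hN, e ν]
    simp_rw [fun n => e (μ n)]
    exact (ht.add_const c).const_mul _
  have hu := ProbabilityMeasure.tendsto_iff_forall_integral_tendsto.1 hw u
  simp_rw [hM, hN] at hu
  exact hu

namespace DensityHMM

universe v

variable {S : Type*} {A : Type v} [MeasurableSpace S] [MeasurableSpace A] {H : DensityHMM S A}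
  {R C : ℝ≥0}

section FilterKernel

variable [MetricSpace A] [SecondCountableTopology A] [BorelSpace A]

theorem lintegral_pow_le_four (hreg : H.IsRegular) {u : DensityProbability H.lam → ℝ≥0∞}
    (hu : IsTest u) (n : ℕ) (x : DensityProbability H.lam) :
    ∫⁻ y, u y ∂((H.filterKernel hreg ^ n) x) ≤ 4 :=
  (lintegral_mono hu.le).trans (by simp)

theorem tendsto_lintegral_testGap (hreg : H.IsRegular)
    (h : ∀ x y, Tendsto (testGap hreg x y) atTop (𝓝 0)) (y : DensityProbability H.lam)
    (ρ : Measure (DensityProbability H.lam)) [IsFiniteMeasure ρ] :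
    Tendsto (fun n => ∫⁻ z, (testGap hreg y z n + testGap hreg z y n) ∂ρ) atTop (𝓝 0) := by
  refine tendsto_lintegral_zero_of_le ρ (c := 8) (fun n z => ?_) fun z => ?_
  · have h4 : ∀ x y, testGap hreg x y n ≤ 4 := fun x y =>
      iSup_le fun u => tsub_le_self.trans (lintegral_pow_le_four hreg u.2 n x)
    calc _ ≤ (4 : ℝ≥0∞) + 4 := add_le_add (h4 y z) (h4 z y)
      _ = _ := by norm_num
  · simpa using (h y z).add (h z y)

/-- By contraction, the law of the filter at time `n` hardly depends on whether the initial value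
is fixed or random. -/
theorem lintegral_lintegral_pow_le (hreg : H.IsRegular) {u : DensityProbability H.lam → ℝ≥0∞}
    (hu : IsTest u) (n : ℕ) (y : DensityProbability H.lam)
    (ρ : Measure (DensityProbability H.lam)) [IsProbabilityMeasure ρ] :
    ∫⁻ z, ∫⁻ w, u w ∂((H.filterKernel hreg ^ n) z) ∂ρ ≤
        ∫⁻ w, u w ∂((H.filterKernel hreg ^ n) y) +
          ∫⁻ z, (testGap hreg y z n + testGap hreg z y n) ∂ρ ∧
      ∫⁻ w, u w ∂((H.filterKernel hreg ^ n) y) ≤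
        ∫⁻ z, ∫⁻ w, u w ∂((H.filterKernel hreg ^ n) z) ∂ρ +
          ∫⁻ z, (testGap hreg y z n + testGap hreg z y n) ∂ρ := by
  have hc : ∫⁻ w, u w ∂((H.filterKernel hreg ^ n) y) =
      ∫⁻ _, ∫⁻ w, u w ∂((H.filterKernel hreg ^ n) y) ∂ρ := by simp
  constructor
  · rw [hc, ← lintegral_add_left measurable_const]
    refine lintegral_mono fun z => (lintegral_pow_le_add_testGap hreg hu n z y).trans ?_
    gcongr
    exact le_add_self
  · rw [hc, ← lintegral_add_left hu.measurable.lintegral_kernel]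
    refine lintegral_mono fun z => (lintegral_pow_le_add_testGap hreg hu n y z).trans ?_
    gcongr
    exact le_self_add

/-- Contraction and tightness imply weak ergodicity: a limit point of the laws of the filter is
invariant by contraction, and all the laws converge to it by contraction again. -/
theorem weaklyErgodic_filterKernel [MeasurableSpace.CountablyGenerated S] (hH : H.IsBoundedBy C)
    (hreg : H.IsRegular) (h : ∀ x y, Tendsto (testGap hreg x y) atTop (𝓝 0))
    (x : DensityProbability H.lam)
    (htight : IsTightMeasureSet (Set.range fun n => (H.filterKernel hreg ^ n) x)) :
    WeaklyErgodic (H.filterKernel hreg) := by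
  refine ⟨weaklyContracting_filterKernel hreg h, ?_⟩
  set μ : ℕ → ProbabilityMeasure (DensityProbability H.lam) := fun n =>
    ⟨(H.filterKernel hreg ^ n) x, inferInstance⟩ with hμ
  have hcpt : IsCompact (closure (Set.range μ)) := by
    refine isCompact_closure_of_isTightMeasureSet (htight.subset ?_)
    rintro _ ⟨_, ⟨n, rfl⟩, rfl⟩
    exact ⟨n, rfl⟩
  obtain ⟨ν, -, hν⟩ := hcpt.ultrafilter_le_nhds ((hyperfilter ℕ).map μ) (by
    rw [le_principal_iff]
    exact Filter.mem_map.2 (Filter.univ_mem' fun n => subset_closure ⟨n, rfl⟩))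
  have hν' : Tendsto μ (hyperfilter ℕ) (𝓝 ν) := hν
  have hF : (hyperfilter ℕ : Filter ℕ) ≤ atTop := Nat.hyperfilter_le_atTop
  -- along the ultrafilter the law at time `n + k` tends to the image of `ν` under `k` steps
  have hlim : ∀ (u : DensityProbability H.lam → ℝ≥0∞), IsTest u → ∀ k,
      Tendsto (fun n => ∫⁻ y, u y ∂((H.filterKernel hreg ^ (n + k)) x)) (hyperfilter ℕ)
        (𝓝 (∫⁻ z, ∫⁻ y, u y ∂((H.filterKernel hreg ^ k) z) ∂(ν : Measure _))) := by
    intro u hu k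
    have hcont : Continuous fun z => ∫⁻ y, u y ∂((H.filterKernel hreg ^ k) z) :=
      continuous_of_le_add_edist 8 (by norm_num) fun y z =>
        lintegral_pow_le_add_edist hH hreg hu k y z
    have hne : ∀ z, ∫⁻ y, u y ∂((H.filterKernel hreg ^ k) z) ≠ ∞ := fun z => hu.lintegral_ne_top _
    have hcont' : Continuous fun z => (∫⁻ y, u y ∂((H.filterKernel hreg ^ k) z)).toNNReal :=
      ENNReal.continuousOn_toNNReal.comp_continuous hcont hne
    have hb : ∀ z, (∫⁻ y, u y ∂((H.filterKernel hreg ^ k) z)).toNNReal ≤ 4 := fun z => by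
      rw [← ENNReal.coe_le_coe, ENNReal.coe_toNNReal (hne z)]
      exact lintegral_pow_le_four hreg hu k z
    obtain ⟨f, hf⟩ : ∃ f : DensityProbability H.lam →ᵇ ℝ≥0,
        ∀ z, f z = (∫⁻ y, u y ∂((H.filterKernel hreg ^ k) z)).toNNReal :=
      ⟨BoundedContinuousFunction.mkOfBound ⟨_, hcont'⟩ 4 fun y z => by
        have h1 := NNReal.coe_le_coe.2 (hb y)
        have h2 := NNReal.coe_le_coe.2 (hb z)
        rw [NNReal.coe_ofNat] at h1 h2
        exact abs_le.2 ⟨(neg_le_neg h2).trans (by simp), (sub_le_self _ (by simp)).trans h1⟩,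
        fun z => rfl⟩
    have e := ProbabilityMeasure.tendsto_iff_forall_lintegral_tendsto.1 hν' f
    simp_rw [hf, ENNReal.coe_toNNReal (hne _)] at e
    refine e.congr fun n => ?_
    rw [add_comm n k, Kernel.pow_add, Kernel.lintegral_comp _ _ _ hu.measurable]
    rfl
  -- the laws at times `n` and `n + k` merge, as they differ by a random initial value only
  have hinv : ∀ (u : DensityProbability H.lam → ℝ≥0∞), IsTest u → ∀ k,
      ∫⁻ z, ∫⁻ y, u y ∂((H.filterKernel hreg ^ k) z) ∂(ν : Measure _) =
        ∫⁻ y, u y ∂(ν : Measure _) := by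
    intro u hu k
    have h0 := hlim u hu 0
    have e0 : ∀ z, ∫⁻ y, u y ∂((H.filterKernel hreg ^ 0) z) = u z := fun z => by
      change ∫⁻ y, u y ∂(Kernel.id z) = _
      rw [Kernel.id_apply, lintegral_dirac' _ hu.measurable]
    simp_rw [e0, add_zero] at h0
    have hk := hlim u hu k
    have hgap := (tendsto_lintegral_testGap hreg h x ((H.filterKernel hreg ^ k) x)).mono_left hF
    have hle : ∀ n, _ := fun n =>
      lintegral_lintegral_pow_le hreg hu n x ((H.filterKernel hreg ^ k) x)
    have ek : ∀ n, ∫⁻ z, ∫⁻ w, u w ∂((H.filterKernel hreg ^ n) z) ∂((H.filterKernel hreg ^ k) x) =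
        ∫⁻ y, u y ∂((H.filterKernel hreg ^ (n + k)) x) := fun n => by
      rw [Kernel.pow_add, Kernel.lintegral_comp _ _ _ hu.measurable]
    simp_rw [ek] at hle
    refine le_antisymm ?_ ?_
    · have := h0.add hgap
      rw [add_zero] at this
      exact le_of_tendsto_of_tendsto' hk this fun n => (hle n).1
    · have := hk.add hgap
      rw [add_zero] at this
      exact le_of_tendsto_of_tendsto' h0 this fun n => (hle n).2
  refine ⟨ν, inferInstance, fun u y => ?_⟩
  refine tendsto_integral_of_isTest dist_le_two (fun u hu => ?_) u
  refine tendsto_of_le_add (hu.lintegral_ne_top _)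
    (tendsto_lintegral_testGap hreg h y ν) (fun n => ?_) fun n => ?_
  · rw [← hinv u hu n]
    exact (lintegral_lintegral_pow_le hreg hu n y ν).2
  · rw [← hinv u hu n]
    exact (lintegral_lintegral_pow_le hreg hu n y ν).1

end FilterKernel

end DensityHMM

end

end HiddenMarkov

/-! ### The filter kernel of a model with emission densities -/

theorem theorem11p2 {S A : Type*}
    [MetricSpace S] [CompleteSpace S] [SecondCountableTopology S]
    [MeasurableSpace S] [BorelSpace S]
    [MetricSpace A] [CompleteSpace A] [SecondCountableTopology A]
    [MeasurableSpace A] [BorelSpace A]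
    (H : HiddenMarkov.DensityHMM S A) (q : S → A → ℝ≥0)
    (hq_meas : Measurable (Function.uncurry q))
    (hm : ∀ s t a, H.m s t a = H.p s t * q t a)
    (hq_int : ∀ t, ∫⁻ a, (q t a : ℝ≥0∞) ∂H.tau = 1)
    (hp_bdd : ∃ C : ℝ≥0, ∀ s t, H.p s t ≤ C)
    (hq_bdd : ∃ C : ℝ≥0, ∀ t a, q t a ≤ C)
    (hS_pos : ∀ a, 0 < H.lam {t | 0 < q t a})
    (hq_cont : ∀ ε : ℝ, 0 < ε → ∃ η : ℝ, 0 < η ∧ ∀ a b : A, dist a b < η →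
      H.lam (symmDiff {t | 0 < q t a} {t | 0 < q t b}) < ENNReal.ofReal ε ∧
      ∀ t ∈ {t | 0 < q t a} ∩ {t | 0 < q t b}, |(q t a : ℝ) - (q t b : ℝ)| < ε)
    (π : Measure S) (hπ : HiddenMarkov.StronglyErgodicWith H.markovKernel π)
    (F₀ : Set S) (hF₀ : MeasurableSet F₀) (B₀ : Set A) (hB₀ : MeasurableSet B₀)
    (hi : 0 < π F₀)
    (hii : 0 < H.tau B₀)
    (hiii : ∀ a ∈ B₀, {t | 0 < q t a} ⊆ F₀)
    (hiv : ∃ β₀ : ℝ, 0 < β₀ ∧ ∀ a ∈ B₀, ENNReal.ofReal β₀ ≤ H.lam {t | 0 < q t a})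
    (hv : ∃ c₀ : ℝ, 0 < c₀ ∧ ∀ a ∈ B₀, {t | 0 < q t a ∧ (q t a : ℝ) < c₀} = ∅)
    (hvi : ∃ c₁ : ℝ, 0 < c₁ ∧ ∀ s ∈ F₀, ∀ t ∈ F₀, c₁ ≤ (H.p s t : ℝ)) :
    ∃ hreg : H.IsRegular,
      HiddenMarkov.WeaklyContracting (H.filterKernel hreg) ∧
      (HiddenMarkov.UniformlyErgodic H.markovKernel →
        HiddenMarkov.WeaklyErgodic (H.filterKernel hreg)) := by
  obtain ⟨Cp, hp⟩ := hp_bdd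
  obtain ⟨Cq, hqC⟩ := hq_bdd
  obtain ⟨β₀, hβ₀, hiv⟩ := hiv
  obtain ⟨c₀, hc₀, hv⟩ := hv
  obtain ⟨c₁, hc₁, hvi⟩ := hvi
  have hq : H.IsEmission q := ⟨hq_meas, hm, hq_int⟩
  have hc : HiddenMarkov.IsUniformlyContinuousEmission H.lam q := hq_cont
  have hqR : ∀ t a, q t a ≤ max Cq 1 := fun t a => (hqC t a).trans (le_max_left _ _)
  have hreg : H.IsRegular := hq.isRegular hqC hc
  have hH := hq.isBoundedBy hp hqC
  have hmin := hq.isMinorizedOn hF₀ hB₀ hiii hiv hc₁ hv hvi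
  have hpos : ENNReal.ofReal (c₁ * c₀) * ENNReal.ofReal β₀ * H.tau B₀ ≠ 0 :=
    mul_ne_zero (mul_ne_zero (ENNReal.ofReal_pos.2 (mul_pos hc₁ hc₀)).ne'
      (ENNReal.ofReal_pos.2 hβ₀).ne') hii.ne'
  have hvan : H.Vanishes (max Cq 1) HiddenMarkov.DensityHMM.meanDeviation :=
    (hmin.vanishes_variance hH hpos hπ hi.ne').meanDeviation hH
  have hgap : ∀ x y, Tendsto (HiddenMarkov.DensityHMM.testGap hreg x y) atTop (𝓝 0) :=
    HiddenMarkov.DensityHMM.tendsto_testGap hH hreg hq (le_max_right _ _) hqR hvan hπ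
  refine ⟨hreg, HiddenMarkov.DensityHMM.weaklyContracting_filterKernel hreg hgap, fun _ => ?_⟩
  have := hπ.1
  obtain ⟨s⟩ := nonempty_of_isProbabilityMeasure π
  exact HiddenMarkov.DensityHMM.weaklyErgodic_filterKernel hH hreg hgap (H.transition s)
    (HiddenMarkov.DensityHMM.isTightMeasureSet_range_filterKernel_pow hq hqC hc hreg hπ _)
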